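/- Let $X$ be a scheme of finite type over $\mathbb C$ and $m\ge 1$ an integer. Let $F_\bullet=(F_1\xrightarrow{d}F_0)$ be a complex of coherent locally free sheaves on $X$. Put $\operatorname{Sym}^h=0$ for $h<0$ and $\Lambda^k=0$ for $k<0$, and write $d$ also for the Koszul differential $\operatorname{Sym}^hF_0\otimes\Lambda^kF_1\to\operatorname{Sym}^{h+1}F_0\otimes\Lambda^{k-1}F_1$, $$c\otimes b_1\wedge\dots\wedge b_k\mapsto\sum_{j}(-1)^{j-1}c\cdot d(b_j)\otimes b_1\wedge\dots\widehat{b_j}\dots\wedge b_k .$$ A *closed form* on $F_\bullet$ is a homomorphism $a:\mathcal O_X\to\operatorname{Sym}^mF_0\otimes F_1$ with $d\circ a=0$. For a closed point $x\in X$ let $H_{1,x}$ and $H_{0,x}$ be the kernel and the cokernel of the map $d_x:F_{1,x}\to F_{0,x}$ on fibres; a closed form $a$ induces an element of $\operatorname{Sym}^mH_{0,x}\otimes H_{1,x}$, that is, a linear map $S_x:H_{1,x}^\vee\to\operatorname{Sym}^mH_{0,x}$. The closed form is *nondegenerate* if for every closed point $x$ the image of $S_x$, regarded as a linear system of degree-$m$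 polynomials on $H_{0,x}^\vee$, has no base point: for every $v\in H_{0,x}^\vee\setminus\{0\}$ there is $w\in H_{1,x}^\vee$ with $S_x(w)(v)\neq0$. For a closed form $a$ and $0\le i\le m$ let $K_i^{p,q}=\operatorname{Sym}^{p+mq-i}F_0\otimes\Lambda^{q-p}F_1$, with the differentials $\tilde d$, of bidegree $(1,0)$, the Koszul differential, and $\tilde a$, of bidegree $(0,1)$, the multiplication by $a$. Let $(K_i^\bullet,D=\tilde d+\tilde a)$, $K_i^n=\bigoplus_{p+q=n}K_i^{p,q}$, be the total complex. Let $K_0(X)$ be the Grothendieck group of coherent locally free sheaves on $X$. A class $c\in K_0(X)$ is called a *class of* $K_i^\bullet$ if $$c=\sum_{n<n_0}(-1)^n[K_i^n]+(-1)^{n_0}\bigl[\operatorname{im}(K_i^{n_0-1}\to K_i^{n_0})\bigr]$$ for some integer $n_0$ such that, for all $n\ge n_0$, $H^n(K_i^\bullet)=0$ and $\operatorname{im}(K_i^{n-1}\to K_i^n)$ is locally free (the $K_i^n$ are locally free, and $0$ for $n\ll0$). Then the following hold. (0) If $a$ is a closed nondegenerate form on $F_\bullet$, then for each $0\le i\le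 m$ the complex $K_i^\bullet$ has exactly one class $\operatorname{cl}(K_i^\bullet)\in K_0(X)$. Hence the K-theory Euler class $\operatorname{Ke}(F_\bullet,a)=\sum_{0\le i\le m}\operatorname{cl}(K_i^\bullet)$ is well defined. (1) Let $a,a'$ be closed nondegenerate forms on $F_\bullet$ that are homotopic, that is, there is $h:\mathcal O_X\to\operatorname{Sym}^{m-1}F_0\otimes\Lambda^2F_1$ with $d\circ h=a-a'$. For $0\le i\le m$ let $\tilde h$ be the endomorphism of each $K_i^n$ given by multiplication by $h$. Then $\tilde h$ is nilpotent on each $K_i^n$, and the maps $e^{-\tilde h}=\sum_{j\ge0}(-\tilde h)^j/j!$ form an isomorphism of complexes $(K_i^\bullet,\tilde d+\tilde a')\to(K_i^\bullet,\tilde d+\tilde a)$. Moreover $\operatorname{Ke}(F_\bullet,a)=\operatorname{Ke}(F_\bullet,a')$. (2) Let $(\Phi_\bullet,\alpha)$ and $(F_\bullet,a)$ be two such complexes with closed nondegenerate forms, and let $f:\Phi_\bullet\to F_\bullet$ be a quasi-isomorphism with $a=(\operatorname{Sym}^mf_0\otimes f_1)\circ\alpha$. Let $\Gamma_i^\bullet$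 and $K_i^\bullet$ be the total complexes of $(\Phi_\bullet,\alpha)$ and $(F_\bullet,a)$. Then for $0\le i\le m$ the morphism $\Gamma_i^\bullet\to K_i^\bullet$ given by the maps $\operatorname{Sym}^{p+mq-i}f_0\otimes\Lambda^{q-p}f_1$ is a quasi-isomorphism, and $\operatorname{Ke}(F_\bullet,a)=\operatorname{Ke}(\Phi_\bullet,\alpha)$. (3) More generally, if $f:\Phi_\bullet\to F_\bullet$ is a quasi-isomorphism and $a$ is only homotopic to $(\operatorname{Sym}^mf_0\otimes f_1)\circ\alpha$, that is, $a-(\operatorname{Sym}^mf_0\otimes f_1)\circ\alpha=d\circ h$ for some $h:\mathcal O_X\to\operatorname{Sym}^{m-1}F_0\otimes\Lambda^2F_1$, then still $\operatorname{Ke}(F_\bullet,a)=\operatorname{Ke}(\Phi_\bullet,\alpha)$. -/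

import Mathlib

open TensorProduct CategoryTheory Limits AlgebraicGeometry Opposite

universe u

/-! ### The bigraded algebra `Sym M₀ ⊗ Λ M₁` of a linear map `M₁ → M₀` -/

/-- `Sym M₀ ⊗ Λ M₁`, the direct sum of all `Symʰ M₀ ⊗ Λᵏ M₁`. -/
abbrev SymExt (R M₀ M₁ : Type*) [CommRing R] [AddCommGroup M₀] [Module R M₀]
    [AddCommGroup M₁] [Module R M₁] : Type _ :=
  SymmetricAlgebra R M₀ ⊗[R] ExteriorAlgebra R M₁

namespace SymExt

section Basic

variable {R M₀ M₁ : Type*} [CommRing R] [AddCommGroup M₀] [Module R M₀]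
  [AddCommGroup M₁] [Module R M₁]

/-- The element `c₁ ⋯ c_h ⊗ b₁ ∧ ⋯ ∧ b_k`. -/
noncomputable def mono (c : List M₀) (b : List M₁) : SymExt R M₀ M₁ :=
  (c.map (SymmetricAlgebra.ι R M₀)).prod ⊗ₜ[R] (b.map (ExteriorAlgebra.ι R)).prod

variable (R M₀ M₁) in
/-- The summand `Symʰ M₀ ⊗ Λᵏ M₁` of `Sym M₀ ⊗ Λ M₁`. It is `0` if `h < 0` or `k < 0`. -/
noncomputable def piece (h k : ℤ) : Submodule R (SymExt R M₀ M₁) :=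
  Submodule.span R
    {x | ∃ (c : List M₀) (b : List M₁), (c.length : ℤ) = h ∧ (b.length : ℤ) = k ∧ x = mono c b}

variable (R M₀ M₁) in
/-- The sum over `p + q = n` of the terms `Sym^{p + m q - i} M₀ ⊗ Λ^{q - p} M₁`. -/
noncomputable def tot (m : ℕ) (i n : ℤ) : Submodule R (SymExt R M₀ M₁) :=
  ⨆ (p : ℤ) (q : ℤ) (_ : p + q = n), piece R M₀ M₁ (p + m * q - i) (q - p)

theorem mono_mul (c c' : List M₀) (b b' : List M₁) :
    (mono c b * mono c' b' : SymExt R M₀ M₁) = mono (c ++ c') (b ++ b') := by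
  simp [mono]

theorem mono_mem (c : List M₀) (b : List M₁) :
    mono c b ∈ piece R M₀ M₁ c.length b.length :=
  Submodule.subset_span ⟨c, b, rfl, rfl, rfl⟩

theorem piece_le_tot {m : ℕ} {i n : ℤ} (p q : ℤ) (hn : p + q = n) :
    piece R M₀ M₁ (p + m * q - i) (q - p) ≤ tot R M₀ M₁ m i n :=
  le_iSup_of_le p (le_iSup_of_le q (le_iSup_of_le hn le_rfl))

theorem mul_mem_piece {h k h' k' : ℤ} {x y : SymExt R M₀ M₁} (hx : x ∈ piece R M₀ M₁ h k)
    (hy : y ∈ piece R M₀ M₁ h' k') : x * y ∈ piece R M₀ M₁ (h + h') (k + k') := by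
  refine Submodule.span_induction₂ (p := fun x y _ _ => x * y ∈ piece R M₀ M₁ (h + h') (k + k'))
    ?_ ?_ ?_ ?_ ?_ ?_ ?_ hx hy
  · rintro _ _ ⟨c, b, hc, hb, rfl⟩ ⟨c', b', hc', hb', rfl⟩
    rw [mono_mul]
    refine Submodule.subset_span ⟨_, _, ?_, ?_, rfl⟩ <;> simp [*]
  · intro y _; simp
  · intro x _; simp
  · intro x y z _ _ _ h1 h2; rw [add_mul]; exact add_mem h1 h2
  · intro x y z _ _ _ h1 h2; rw [mul_add]; exact add_mem h1 h2
  · intro r x y _ _ h1; rw [smul_mul_assoc]; exact Submodule.smul_mem _ _ h1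
  · intro r x y _ _ h1; rw [mul_smul_comm]; exact Submodule.smul_mem _ _ h1

/-- A linear map sending every bihomogeneous part to the expected place preserves totals. -/
theorem tot_induction {m : ℕ} {i n : ℤ} {N : Type*} [AddCommGroup N] (f : SymExt R M₀ M₁ →+ N)
    (S : AddSubgroup N)
    (H : ∀ p q : ℤ, p + q = n → ∀ x ∈ piece R M₀ M₁ (p + m * q - i) (q - p), f x ∈ S)
    {x : SymExt R M₀ M₁} (hx : x ∈ tot R M₀ M₁ m i n) : f x ∈ S := by
  unfold tot at hx
  induction hx using Submodule.iSup_induction' with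
  | zero => simp
  | add x y _ _ h1 h2 => rw [map_add]; exact add_mem h1 h2
  | mem p x hx =>
    induction hx using Submodule.iSup_induction' with
    | zero => simp
    | add x y _ _ h1 h2 => rw [map_add]; exact add_mem h1 h2
    | mem q x hx =>
      induction hx using Submodule.iSup_induction' with
      | zero => simp
      | add x y _ _ h1 h2 => rw [map_add]; exact add_mem h1 h2
      | mem hn x hx => exact H p q hn x hx

theorem mul_mem_tot {m : ℕ} {i n n' h k : ℤ} (p₀ q₀ : ℤ) (hp : p₀ + m * q₀ = h) (hq : q₀ - p₀ = k)
    (hn : n + (p₀ + q₀) = n') {a x : SymExt R M₀ M₁} (ha : a ∈ piece R M₀ M₁ h k)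
    (hx : x ∈ tot R M₀ M₁ m i n) : a * x ∈ tot R M₀ M₁ m i n' := by
  refine tot_induction (AddMonoidHom.mulLeft a) (tot R M₀ M₁ m i n').toAddSubgroup ?_ hx
  intro p q hpq y hy
  refine piece_le_tot (p₀ + p) (q₀ + q) (by omega) ?_
  have := mul_mem_piece ha hy
  rw [AddMonoidHom.coe_mulLeft]
  convert this using 2
  · rw [← hp]; ring
  · rw [← hq]; ring

end Basic

section Differential

variable {R M₀ M₁ : Type*} [CommRing R] [AddCommGroup M₀] [Module R M₀]
  [AddCommGroup M₁] [Module R M₁] (d : M₁ →ₗ[R] M₀)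

/-- The recursion step `(b, x, y) ↦ d b ⊗ x - (1 ⊗ b) y`. -/
noncomputable def extDStep :
    M₁ →ₗ[R] ExteriorAlgebra R M₁ × SymExt R M₀ M₁ →ₗ[R] SymExt R M₀ M₁ :=
  LinearMap.mk₂ R
    (fun b xy => SymmetricAlgebra.ι R M₀ (d b) ⊗ₜ[R] xy.1 -
      (1 ⊗ₜ[R] ExteriorAlgebra.ι R b) * xy.2)
    (by intro b b' x; simp only [map_add, TensorProduct.add_tmul, TensorProduct.tmul_add, add_mul]; abel)
    (by
      intro r b x
      simp only [map_smul, ← TensorProduct.smul_tmul', TensorProduct.tmul_smul, smul_mul_assoc,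
        smul_sub])
    (by intro b x x'; simp only [Prod.fst_add, Prod.snd_add, TensorProduct.tmul_add, mul_add]; abel)
    (by
      intro r b x
      simp only [Prod.smul_fst, Prod.smul_snd, TensorProduct.tmul_smul, mul_smul_comm, smul_sub])

theorem extDStep_apply (b : M₁) (x : ExteriorAlgebra R M₁) (y : SymExt R M₀ M₁) :
    extDStep d b (x, y) =
      SymmetricAlgebra.ι R M₀ (d b) ⊗ₜ[R] x - (1 ⊗ₜ[R] ExteriorAlgebra.ι R b) * y := by
  rfl

/-- `b₁ ∧ ⋯ ∧ b_k ↦ ∑ⱼ (-1)^{j-1} d(bⱼ) ⊗ b₁ ∧ ⋯ (omit bⱼ) ⋯ ∧ b_k`. -/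
noncomputable def extD : ExteriorAlgebra R M₁ →ₗ[R] SymExt R M₀ M₁ :=
  CliffordAlgebra.foldr' (0 : QuadraticForm R M₁) (extDStep d) (by
    intro b x y
    have h2 : (ExteriorAlgebra.ι R b) * (ExteriorAlgebra.ι R b) = 0 := ExteriorAlgebra.ι_sq_zero b
    change extDStep d b (ExteriorAlgebra.ι R b * x, extDStep d b (x, y)) = _
    rw [extDStep_apply, extDStep_apply, mul_sub, ← mul_assoc]
    simp [h2]) 0

theorem extD_one : extD d 1 = 0 := by
  have := CliffordAlgebra.foldr'_algebraMap (0 : QuadraticForm R M₁) (extDStep d)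
    (by
    intro b x y
    have h2 : (ExteriorAlgebra.ι R b) * (ExteriorAlgebra.ι R b) = 0 := ExteriorAlgebra.ι_sq_zero b
    change extDStep d b (ExteriorAlgebra.ι R b * x, extDStep d b (x, y)) = _
    rw [extDStep_apply, extDStep_apply, mul_sub, ← mul_assoc]
    simp [h2]) 0 1
  rw [map_one, smul_zero] at this
  exact this

theorem extD_ι_mul (b : M₁) (x : ExteriorAlgebra R M₁) :
    extD d (ExteriorAlgebra.ι R b * x) =
      SymmetricAlgebra.ι R M₀ (d b) ⊗ₜ[R] x - (1 ⊗ₜ[R] ExteriorAlgebra.ι R b) * extD d x := by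
  rw [← extDStep_apply]
  exact CliffordAlgebra.foldr'_ι_mul (0 : QuadraticForm R M₁) (extDStep d) _ 0 b x

/-- The Koszul differential `Symʰ M₀ ⊗ Λᵏ M₁ → Symʰ⁺¹ M₀ ⊗ Λᵏ⁻¹ M₁` of `d : M₁ → M₀`. -/
noncomputable def koszul : SymExt R M₀ M₁ →ₗ[R] SymExt R M₀ M₁ :=
  TensorProduct.lift
    (((LinearMap.mul R (SymExt R M₀ M₁)).comp
      ((TensorProduct.mk R (SymmetricAlgebra R M₀) (ExteriorAlgebra R M₁)).flip 1)).compl₂ (extD d))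

theorem koszul_tmul (s : SymmetricAlgebra R M₀) (x : ExteriorAlgebra R M₁) :
    koszul d (s ⊗ₜ[R] x) = (s ⊗ₜ[R] 1) * extD d x := by
  simp [koszul]

theorem sym_comm (s : SymmetricAlgebra R M₀) (x : SymExt R M₀ M₁) :
    (s ⊗ₜ[R] 1) * x = x * (s ⊗ₜ[R] 1) := by
  induction x using TensorProduct.induction_on with
  | zero => simp
  | tmul t y => simp [mul_comm]
  | add x y hx hy => rw [mul_add, add_mul, hx, hy]

theorem koszul_sym_mul (s : SymmetricAlgebra R M₀) (x : SymExt R M₀ M₁) :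
    koszul d ((s ⊗ₜ[R] 1) * x) = (s ⊗ₜ[R] 1) * koszul d x := by
  induction x using TensorProduct.induction_on with
  | zero => simp
  | tmul t y =>
    rw [Algebra.TensorProduct.tmul_mul_tmul, one_mul, koszul_tmul, koszul_tmul, ← mul_assoc,
      Algebra.TensorProduct.tmul_mul_tmul, one_mul]
  | add x y hx hy => rw [mul_add, map_add, map_add, mul_add, hx, hy]

theorem koszul_ι_mul (b : M₁) (x : SymExt R M₀ M₁) :
    koszul d ((1 ⊗ₜ[R] ExteriorAlgebra.ι R b) * x) =
      (SymmetricAlgebra.ι R M₀ (d b) ⊗ₜ[R] 1) * x -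
        (1 ⊗ₜ[R] ExteriorAlgebra.ι R b) * koszul d x := by
  induction x using TensorProduct.induction_on with
  | zero => simp
  | tmul t y =>
    rw [Algebra.TensorProduct.tmul_mul_tmul, one_mul, koszul_tmul, koszul_tmul, extD_ι_mul,
      mul_sub, ← mul_assoc, ← mul_assoc, Algebra.TensorProduct.tmul_mul_tmul,
      Algebra.TensorProduct.tmul_mul_tmul, Algebra.TensorProduct.tmul_mul_tmul,
      Algebra.TensorProduct.tmul_mul_tmul]
    simp [mul_comm]
  | add x y hx hy => rw [mul_add, map_add, map_add, mul_add, mul_add, hx, hy]; abel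

theorem mono_cons (c : List M₀) (b : M₁) (l : List M₁) :
    (mono c (b :: l) : SymExt R M₀ M₁) = (1 ⊗ₜ[R] ExteriorAlgebra.ι R b) * mono c l := by
  simp [mono]

theorem sym_mul_mono (c₀ : M₀) (c : List M₀) (l : List M₁) :
    (SymmetricAlgebra.ι R M₀ c₀ ⊗ₜ[R] 1) * (mono c l : SymExt R M₀ M₁) = mono (c₀ :: c) l := by
  simp [mono]

theorem koszul_mono_nil (c : List M₀) : koszul d (mono c []) = 0 := by
  simp [mono, koszul_tmul, extD_one]

/-- `Sym M₀ ⊗ Λ M₁` is spanned by the elements `c₁ ⋯ c_h ⊗ b₁ ∧ ⋯ ∧ b_k`. -/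
theorem span_mono : Submodule.span R {x : SymExt R M₀ M₁ | ∃ c b, x = mono c b} = ⊤ := by
  set S := Submodule.span R {x : SymExt R M₀ M₁ | ∃ c b, x = mono c b} with hS
  have hm : ∀ x ∈ S, ∀ y ∈ S, x * y ∈ S := by
    intro x hx y hy
    refine Submodule.span_induction₂ (p := fun x y _ _ => x * y ∈ S) ?_ ?_ ?_ ?_ ?_ ?_ ?_ hx hy
    · rintro _ _ ⟨c, b, rfl⟩ ⟨c', b', rfl⟩
      rw [mono_mul]
      exact Submodule.subset_span ⟨_, _, rfl⟩
    · intro y _; simp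
    · intro x _; simp
    · intro x y z _ _ _ h1 h2; rw [add_mul]; exact add_mem h1 h2
    · intro x y z _ _ _ h1 h2; rw [mul_add]; exact add_mem h1 h2
    · intro r x y _ _ h1; rw [smul_mul_assoc]; exact Submodule.smul_mem _ _ h1
    · intro r x y _ _ h1; rw [mul_smul_comm]; exact Submodule.smul_mem _ _ h1
  have h1 : (1 : SymExt R M₀ M₁) ∈ S :=
    Submodule.subset_span ⟨[], [], by simp [mono, Algebra.TensorProduct.one_def]⟩
  have hs : ∀ s : SymmetricAlgebra R M₀, s ⊗ₜ[R] (1 : ExteriorAlgebra R M₁) ∈ S := by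
    intro s
    induction s using SymmetricAlgebra.induction with
    | algebraMap r =>
      rw [Algebra.algebraMap_eq_smul_one, ← TensorProduct.smul_tmul']
      exact Submodule.smul_mem _ _ h1
    | ι x => exact Submodule.subset_span ⟨[x], [], by simp [mono]⟩
    | mul a b ha hb => simpa using hm _ ha _ hb
    | add a b ha hb => rw [TensorProduct.add_tmul]; exact add_mem ha hb
  have hl : ∀ s : ExteriorAlgebra R M₁, (1 : SymmetricAlgebra R M₀) ⊗ₜ[R] s ∈ S := by
    intro s
    induction s using ExteriorAlgebra.induction with
    | algebraMap r =>
      rw [Algebra.algebraMap_eq_smul_one, TensorProduct.tmul_smul]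
      exact Submodule.smul_mem _ _ h1
    | ι x => exact Submodule.subset_span ⟨[], [x], by simp [mono]⟩
    | mul a b ha hb => simpa using hm _ ha _ hb
    | add a b ha hb => rw [TensorProduct.tmul_add]; exact add_mem ha hb
  rw [eq_top_iff]
  rintro x -
  induction x using TensorProduct.induction_on with
  | zero => simp
  | tmul t y => simpa using hm _ (hs t) _ (hl y)
  | add x y hx hy => exact add_mem hx hy

/-- Two additive maps that are semilinear and agree on monomials are equal. -/
theorem mono_induction {motive : SymExt R M₀ M₁ → Prop} (h0 : motive 0)
    (hadd : ∀ x y, motive x → motive y → motive (x + y))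
    (hsmul : ∀ (r : R) x, motive x → motive (r • x))
    (hmono : ∀ c b, motive (mono c b)) (x : SymExt R M₀ M₁) : motive x := by
  have hx : x ∈ Submodule.span R {x : SymExt R M₀ M₁ | ∃ c b, x = mono c b} := by
    rw [span_mono]; trivial
  induction hx using Submodule.span_induction with
  | mem x h => obtain ⟨c, b, rfl⟩ := h; exact hmono c b
  | zero => exact h0
  | add x y _ _ h1 h2 => exact hadd _ _ h1 h2
  | smul r x _ h => exact hsmul _ _ h

theorem koszul_mono_mem (c : List M₀) (b : List M₁) :
    koszul d (mono c b) ∈ piece R M₀ M₁ (c.length + 1) (b.length - 1) := by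
  induction b with
  | nil => rw [koszul_mono_nil]; exact zero_mem _
  | cons b l ih =>
    rw [mono_cons, koszul_ι_mul, sym_mul_mono]
    refine sub_mem (Submodule.subset_span ⟨_, _, by simp, by simp, rfl⟩) ?_
    have h : (1 ⊗ₜ[R] ExteriorAlgebra.ι R b : SymExt R M₀ M₁) ∈ piece R M₀ M₁ 0 1 :=
      Submodule.subset_span ⟨[], [b], by simp, by simp, by simp [mono]⟩
    have := mul_mem_piece h ih
    convert this using 2
    · ring
    · push_cast [List.length_cons]; ring

theorem koszul_mem_piece {h k : ℤ} {x : SymExt R M₀ M₁} (hx : x ∈ piece R M₀ M₁ h k) :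
    koszul d x ∈ piece R M₀ M₁ (h + 1) (k - 1) := by
  induction hx using Submodule.span_induction with
  | mem x h => obtain ⟨c, b, rfl, rfl, rfl⟩ := h; exact koszul_mono_mem d c b
  | zero => simp
  | add x y _ _ h1 h2 => rw [map_add]; exact add_mem h1 h2
  | smul r x _ h => rw [map_smul]; exact Submodule.smul_mem _ _ h

theorem koszul_mem_tot {m : ℕ} {i n : ℤ} {x : SymExt R M₀ M₁} (hx : x ∈ tot R M₀ M₁ m i n) :
    koszul d x ∈ tot R M₀ M₁ m i (n + 1) := by
  refine tot_induction (koszul d).toAddMonoidHom (tot R M₀ M₁ m i (n + 1)).toAddSubgroup ?_ hx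
  intro p q hpq y hy
  refine piece_le_tot (p + 1) q (by omega) ?_
  have := koszul_mem_piece d hy
  change koszul d y ∈ _
  convert this using 2 <;> ring

theorem koszul_koszul (x : SymExt R M₀ M₁) : koszul d (koszul d x) = 0 := by
  induction x using mono_induction with
  | h0 => simp
  | hadd x y hx hy => rw [map_add, map_add, hx, hy, add_zero]
  | hsmul r x hx => rw [map_smul, map_smul, hx, smul_zero]
  | hmono c b =>
    induction b with
    | nil => rw [koszul_mono_nil, map_zero]
    | cons b l ih =>
      rw [mono_cons, koszul_ι_mul, map_sub, koszul_sym_mul, koszul_ι_mul, ih]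
      simp

/-- The elements of `Symʰ M₀ ⊗ Λ¹ M₁` are sums of elements `s ⊗ b`. -/
theorem piece_one_induction {h : ℤ} (motive : SymExt R M₀ M₁ → Prop) (h0 : motive 0)
    (hadd : ∀ x y, x ∈ piece R M₀ M₁ h 1 → y ∈ piece R M₀ M₁ h 1 →
      motive x → motive y → motive (x + y))
    (hsmul : ∀ (r : R) x, motive x → motive (r • x))
    (hmono : ∀ (s : SymmetricAlgebra R M₀) (b : M₁),
      motive ((s ⊗ₜ[R] 1) * (1 ⊗ₜ[R] ExteriorAlgebra.ι R b)))
    {x : SymExt R M₀ M₁} (hx : x ∈ piece R M₀ M₁ h 1) : motive x := by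
  induction hx using Submodule.span_induction with
  | mem x h =>
    obtain ⟨c, b, -, hb, rfl⟩ := h
    have hb' : b.length = 1 := by exact_mod_cast hb
    obtain ⟨b, rfl⟩ := List.length_eq_one_iff.mp hb'
    convert hmono (c.map (SymmetricAlgebra.ι R M₀)).prod b using 1
    simp [mono]
  | zero => exact h0
  | add x y hx hy h1 h2 => exact hadd _ _ hx hy h1 h2
  | smul r x _ h => exact hsmul _ _ h

theorem koszul_mul {h : ℤ} {a : SymExt R M₀ M₁} (ha : a ∈ piece R M₀ M₁ h 1)
    (x : SymExt R M₀ M₁) : koszul d (a * x) = koszul d a * x - a * koszul d x := by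
  refine piece_one_induction (fun a => koszul d (a * x) = koszul d a * x - a * koszul d x)
    ?_ ?_ ?_ ?_ ha
  · simp
  · intro a b _ _ h1 h2
    simp only [add_mul, map_add, h1, h2]; abel
  · intro r a h1
    simp only [smul_mul_assoc, map_smul, h1, smul_sub]
  · intro s b
    have h1 : koszul d (1 ⊗ₜ[R] ExteriorAlgebra.ι R b) =
        (SymmetricAlgebra.ι R M₀ (d b) ⊗ₜ[R] 1) := by
      have := koszul_ι_mul d b 1
      rw [mul_one, mul_one] at this
      rw [this, Algebra.TensorProduct.one_def, koszul_tmul, extD_one]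
      simp
    rw [mul_assoc, koszul_sym_mul, koszul_ι_mul, koszul_sym_mul, h1, mul_sub, ← mul_assoc,
      ← mul_assoc]

theorem ι_mul_ι (b b' : M₁) : ExteriorAlgebra.ι R b * ExteriorAlgebra.ι R b' =
    - (ExteriorAlgebra.ι R b' * ExteriorAlgebra.ι R b) :=
  eq_neg_of_add_eq_zero_left (ExteriorAlgebra.ι_add_mul_swap b b')

theorem anticomm {h : ℤ} {a a' : SymExt R M₀ M₁} (ha : a ∈ piece R M₀ M₁ h 1)
    (ha' : a' ∈ piece R M₀ M₁ h 1) : a * a' + a' * a = 0 := by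
  refine piece_one_induction (fun a => a * a' + a' * a = 0) ?_ ?_ ?_ ?_ ha
  · simp
  · intro a b _ _ h1 h2
    rw [add_mul, mul_add, add_add_add_comm, h1, h2, add_zero]
  · intro r a h1
    rw [smul_mul_assoc, mul_smul_comm, ← smul_add, h1, smul_zero]
  · intro s b
    refine piece_one_induction (fun a' => _ * a' + a' * _ = 0) ?_ ?_ ?_ ?_ ha'
    · simp
    · intro x y _ _ h1 h2
      rw [mul_add, add_mul, add_add_add_comm, h1, h2, add_zero]
    · intro r x h1
      rw [mul_smul_comm, smul_mul_assoc, ← smul_add, h1, smul_zero]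
    · intro t b'
      simp only [Algebra.TensorProduct.tmul_mul_tmul, one_mul, mul_one]
      rw [ι_mul_ι b b', TensorProduct.tmul_neg, mul_comm s t, neg_add_cancel]

theorem mul_self {h : ℤ} {a : SymExt R M₀ M₁} (ha : a ∈ piece R M₀ M₁ h 1) : a * a = 0 := by
  refine piece_one_induction (fun a => a * a = 0) ?_ ?_ ?_ ?_ ha
  · simp
  · intro x y hx hy h1 h2
    rw [add_mul, mul_add, mul_add, h1, h2, zero_add, add_zero, anticomm hx hy]
  · intro r a h1
    rw [smul_mul_assoc, mul_smul_comm, h1, smul_zero, smul_zero]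
  · intro s b
    simp

/-- The total differential `D = d̃ + ã`, where `ã` multiplies by `a` on the left. -/
noncomputable def totD (a : SymExt R M₀ M₁) : SymExt R M₀ M₁ →ₗ[R] SymExt R M₀ M₁ :=
  koszul d + LinearMap.mulLeft R a

theorem totD_apply (a x : SymExt R M₀ M₁) : totD d a x = koszul d x + a * x := rfl

theorem totD_totD {h : ℤ} {a : SymExt R M₀ M₁} (ha : a ∈ piece R M₀ M₁ h 1)
    (hd : koszul d a = 0) (x : SymExt R M₀ M₁) : totD d a (totD d a x) = 0 := by
  rw [totD_apply, totD_apply, map_add, koszul_koszul, koszul_mul d ha, hd, mul_add, ← mul_assoc,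
    mul_self ha]
  simp

theorem totD_mem_tot {m : ℕ} {i n : ℤ} {a x : SymExt R M₀ M₁} (ha : a ∈ piece R M₀ M₁ m 1)
    (hx : x ∈ tot R M₀ M₁ m i n) : totD d a x ∈ tot R M₀ M₁ m i (n + 1) :=
  add_mem (koszul_mem_tot d hx)
    (mul_mem_tot (n' := n + 1) 0 1 (by simp) (by simp) (by simp) ha hx)

end Differential

section Map

variable {R R' M₀ M₁ M₀' M₁' : Type*} [CommRing R] [CommRing R']
  [AddCommGroup M₀] [Module R M₀] [AddCommGroup M₁] [Module R M₁]
  [AddCommGroup M₀'] [Module R' M₀'] [AddCommGroup M₁'] [Module R' M₁']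
  (φ : R →+* R') (g₀ : M₀ →ₛₗ[φ] M₀') (g₁ : M₁ →ₛₗ[φ] M₁')

/-- The ring homomorphism `Sym M₀ → Sym M₀'` induced by a semilinear map. -/
noncomputable def symMap : SymmetricAlgebra R M₀ →+* SymmetricAlgebra R' M₀' :=
  letI : Algebra R (SymmetricAlgebra R' M₀') :=
    ((algebraMap R' (SymmetricAlgebra R' M₀')).comp φ).toAlgebra
  (SymmetricAlgebra.lift
    ({ toFun := fun x => SymmetricAlgebra.ι R' M₀' (g₀ x)
       map_add' := by intro x y; simp
       map_smul' := by
        intro r x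
        rw [LinearMap.map_smulₛₗ, LinearMap.map_smul, Algebra.smul_def, Algebra.smul_def]; rfl } :
      M₀ →ₗ[R] SymmetricAlgebra R' M₀')).toRingHom

theorem symMap_ι (x : M₀) :
    symMap φ g₀ (SymmetricAlgebra.ι R M₀ x) = SymmetricAlgebra.ι R' M₀' (g₀ x) := by
  simp [symMap]

theorem symMap_algebraMap (r : R) :
    symMap φ g₀ (algebraMap R _ r) = algebraMap R' _ (φ r) := by
  let _ : Algebra R (SymmetricAlgebra R' M₀') :=
    ((algebraMap R' (SymmetricAlgebra R' M₀')).comp φ).toAlgebra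
  exact AlgHom.commutes (SymmetricAlgebra.lift
    ({ toFun := fun x => SymmetricAlgebra.ι R' M₀' (g₀ x)
       map_add' := by intro x y; simp
       map_smul' := by
        intro r x
        rw [LinearMap.map_smulₛₗ, LinearMap.map_smul, Algebra.smul_def, Algebra.smul_def]; rfl } :
      M₀ →ₗ[R] SymmetricAlgebra R' M₀')) r

/-- The ring homomorphism `Λ M₁ → Λ M₁'` induced by a semilinear map. -/
noncomputable def extMap : ExteriorAlgebra R M₁ →+* ExteriorAlgebra R' M₁' :=
  letI : Algebra R (ExteriorAlgebra R' M₁') :=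
    ((algebraMap R' (ExteriorAlgebra R' M₁')).comp φ).toAlgebra'
      (fun c x => Algebra.commutes (φ c) x)
  (ExteriorAlgebra.lift R ⟨({ toFun := fun x => ExteriorAlgebra.ι R' (g₁ x)
                              map_add' := by intro x y; simp
                              map_smul' := by
                                intro r x
                                rw [LinearMap.map_smulₛₗ, LinearMap.map_smul, Algebra.smul_def,
                                  Algebra.smul_def]; rfl } :
      M₁ →ₗ[R] ExteriorAlgebra R' M₁'), fun x => ExteriorAlgebra.ι_sq_zero (g₁ x)⟩).toRingHom

theorem extMap_ι (x : M₁) :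
    extMap φ g₁ (ExteriorAlgebra.ι R x) = ExteriorAlgebra.ι R' (g₁ x) := by
  let _ : Algebra R (ExteriorAlgebra R' M₁') :=
    ((algebraMap R' (ExteriorAlgebra R' M₁')).comp φ).toAlgebra'
      (fun c x => Algebra.commutes (φ c) x)
  exact ExteriorAlgebra.lift_ι_apply R _ _ x

theorem extMap_algebraMap (r : R) :
    extMap φ g₁ (algebraMap R _ r) = algebraMap R' _ (φ r) := by
  let _ : Algebra R (ExteriorAlgebra R' M₁') :=
    ((algebraMap R' (ExteriorAlgebra R' M₁')).comp φ).toAlgebra'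
      (fun c x => Algebra.commutes (φ c) x)
  unfold extMap
  exact AlgHom.commutes _ r

/-- The ring homomorphism `Sym M₀ ⊗ Λ M₁ → Sym M₀' ⊗ Λ M₁'` induced by two semilinear maps. -/
noncomputable def map : SymExt R M₀ M₁ →+* SymExt R' M₀' M₁' :=
  letI : Algebra R (SymExt R' M₀' M₁') :=
    ((algebraMap R' (SymExt R' M₀' M₁')).comp φ).toAlgebra' (fun c x => Algebra.commutes (φ c) x)
  let f₀ : SymmetricAlgebra R M₀ →ₐ[R] SymExt R' M₀' M₁' :=
    { toRingHom := (Algebra.TensorProduct.includeLeft :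
        SymmetricAlgebra R' M₀' →ₐ[R'] SymExt R' M₀' M₁').toRingHom.comp (symMap φ g₀)
      commutes' := fun r =>
        (congrArg _ (symMap_algebraMap φ g₀ r)).trans
          (AlgHom.commutes (Algebra.TensorProduct.includeLeft :
            SymmetricAlgebra R' M₀' →ₐ[R'] SymExt R' M₀' M₁') (φ r)) }
  let f₁ : ExteriorAlgebra R M₁ →ₐ[R] SymExt R' M₀' M₁' :=
    { toRingHom := (Algebra.TensorProduct.includeRight :
        ExteriorAlgebra R' M₁' →ₐ[R'] SymExt R' M₀' M₁').toRingHom.comp (extMap φ g₁)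
      commutes' := fun r =>
        (congrArg _ (extMap_algebraMap φ g₁ r)).trans
          (AlgHom.commutes (Algebra.TensorProduct.includeRight :
            ExteriorAlgebra R' M₁' →ₐ[R'] SymExt R' M₀' M₁') (φ r)) }
  (Algebra.TensorProduct.lift f₀ f₁ (fun s x => sym_comm (symMap φ g₀ s) (f₁ x))).toRingHom

theorem map_tmul (s : SymmetricAlgebra R M₀) (x : ExteriorAlgebra R M₁) :
    map φ g₀ g₁ (s ⊗ₜ[R] x) = symMap φ g₀ s ⊗ₜ[R'] extMap φ g₁ x := by
  let _ : Algebra R (SymExt R' M₀' M₁') :=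
    ((algebraMap R' (SymExt R' M₀' M₁')).comp φ).toAlgebra' (fun c x => Algebra.commutes (φ c) x)
  refine (Algebra.TensorProduct.lift_tmul _ _ _ s x).trans ?_
  change (symMap φ g₀ s ⊗ₜ[R'] (1 : ExteriorAlgebra R' M₁')) *
    ((1 : SymmetricAlgebra R' M₀') ⊗ₜ[R'] extMap φ g₁ x) = _
  simp

theorem map_ι₀ (x : M₀) : map φ g₀ g₁ (SymmetricAlgebra.ι R M₀ x ⊗ₜ[R] 1) =
    SymmetricAlgebra.ι R' M₀' (g₀ x) ⊗ₜ[R'] 1 := by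
  rw [map_tmul, symMap_ι, map_one]

theorem map_ι₁ (x : M₁) : map φ g₀ g₁ (1 ⊗ₜ[R] ExteriorAlgebra.ι R x) =
    1 ⊗ₜ[R'] ExteriorAlgebra.ι R' (g₁ x) := by
  rw [map_tmul, extMap_ι, map_one]

theorem map_algebraMap (r : R) : map φ g₀ g₁ (algebraMap R _ r) = algebraMap R' _ (φ r) := by
  rw [Algebra.TensorProduct.algebraMap_apply, map_tmul, symMap_algebraMap, map_one,
    Algebra.TensorProduct.algebraMap_apply]

theorem map_smul' (r : R) (x : SymExt R M₀ M₁) : map φ g₀ g₁ (r • x) = φ r • map φ g₀ g₁ x := by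
  have h1 : r • x = algebraMap R _ r * x := Algebra.smul_def r x
  have h2 : φ r • map φ g₀ g₁ x = algebraMap R' _ (φ r) * map φ g₀ g₁ x :=
    Algebra.smul_def (φ r) (map φ g₀ g₁ x)
  rw [h1, h2, map_mul, map_algebraMap]

theorem map_mono (c : List M₀) (b : List M₁) :
    map φ g₀ g₁ (mono c b) = mono (c.map g₀) (b.map g₁) := by
  induction b with
  | nil =>
    induction c with
    | nil => simp [mono, ← Algebra.TensorProduct.one_def]
    | cons c l ih => rw [← sym_mul_mono, map_mul, ih, map_ι₀, sym_mul_mono]; rfl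
  | cons b l ih => rw [mono_cons, map_mul, ih, map_ι₁]; simp [mono_cons]

theorem map_mem_piece {h k : ℤ} {x : SymExt R M₀ M₁} (hx : x ∈ piece R M₀ M₁ h k) :
    map φ g₀ g₁ x ∈ piece R' M₀' M₁' h k := by
  induction hx using Submodule.span_induction with
  | mem x h =>
    obtain ⟨c, b, rfl, rfl, rfl⟩ := h
    rw [map_mono]
    exact Submodule.subset_span ⟨_, _, by simp, by simp, rfl⟩
  | zero => simp
  | add x y _ _ h1 h2 => rw [map_add]; exact add_mem h1 h2
  | smul r x _ h => rw [map_smul']; exact Submodule.smul_mem _ _ h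

theorem map_mem_tot {m : ℕ} {i n : ℤ} {x : SymExt R M₀ M₁} (hx : x ∈ tot R M₀ M₁ m i n) :
    map φ g₀ g₁ x ∈ tot R' M₀' M₁' m i n := by
  refine tot_induction (map φ g₀ g₁).toAddMonoidHom (tot R' M₀' M₁' m i n).toAddSubgroup ?_ hx
  intro p q hpq y hy
  exact piece_le_tot p q hpq (map_mem_piece φ g₀ g₁ hy)

theorem map_koszul (d : M₁ →ₗ[R] M₀) (d' : M₁' →ₗ[R'] M₀') (h : ∀ x, g₀ (d x) = d' (g₁ x))
    (x : SymExt R M₀ M₁) : map φ g₀ g₁ (koszul d x) = koszul d' (map φ g₀ g₁ x) := by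
  induction x using mono_induction with
  | h0 => simp
  | hadd x y hx hy => simp only [map_add, hx, hy]
  | hsmul r x hx =>
    rw [LinearMap.map_smul, map_smul', map_smul', LinearMap.map_smul, hx]
  | hmono c b =>
    induction b with
    | nil => rw [koszul_mono_nil, map_zero, map_mono, List.map_nil, koszul_mono_nil]
    | cons b l ih =>
      rw [mono_cons, koszul_ι_mul, map_sub, map_mul, map_mul, map_mul, ih, map_ι₁, map_ι₀, h,
        koszul_ι_mul]

theorem map_map {R'' M₀'' M₁'' : Type*} [CommRing R''] [AddCommGroup M₀''] [Module R'' M₀'']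
    [AddCommGroup M₁''] [Module R'' M₁''] {S : Type*} [CommRing S] {N₀ N₁ : Type*}
    [AddCommGroup N₀] [Module S N₀] [AddCommGroup N₁] [Module S N₁]
    (φ' : R' →+* R'') (g₀' : M₀' →ₛₗ[φ'] M₀'') (g₁' : M₁' →ₛₗ[φ'] M₁'')
    (ψ : R →+* S) (k₀ : M₀ →ₛₗ[ψ] N₀) (k₁ : M₁ →ₛₗ[ψ] N₁)
    (ψ' : S →+* R'') (k₀' : N₀ →ₛₗ[ψ'] M₀'') (k₁' : N₁ →ₛₗ[ψ'] M₁'')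
    (h : ∀ r, φ' (φ r) = ψ' (ψ r)) (h₀ : ∀ x, g₀' (g₀ x) = k₀' (k₀ x))
    (h₁ : ∀ x, g₁' (g₁ x) = k₁' (k₁ x)) (x : SymExt R M₀ M₁) :
    map φ' g₀' g₁' (map φ g₀ g₁ x) = map ψ' k₀' k₁' (map ψ k₀ k₁ x) := by
  induction x using mono_induction with
  | h0 => simp
  | hadd x y hx hy => simp only [map_add, hx, hy]
  | hsmul r x hx => rw [map_smul', map_smul', map_smul', map_smul', hx, h]
  | hmono c b => simp only [map_mono, List.map_map, Function.comp_def, h₀, h₁]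

end Map

end SymExt

namespace AlgebraicGeometry.EulerK

variable {X : Scheme.{u}}

/-- A coherent locally free sheaf: locally isomorphic to `𝒪ⁿ` for some `n`. -/
def IsVect (M : X.Modules) : Prop :=
  ∀ x : X, ∃ U : X.Opens, x ∈ U ∧ ∃ n : ℕ, Nonempty
    (M.restrict U.ι ≅ SheafOfModules.free (R := (U : Scheme.{u}).ringCatSheaf) (ULift.{u} (Fin n)))

/-- A complex `0 → F₁ → F₀ → 0` of coherent locally free sheaves. -/
structure TwoTerm (X : Scheme.{u}) where
  F₁ : X.Modules
  F₀ : X.Modules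
  d : F₁ ⟶ F₀
  vect₁ : IsVect F₁
  vect₀ : IsVect F₀

/-- A morphism of complexes. -/
structure TwoTerm.Hom (Φ F : TwoTerm X) where
  f₁ : Φ.F₁ ⟶ F.F₁
  f₀ : Φ.F₀ ⟶ F.F₀
  comm : f₁ ≫ F.d = Φ.d ≫ f₀

/-- A quasi-isomorphism: isomorphisms on the two homology sheaves. -/
def TwoTerm.Hom.IsQuasiIso {Φ F : TwoTerm X} (f : TwoTerm.Hom Φ F) : Prop :=
  IsIso (kernel.map Φ.d F.d f.f₁ f.f₀ f.comm.symm) ∧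
    IsIso (cokernel.map Φ.d F.d f.f₁ f.f₀ f.comm.symm)

/-- A morphism of sheaves of modules on sections. -/
noncomputable def onSections {M N : X.Modules} (f : M ⟶ N) (U : X.Opens) :
    Γ(M, U) →ₗ[Γ(X, U)] Γ(N, U) where
  toFun := f.app U
  map_add' x y := map_add _ x y
  map_smul' r x := f.app_smul r x

/-- Restriction of sections of the structure sheaf. -/
def resO {V W : X.Opens} (h : W ≤ V) : Γ(X, V) →+* Γ(X, W) :=
  (X.presheaf.map (homOfLE h).op).hom

/-- Restriction of sections of a sheaf of modules. -/
noncomputable def resM (M : X.Modules) {V W : X.Opens} (h : W ≤ V) :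
    Γ(M, V) →ₛₗ[resO h] Γ(M, W) where
  toFun := M.presheaf.map (homOfLE h).op
  map_add' x y := map_add _ x y
  map_smul' r x := M.map_smul (homOfLE h) r x

theorem resM_onSections {M N : X.Modules} (f : M ⟶ N) {V W : X.Opens} (h : W ≤ V) (x : Γ(M, V)) :
    resM N h (onSections f V x) = onSections f W (resM M h x) :=
  (ConcreteCategory.congr_hom (f.mapPresheaf.naturality (homOfLE h).op) x).symm

theorem resO_resO {U V W : X.Opens} (h : V ≤ U) (h' : W ≤ V) (x : Γ(X, U)) :
    resO h' (resO h x) = resO (h'.trans h) x :=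
  (ConcreteCategory.congr_hom (X.presheaf.map_comp (homOfLE h).op (homOfLE h').op) x).symm

namespace TwoTerm

variable (F : TwoTerm X)

/-- `Sym F₀(U) ⊗ Λ F₁(U)`. For affine `U` these are the sections of `Sym F₀ ⊗ Λ F₁` on `U`. -/
abbrev Alg (U : X.Opens) : Type u := SymExt Γ(X, U) Γ(F.F₀, U) Γ(F.F₁, U)

/-- The differential on `U`. -/
noncomputable abbrev dU (U : X.Opens) : Γ(F.F₁, U) →ₗ[Γ(X, U)] Γ(F.F₀, U) := onSections F.d U

/-- Restriction `Sym F₀(V) ⊗ Λ F₁(V) → Sym F₀(W) ⊗ Λ F₁(W)`. -/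
noncomputable def res {V W : X.Opens} (h : W ≤ V) : F.Alg V →+* F.Alg W :=
  SymExt.map (resO h) (resM F.F₀ h) (resM F.F₁ h)

theorem res_smul {V W : X.Opens} (h : W ≤ V) (r : Γ(X, V)) (x : F.Alg V) :
    F.res h (r • x) = resO h r • F.res h x :=
  SymExt.map_smul' _ _ _ r x

theorem res_koszul {V W : X.Opens} (h : W ≤ V) (x : F.Alg V) :
    F.res h (SymExt.koszul (F.dU V) x) = SymExt.koszul (F.dU W) (F.res h x) :=
  SymExt.map_koszul _ _ _ _ _ (resM_onSections F.d h) x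

/-- A global section of `Symʰ F₀ ⊗ Λᵏ F₁`, given by its restrictions to the affine open subsets. -/
structure Section (h k : ℤ) where
  val : ∀ V : X.affineOpens, F.Alg V.1
  mem : ∀ V, val V ∈ SymExt.piece _ _ _ h k
  res_val : ∀ (V W : X.affineOpens) (hWV : W.1 ≤ V.1), F.res hWV (val V) = val W

/-- The terms `K_i^n = ⨁_{p + q = n} Sym^{p + mq - i} F₀ ⊗ Λ^{q - p} F₁` on an open subset. -/
noncomputable abbrev totU (m : ℕ) (i n : ℤ) (U : X.Opens) : Submodule Γ(X, U) (F.Alg U) :=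
  SymExt.tot Γ(X, U) Γ(F.F₀, U) Γ(F.F₁, U) m i n

/-- The sections of `K_i^n` on `U`: the compatible families of elements
`s V ∈ ⨁_{p + q = n} Sym^{p + mq - i} F₀(V) ⊗ Λ^{q - p} F₁(V)`, for all affine open `V ⊆ U`. -/
noncomputable def totSec (m : ℕ) (i n : ℤ) (U : X.Opens) :
    AddSubgroup (∀ V : {V : X.affineOpens // V.1 ≤ U}, F.Alg V.1.1) where
  carrier := {s | (∀ V, s V ∈ F.totU m i n V.1.1) ∧
    ∀ (V W : {V : X.affineOpens // V.1 ≤ U}) (h : W.1.1 ≤ V.1.1), F.res h (s V) = s W}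
  add_mem' hs ht := ⟨fun V => add_mem (hs.1 V) (ht.1 V), fun V W h => by
    rw [Pi.add_apply, Pi.add_apply, map_add, hs.2 V W h, ht.2 V W h]⟩
  zero_mem' := ⟨fun V => zero_mem _, fun V W h => map_zero _⟩
  neg_mem' hs := ⟨fun V => neg_mem (hs.1 V), fun V W h => by
    rw [Pi.neg_apply, Pi.neg_apply, map_neg, hs.2 V W h]⟩

noncomputable instance (m : ℕ) (i n : ℤ) (U : X.Opens) : Module Γ(X, U) (F.totSec m i n U) where
  smul r s := ⟨fun V => resO V.2 r • s.1 V, fun V => Submodule.smul_mem _ _ (s.2.1 V),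
    fun V W h => by rw [res_smul, s.2.2 V W h, resO_resO]⟩
  one_smul s := Subtype.ext (funext fun V => by
    change resO V.2 1 • s.1 V = s.1 V
    rw [map_one, one_smul])
  mul_smul r r' s := Subtype.ext (funext fun V => by
    change resO V.2 (r * r') • s.1 V = resO V.2 r • resO V.2 r' • s.1 V
    rw [map_mul, mul_smul])
  smul_zero r := Subtype.ext (funext fun V => smul_zero (resO V.2 r))
  smul_add r s t := Subtype.ext (funext fun V => smul_add (resO V.2 r) (s.1 V) (t.1 V))
  add_smul r r' s := Subtype.ext (funext fun V => by
    change resO V.2 (r + r') • s.1 V = resO V.2 r • s.1 V + resO V.2 r' • s.1 V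
    rw [map_add, add_smul])
  zero_smul s := Subtype.ext (funext fun V => by
    change resO V.2 0 • s.1 V = 0
    rw [map_zero, zero_smul])

theorem totSec_smul {m : ℕ} {i n : ℤ} {U : X.Opens} (r : Γ(X, U)) (s : F.totSec m i n U)
    (V : {V : X.affineOpens // V.1 ≤ U}) : (r • s).1 V = resO V.2 r • s.1 V := rfl

/-- Restriction of families. -/
noncomputable def totRes (m : ℕ) (i n : ℤ) {U U' : X.Opens} (h : U' ≤ U) :
    F.totSec m i n U →+ F.totSec m i n U' where
  toFun s := ⟨fun V => s.1 ⟨V.1, V.2.trans h⟩, fun V => s.2.1 ⟨V.1, V.2.trans h⟩,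
    fun V W hVW => s.2.2 ⟨V.1, V.2.trans h⟩ ⟨W.1, W.2.trans h⟩ hVW⟩
  map_zero' := rfl
  map_add' _ _ := rfl

theorem totRes_smul (m : ℕ) (i n : ℤ) {U U' : X.Opens} (h : U' ≤ U) (r : Γ(X, U))
    (s : F.totSec m i n U) : F.totRes m i n h (r • s) = resO h r • F.totRes m i n h s :=
  Subtype.ext (funext fun V => by
    change resO (V.2.trans h) r • _ = resO V.2 (resO h r) • _
    rw [resO_resO]
    rfl)

noncomputable instance (m : ℕ) (i n : ℤ) (U : X.Opensᵒᵖ) :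
    Module (X.ringCatSheaf.obj.obj U) (AddCommGrpCat.of (F.totSec m i n U.unop)) :=
  inferInstanceAs (Module Γ(X, U.unop) (F.totSec m i n U.unop))

/-- The presheaf `U ↦ K_i^n(U)`. -/
noncomputable def totPresheaf (m : ℕ) (i n : ℤ) : X.PresheafOfModules :=
  PresheafOfModules.ofPresheaf (R := X.ringCatSheaf.obj)
    { obj := fun U => AddCommGrpCat.of (F.totSec m i n U.unop)
      map := fun f => AddCommGrpCat.ofHom (F.totRes m i n f.unop.le)
      map_id := fun _ => rfl
      map_comp := fun _ _ => rfl }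
    (fun _ _ f r s => F.totRes_smul m i n f.unop.le r s)

/-- The sheaf of modules `K_i^n = ⨁_{p + q = n} Sym^{p + mq - i} F₀ ⊗ Λ^{q - p} F₁`. -/
noncomputable def totSheaf (m : ℕ) (i n : ℤ) : X.Modules :=
  (PresheafOfModules.sheafification (𝟙 X.ringCatSheaf.obj)).obj (F.totPresheaf m i n)

variable {F}

/-- A family of linear maps on affine open subsets, compatible with restrictions. -/
structure AffMap (Φ F : TwoTerm X) where
  toFun : ∀ V : X.affineOpens, Φ.Alg V.1 →ₗ[Γ(X, V.1)] F.Alg V.1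
  res_toFun : ∀ (V W : X.affineOpens) (h : W.1 ≤ V.1) (x : Φ.Alg V.1),
    F.res h (toFun V x) = toFun W (Φ.res h x)

/-- The map on presheaves induced by a compatible family of linear maps. -/
noncomputable def AffMap.presheafMap {Φ F : TwoTerm X} (T : AffMap Φ F) {m : ℕ} {i n i' n' : ℤ}
    (hT : ∀ V : X.affineOpens, ∀ x ∈ Φ.totU m i n V.1, T.toFun V x ∈ F.totU m i' n' V.1) :
    Φ.totPresheaf m i n ⟶ F.totPresheaf m i' n' :=
  PresheafOfModules.homMk
    { app := fun U => AddCommGrpCat.ofHom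
        { toFun := fun s => (⟨fun V => T.toFun V.1 (s.1 V), fun V => hT _ _ (s.2.1 V), fun V W h => by
            rw [T.res_toFun, s.2.2 V W h]⟩ : F.totSec m i' n' U.unop)
          map_zero' := Subtype.ext (funext fun V => map_zero _)
          map_add' := fun s t => Subtype.ext (funext fun V => map_add _ _ _) }
      naturality := fun _ _ _ => rfl }
    (fun _ r s => Subtype.ext (funext fun V => (T.toFun V.1).map_smul (resO V.2 r) (s.1 V)))

/-- The map on sheaves induced by a compatible family of linear maps. -/
noncomputable def AffMap.sheafMap {Φ F : TwoTerm X} (T : AffMap Φ F) {m : ℕ} {i n i' n' : ℤ}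
    (hT : ∀ V : X.affineOpens, ∀ x ∈ Φ.totU m i n V.1, T.toFun V x ∈ F.totU m i' n' V.1) :
    Φ.totSheaf m i n ⟶ F.totSheaf m i' n' :=
  (PresheafOfModules.sheafification (𝟙 X.ringCatSheaf.obj)).map (T.presheafMap hT)

theorem AffMap.sheafMap_comp {Φ F G : TwoTerm X} (T : AffMap Φ F) (S : AffMap F G)
    (P : AffMap Φ G) (h : ∀ V x, S.toFun V (T.toFun V x) = P.toFun V x)
    {m : ℕ} {i n i' n' i'' n'' : ℤ}
    (hT : ∀ V : X.affineOpens, ∀ x ∈ Φ.totU m i n V.1, T.toFun V x ∈ F.totU m i' n' V.1)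
    (hS : ∀ V : X.affineOpens, ∀ x ∈ F.totU m i' n' V.1, S.toFun V x ∈ G.totU m i'' n'' V.1)
    (hP : ∀ V : X.affineOpens, ∀ x ∈ Φ.totU m i n V.1, P.toFun V x ∈ G.totU m i'' n'' V.1) :
    T.sheafMap hT ≫ S.sheafMap hS = P.sheafMap hP := by
  unfold AffMap.sheafMap
  refine ((PresheafOfModules.sheafification (𝟙 X.ringCatSheaf.obj)).map_comp _ _).symm.trans ?_
  congr 1
  refine PresheafOfModules.hom_ext fun U => ?_
  ext s
  exact Subtype.ext (funext fun V => h V.1 (s.1 V))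

theorem AffMap.sheafMap_eq_zero {Φ F : TwoTerm X} (T : AffMap Φ F)
    (h : ∀ V x, T.toFun V x = 0) {m : ℕ} {i n i' n' : ℤ}
    (hT : ∀ V : X.affineOpens, ∀ x ∈ Φ.totU m i n V.1, T.toFun V x ∈ F.totU m i' n' V.1) :
    T.sheafMap hT = 0 := by
  unfold AffMap.sheafMap
  have : T.presheafMap hT = 0 := by
    refine PresheafOfModules.hom_ext fun U => ?_
    ext s
    exact Subtype.ext (funext fun V => h V.1 (s.1 V))
  rw [this]
  exact Functor.map_zero (PresheafOfModules.sheafification (𝟙 X.ringCatSheaf.obj)) _ _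

/-- The zero family. -/
noncomputable def AffMap.zero (Φ F : TwoTerm X) : AffMap Φ F where
  toFun V := 0
  res_toFun V W h x := by simp

/-- The total differential `D = d̃ + ã`. -/
noncomputable def Section.totD {h k : ℤ} (a : F.Section h k) : AffMap F F where
  toFun V := SymExt.totD (F.dU V.1) (a.val V)
  res_toFun V W h x := by
    rw [SymExt.totD_apply, SymExt.totD_apply, map_add, map_mul, res_koszul, a.res_val]

/-- Multiplication by a section of `Symʰ F₀ ⊗ Λᵏ F₁`. -/
noncomputable def Section.mul {h k : ℤ} (a : F.Section h k) : AffMap F F where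
  toFun V := LinearMap.mulLeft Γ(X, V.1) (a.val V)
  res_toFun V W h x := by
    rw [LinearMap.mulLeft_apply, LinearMap.mulLeft_apply, map_mul, a.res_val]

/-- A closed form `a : 𝒪 → Symᵐ F₀ ⊗ F₁`: a global section with `d a = 0` in `Symᵐ⁺¹ F₀`. -/
structure ClosedForm (F : TwoTerm X) (m : ℕ) extends Section F m 1 where
  closed : ∀ V : X.affineOpens, SymExt.koszul (F.dU V.1) (val V) = 0

/-- The total complex `(K_i^•, d̃ + ã)`. -/
noncomputable def ClosedForm.complex {m : ℕ} (a : ClosedForm F m) (i : ℤ) :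
    CochainComplex X.Modules ℤ where
  X n := F.totSheaf m i n
  d n n' :=
    if h : n + 1 = n' then
      a.totD.sheafMap (fun V x hx => h ▸ SymExt.totD_mem_tot (F.dU V.1) (a.mem V) hx)
    else 0
  shape n n' h := dif_neg h
  d_comp_d' n n' n'' h h' := by
    change n + 1 = n' at h
    change n' + 1 = n'' at h'
    rw [dif_pos h, dif_pos h']
    rw [AffMap.sheafMap_comp _ _ (AffMap.zero F F)
      (fun V x => SymExt.totD_totD _ (a.mem V) (a.closed V) x) _ _ (fun V x _ => zero_mem _)]
    exact AffMap.sheafMap_eq_zero _ (fun V x => rfl) _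

/-- The endomorphism `h̃` of `K_i^n`, multiplication by `h ∈ Sym^{m-1} F₀ ⊗ Λ² F₁`. -/
noncomputable def Section.tilde {m : ℕ} (h : F.Section (m - 1) 2) (i n : ℤ) :
    End (F.totSheaf m i n) :=
  h.mul.sheafMap (fun V _ hx =>
    SymExt.mul_mem_tot (-1) 1 (by ring) (by ring) (by ring) (h.mem V) hx)

namespace Hom

variable {Φ : TwoTerm X} (f : TwoTerm.Hom Φ F)

/-- `Sym f₀ ⊗ Λ f₁` on `U`. -/
noncomputable def onAlg (U : X.Opens) : Φ.Alg U →+* F.Alg U :=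
  SymExt.map (RingHom.id Γ(X, U)) (onSections f.f₀ U) (onSections f.f₁ U)

theorem onSections_comm (U : X.Opens) (x : Γ(Φ.F₁, U)) :
    onSections f.f₀ U (Φ.dU U x) = F.dU U (onSections f.f₁ U x) := by
  have h := congrArg (fun g => onSections g U x) f.comm
  exact h.symm

theorem res_onAlg {V W : X.Opens} (h : W ≤ V) (x : Φ.Alg V) :
    F.res h (f.onAlg V x) = f.onAlg W (Φ.res h x) := by
  unfold TwoTerm.res onAlg
  exact SymExt.map_map (RingHom.id Γ(X, V)) (onSections f.f₀ V) (onSections f.f₁ V)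
    (resO h) (resM F.F₀ h) (resM F.F₁ h) (resO h) (resM Φ.F₀ h) (resM Φ.F₁ h)
    (RingHom.id Γ(X, W)) (onSections f.f₀ W) (onSections f.f₁ W) (fun _ => rfl)
    (fun x => resM_onSections f.f₀ h x) (fun x => resM_onSections f.f₁ h x) x

theorem onAlg_koszul (U : X.Opens) (x : Φ.Alg U) :
    f.onAlg U (SymExt.koszul (Φ.dU U) x) = SymExt.koszul (F.dU U) (f.onAlg U x) := by
  unfold onAlg
  exact SymExt.map_koszul (RingHom.id Γ(X, U)) (onSections f.f₀ U) (onSections f.f₁ U)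
    (Φ.dU U) (F.dU U) (f.onSections_comm U) x

/-- The family of maps `Sym f₀ ⊗ Λ f₁`. -/
noncomputable def affMap : AffMap Φ F where
  toFun V :=
    { toFun := f.onAlg V.1
      map_add' := map_add _
      map_smul' := SymExt.map_smul' _ _ _ }
  res_toFun V W h x := f.res_onAlg h x

theorem affMap_mem {m : ℕ} {i n : ℤ} (V : X.affineOpens) (x : Φ.Alg V.1)
    (hx : x ∈ Φ.totU m i n V.1) : f.affMap.toFun V x ∈ F.totU m i n V.1 :=
  SymExt.map_mem_tot _ _ _ hx

/-- The image under `Symʰ f₀ ⊗ Λᵏ f₁` of a section of `Symʰ Φ₀ ⊗ Λᵏ Φ₁`. -/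
noncomputable def push {h k : ℤ} (s : Φ.Section h k) : F.Section h k where
  val V := f.onAlg V.1 (s.val V)
  mem V := SymExt.map_mem_piece _ _ _ (s.mem V)
  res_val _ _ hWV := by rw [res_onAlg, s.res_val]

theorem onAlg_totD {m : ℕ} (α : ClosedForm Φ m) (a : ClosedForm F m)
    (h : f.push α.toSection = a.toSection) (V : X.affineOpens) (x : Φ.Alg V.1) :
    a.totD.toFun V (f.affMap.toFun V x) = f.affMap.toFun V (α.totD.toFun V x) := by
  change SymExt.totD (F.dU V.1) (a.val V) (f.onAlg V.1 x) =
    f.onAlg V.1 (SymExt.totD (Φ.dU V.1) (α.val V) x)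
  rw [SymExt.totD_apply, SymExt.totD_apply, map_add, map_mul, onAlg_koszul]
  congr 2
  exact congrArg (fun s : F.Section m 1 => s.val V) h.symm

/-- The family of maps `f̃ ∘ D`. -/
noncomputable def affMapD {m : ℕ} (α : ClosedForm Φ m) : AffMap Φ F where
  toFun V := (f.affMap.toFun V).comp (α.totD.toFun V)
  res_toFun V W h x := by
    rw [LinearMap.comp_apply, LinearMap.comp_apply, f.affMap.res_toFun, α.totD.res_toFun]

/-- The morphism `f̃` of total complexes, if `f` maps the form `α` to the form `a`. -/
noncomputable def total {m : ℕ} (α : ClosedForm Φ m) (a : ClosedForm F m)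
    (h : f.push α.toSection = a.toSection) (i : ℤ) : α.complex i ⟶ a.complex i where
  f n := f.affMap.sheafMap f.affMap_mem
  comm' n n' hn := by
    change n + 1 = n' at hn
    have hP : ∀ V : X.affineOpens, ∀ x ∈ Φ.totU m i n V.1,
        (f.affMapD α).toFun V x ∈ F.totU m i n' V.1 := fun V x hx =>
      f.affMap_mem V _ (hn ▸ SymExt.totD_mem_tot (Φ.dU V.1) (α.mem V) hx)
    dsimp only [ClosedForm.complex]
    rw [dif_pos hn, dif_pos hn]
    exact (AffMap.sheafMap_comp _ _ (f.affMapD α) (fun V x => f.onAlg_totD α a h V x) _ _ hP).trans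
      (AffMap.sheafMap_comp _ _ (f.affMapD α) (fun V x => rfl) _ _ hP).symm

end Hom

end TwoTerm

/-! ### Nondegenerate forms -/

section Nondegenerate

variable {R M₀ M₁ : Type u} [CommRing R] [AddCommGroup M₀] [Module R M₀]
  [AddCommGroup M₁] [Module R M₁] {κ : Type u} [Field κ]

/-- The map `m ↦ 1 ⊗ m` to the fibre. -/
def toFibre (φ : R →+* κ) (M : Type u) [AddCommGroup M] [Module R M] :
    letI := φ.toAlgebra
    M →ₛₗ[φ] κ ⊗[R] M :=
  letI := φ.toAlgebra
  { toFun := fun x => 1 ⊗ₜ[R] x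
    map_add' := fun x y => TensorProduct.tmul_add _ x y
    map_smul' := fun r x => by
      rw [TensorProduct.tmul_smul, TensorProduct.smul_tmul', TensorProduct.smul_tmul',
        smul_eq_mul, mul_one, Algebra.smul_def, mul_one]
      rfl }

/-- Nondegeneracy on the fibre of `d : M₁ → M₀` along `φ : R → κ`. With `H₁` and `H₀` the kernel
and the cokernel of the fibre of `d`, the form `a` induces an element `c` of `Sym H₀ ⊗ H₁`, hence
a linear map `S : H₁^∨ → Sym H₀`, `w ↦ (id ⊗ w) c`. The image of `S` is required to have no base
point `[v]`, `v ∈ H₀^∨ ∖ 0`. -/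
def FibreNondegenerate (φ : R →+* κ) (d : M₁ →ₗ[R] M₀) (a : SymExt R M₀ M₁) : Prop :=
  letI := φ.toAlgebra
  let dκ : κ ⊗[R] M₁ →ₗ[κ] κ ⊗[R] M₀ := d.baseChange κ
  let H₁ := LinearMap.ker dκ
  let H₀ := (κ ⊗[R] M₀) ⧸ LinearMap.range dκ
  ∃ c : SymmetricAlgebra κ H₀ ⊗[κ] H₁,
    TensorProduct.map LinearMap.id ((ExteriorAlgebra.ι κ).comp H₁.subtype) c =
      SymExt.map φ ((LinearMap.range dκ).mkQ.comp (toFibre φ M₀)) (toFibre φ M₁) a ∧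
    ∀ v : Module.Dual κ H₀,
      (∀ w : Module.Dual κ H₁, SymmetricAlgebra.lift (A := κ) v
        (TensorProduct.rid κ (SymmetricAlgebra κ H₀) (TensorProduct.map LinearMap.id w c)) = 0) →
      v = 0

end Nondegenerate

/-- A closed form is nondegenerate if it is nondegenerate on the fibre at every closed point. -/
def TwoTerm.ClosedForm.Nondegenerate {F : TwoTerm X} {m : ℕ} (a : F.ClosedForm m) : Prop :=
  ∀ (V : X.affineOpens) (x : X) (hx : x ∈ V.1), IsClosed ({x} : Set X) →
    FibreNondegenerate (X.evaluation V.1 x hx).hom (F.dU V.1) (a.val V)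

/-! ### K-theory -/

/-- The relations `[M₂] = [M₁] + [M₃]` for exact sequences `0 → M₁ → M₂ → M₃ → 0`. -/
def K0Rel (X : Scheme.{u}) : AddSubgroup (FreeAbelianGroup {M : X.Modules // IsVect M}) :=
  AddSubgroup.closure {r | ∃ (S : ShortComplex X.Modules) (_ : S.ShortExact) (h₁ : IsVect S.X₁)
    (h₂ : IsVect S.X₂) (h₃ : IsVect S.X₃), r = FreeAbelianGroup.of ⟨S.X₂, h₂⟩ -
      FreeAbelianGroup.of ⟨S.X₁, h₁⟩ - FreeAbelianGroup.of ⟨S.X₃, h₃⟩}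

/-- The Grothendieck group of coherent locally free sheaves. -/
abbrev K0 (X : Scheme.{u}) : Type (u + 1) :=
  FreeAbelianGroup {M : X.Modules // IsVect M} ⧸ K0Rel X

/-- The class of a coherent locally free sheaf. -/
def K0.cls (M : X.Modules) (h : IsVect M) : K0 X :=
  QuotientAddGroup.mk (FreeAbelianGroup.of ⟨M, h⟩)

/-- `c` is the class `∑_{n < n₀} (-1)ⁿ [Kⁿ] + (-1)^{n₀} [im (K^{n₀-1} → K^{n₀})]` of a complex of
coherent locally free sheaves `Kⁿ`, zero for `n < b`, such that, for all `n ≥ n₀`, the cohomology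
`Hⁿ` vanishes and `im (K^{n-1} → Kⁿ)` is locally free. -/
def HasClass (K : CochainComplex X.Modules ℤ) (c : K0 X) : Prop :=
  ∃ (b n₀ : ℤ) (hK : ∀ n, IsVect (K.X n)) (_ : ∀ n < b, IsZero (K.X n))
    (_ : ∀ n ≥ n₀, K.ExactAt n) (hI : ∀ n ≥ n₀, IsVect (image (K.d (n - 1) n))),
    c = ∑ n ∈ Finset.Ico b n₀, n.negOnePow • K0.cls (K.X n) (hK n) +
      n₀.negOnePow • K0.cls (image (K.d (n₀ - 1) n₀)) (hI n₀ le_rfl)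

open Classical in
/-- The class `cl(K)` of a complex that has one. -/
noncomputable def cl (K : CochainComplex X.Modules ℤ) : K0 X :=
  if h : ∃ c, HasClass K c then h.choose else 0

/-- The K-theory Euler class `Ke(F, a) = ∑_{0 ≤ i ≤ m} cl(K_i)`. -/
noncomputable def TwoTerm.ClosedForm.Ke {F : TwoTerm X} {m : ℕ} (a : F.ClosedForm m) : K0 X :=
  ∑ i ∈ Finset.range (m + 1), cl (a.complex i)

/-- `∑_{j ≥ 0} gʲ / j!` for a nilpotent endomorphism `g` of an object on which the `j!` are
invertible. -/
noncomputable def expEnd {M : X.Modules} (g : End M) : End M :=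
  ∑ j ∈ Finset.range (nilpotencyClass g), Ring.inverse ((j.factorial : ℕ) : End M) * g ^ j

end AlgebraicGeometry.EulerK

/-! Let `D = d̃ + ã` act on the algebra `Sym F₀ ⊗ Λ F₁` over an affine open set. Existence of the
classes rests on two Cartan formulas: wedging with `b ∈ F₁` is a null homotopy for multiplication by
`d b`, and contracting with a functional `w` on `F₁` is a null homotopy for multiplication by the
coefficient of `a` along `w`. So every element of the ideal generated by all `d b` and all
coefficients of `a` (`baseIdeal`) acts as zero up to homotopy (`exists_nullHomotopy`). Nondegeneracy
says that on the fibre at a closed point this ideal has no zero except the origin. By the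
Nullstellensatz it contains powers of the linear coordinates there, and by a graded Nakayama
argument it contains them on a neighbourhood (`exists_smul_pow_mem_baseIdeal`).

For large `n` every monomial of `K_i^n` is divisible by such a power, and the null homotopies splice
to a contraction of the complex in degrees `n ≥ n₀` (`exists_contraction`,
`exists_tot_contraction`). The contraction gives exactness. It is also a generalized inverse of `D`,
so the cocycles are locally a direct summand of a free module, hence locally free. Quasi-compactness
makes `n₀` uniform. Independence of `n₀` is the telescoping of `[Kⁿ] = [Zⁿ] + [Zⁿ⁺¹]`.

For the comparison statements, the class of a mapping cone is the class of the target minus the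
class of the source, and acyclic complexes have class zero. Therefore quasi-isomorphic complexes
have equal classes (`HasClass.eq_of_quasiIso`), and it suffices to produce quasi-isomorphisms of
total complexes.

For homotopic forms, `h` has even exterior degree, so it is central, and the commutator of `D` with
`h̃` is `ã - ã'`, which again commutes with `h̃`. The exponential series then intertwines the two
differentials; it is finite because the exterior degree is bounded by the rank of `F₁`.

For a quasi-isomorphism `f`, freeness of `F₀` near a point makes `f` a homotopy equivalence there. A
homotopy extends to a map of differential graded algebras into `(Sym ⊗ Λ)[t, dt]`, and integrating
over `t` in characteristic zero shows that homotopic maps agree on Koszul homology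
(`map_sub_map_mem_range`). The filtration by `q`, finite in each total degree, carries this from
`d̃` to `d̃ + ã` (`exists_totD_of_koszul`).

In the last statement the image of `α` under `f` is homotopic to `a`. Homotopic forms induce the
same element of `Symᵐ H₀ ⊗ H₁`, so the image is nondegenerate too, and the two previous cases
combine. -/

namespace SymExt

/-! ### Weight projections on `Sym M₀ ⊗ Λ M₁` -/

section Grading

variable {R M₀ M₁ : Type*} [CommRing R] [AddCommGroup M₀] [Module R M₀]
  [AddCommGroup M₁] [Module R M₁] {G : Type*} [AddCommMonoid G]

variable (R M₀ M₁) in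
/-- The algebra homomorphism `Sym M₀ → (Sym M₀ ⊗ Λ M₁)[G]` placing the elements of `M₀` in
degree `g₀`. -/
noncomputable def symGrade (g₀ : G) :
    SymmetricAlgebra R M₀ →ₐ[R] AddMonoidAlgebra (SymExt R M₀ M₁) G :=
  (AddMonoidAlgebra.mapAlgHom G
    (Algebra.TensorProduct.includeLeft : SymmetricAlgebra R M₀ →ₐ[R] SymExt R M₀ M₁)).comp
    (SymmetricAlgebra.lift
      ((AddMonoidAlgebra.lsingle g₀ :
        SymmetricAlgebra R M₀ →ₗ[R] AddMonoidAlgebra (SymmetricAlgebra R M₀) G).comp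
        (SymmetricAlgebra.ι R M₀)))

theorem symGrade_ι (g₀ : G) (c : M₀) : symGrade R M₀ M₁ g₀ (SymmetricAlgebra.ι R M₀ c) =
    AddMonoidAlgebra.single g₀ (SymmetricAlgebra.ι R M₀ c ⊗ₜ[R] 1) := by
  rw [symGrade, AlgHom.comp_apply, SymmetricAlgebra.lift_ι_apply]
  simp

variable (R M₀ M₁) in
/-- The algebra homomorphism `Λ M₁ → (Sym M₀ ⊗ Λ M₁)[G]` placing the elements of `M₁` in
degree `g₁`. -/
noncomputable def extGrade (g₁ : G) :
    ExteriorAlgebra R M₁ →ₐ[R] AddMonoidAlgebra (SymExt R M₀ M₁) G :=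
  ExteriorAlgebra.lift R ⟨(AddMonoidAlgebra.lsingle g₁ :
      SymExt R M₀ M₁ →ₗ[R] AddMonoidAlgebra (SymExt R M₀ M₁) G).comp
      ((TensorProduct.mk R (SymmetricAlgebra R M₀) (ExteriorAlgebra R M₁) 1).comp
        (ExteriorAlgebra.ι R)), fun b => by
    simp [AddMonoidAlgebra.single_mul_single]⟩

theorem extGrade_ι (g₁ : G) (b : M₁) : extGrade R M₀ M₁ g₁ (ExteriorAlgebra.ι R b) =
    AddMonoidAlgebra.single g₁ (1 ⊗ₜ[R] ExteriorAlgebra.ι R b) := by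
  rw [extGrade, ExteriorAlgebra.lift_ι_apply]
  simp

theorem commute_single_sym (g : G) (s : SymmetricAlgebra R M₀)
    (y : AddMonoidAlgebra (SymExt R M₀ M₁) G) :
    Commute (AddMonoidAlgebra.single g (s ⊗ₜ[R] (1 : ExteriorAlgebra R M₁))) y := by
  induction y using AddMonoidAlgebra.induction_linear with
  | zero => exact Commute.zero_right _
  | add f g hf hg => exact hf.add_right hg
  | single h x =>
    rw [commute_iff_eq, AddMonoidAlgebra.single_mul_single, AddMonoidAlgebra.single_mul_single,
      add_comm, sym_comm]

theorem commute_symGrade (g₀ : G) (s : SymmetricAlgebra R M₀)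
    (y : AddMonoidAlgebra (SymExt R M₀ M₁) G) : Commute (symGrade R M₀ M₁ g₀ s) y := by
  induction s using SymmetricAlgebra.induction with
  | algebraMap r => rw [AlgHom.commutes]; exact Algebra.commutes r y
  | ι x => rw [symGrade_ι]; exact commute_single_sym _ _ _
  | mul a b ha hb => rw [map_mul]; exact ha.mul_left hb
  | add a b ha hb => rw [map_add]; exact ha.add_left hb

variable (R M₀ M₁) in
/-- The coaction of `G`-gradings on `Sym M₀ ⊗ Λ M₁`. -/
noncomputable def grade (g₀ g₁ : G) :
    SymExt R M₀ M₁ →ₐ[R] AddMonoidAlgebra (SymExt R M₀ M₁) G :=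
  Algebra.TensorProduct.lift (symGrade R M₀ M₁ g₀) (extGrade R M₀ M₁ g₁)
    fun s _ => commute_symGrade g₀ s _

/-- The coaction takes the place of a direct sum decomposition: it exists for arbitrary modules,
without bases, and its coefficients are the weight projections. -/
theorem grade_mono (g₀ g₁ : G) (c : List M₀) (b : List M₁) :
    grade R M₀ M₁ g₀ g₁ (mono c b) =
      AddMonoidAlgebra.single (c.length • g₀ + b.length • g₁) (mono c b) := by
  induction b with
  | nil =>
    induction c with
    | nil => simp [mono, ← Algebra.TensorProduct.one_def, AddMonoidAlgebra.one_def]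
    | cons c l ih =>
      rw [← sym_mul_mono, map_mul, ih, grade, Algebra.TensorProduct.lift_tmul, symGrade_ι, map_one,
        mul_one, AddMonoidAlgebra.single_mul_single]
      congr 1
      simp only [List.length_cons, add_smul, one_smul]; abel
  | cons b l ih =>
    rw [mono_cons, map_mul, ih, grade, Algebra.TensorProduct.lift_tmul, extGrade_ι, map_one,
      one_mul, AddMonoidAlgebra.single_mul_single]
    congr 1
    simp only [List.length_cons, add_smul, one_smul]; abel

variable (R M₀ M₁) in
/-- The projection of `Sym M₀ ⊗ Λ M₁` to the part of weight `g`, where the elements of `M₀` have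
weight `g₀` and the elements of `M₁` weight `g₁`. -/
noncomputable def wproj (g₀ g₁ g : G) : SymExt R M₀ M₁ →ₗ[R] SymExt R M₀ M₁ :=
  ((Finsupp.lapply g).comp
    (AddMonoidAlgebra.coeffLinearEquiv R : AddMonoidAlgebra (SymExt R M₀ M₁) G ≃ₗ[R] _).toLinearMap).comp
    (grade R M₀ M₁ g₀ g₁).toLinearMap

theorem wproj_mono [DecidableEq G] (g₀ g₁ g : G) (c : List M₀) (b : List M₁) :
    wproj R M₀ M₁ g₀ g₁ g (mono c b) =
      if c.length • g₀ + b.length • g₁ = g then mono c b else 0 := by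
  change (grade R M₀ M₁ g₀ g₁ (mono c b)).coeff g = _
  rw [grade_mono, AddMonoidAlgebra.coeff_single, Finsupp.single_apply]

/-- Adding up the coefficients is a left inverse of the coaction, and only the weights in its finite
support occur. -/
theorem exists_sum_wproj (g₀ g₁ : G) (x : SymExt R M₀ M₁) :
    ∃ s : Finset G, x = ∑ g ∈ s, wproj R M₀ M₁ g₀ g₁ g x ∧
      ∀ g ∉ s, wproj R M₀ M₁ g₀ g₁ g x = 0 := by
  classical
  refine ⟨(grade R M₀ M₁ g₀ g₁ x).coeff.support, ?_, fun g hg => Finsupp.notMem_support_iff.mp hg⟩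
  have key : ∀ x : SymExt R M₀ M₁, x = (grade R M₀ M₁ g₀ g₁ x).coeff.sum fun _ y => y := by
    intro x
    induction x using mono_induction with
    | h0 => simp
    | hadd x y hx hy =>
      rw [map_add, AddMonoidAlgebra.coeff_add, Finsupp.sum_add_index' (fun _ => rfl)
        (fun _ _ _ => rfl), ← hx, ← hy]
    | hsmul r x hx =>
      rw [map_smul, AddMonoidAlgebra.coeff_smul, Finsupp.sum_smul_index' (fun _ => rfl),
        ← Finsupp.smul_sum, ← hx]
    | hmono c b => rw [grade_mono, AddMonoidAlgebra.coeff_single, Finsupp.sum_single_index rfl]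
  exact key x

/-- The Koszul differential trades one factor of weight `g₁` for one of weight `g₀`. -/
theorem wproj_koszul {G : Type*} [AddCommGroup G] (d : M₁ →ₗ[R] M₀) (g₀ g₁ g : G)
    (x : SymExt R M₀ M₁) :
    wproj R M₀ M₁ g₀ g₁ g (koszul d x) = koszul d (wproj R M₀ M₁ g₀ g₁ (g - g₀ + g₁) x) := by
  classical
  have hsym : ∀ (g : G) (c : M₀) (x : SymExt R M₀ M₁),
      wproj R M₀ M₁ g₀ g₁ g ((SymmetricAlgebra.ι R M₀ c ⊗ₜ[R] 1) * x) =
        (SymmetricAlgebra.ι R M₀ c ⊗ₜ[R] 1) * wproj R M₀ M₁ g₀ g₁ (g - g₀) x := by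
    intro g c x
    induction x using mono_induction with
    | h0 => simp
    | hadd x y hx hy => rw [mul_add, map_add, map_add, hx, hy, mul_add]
    | hsmul r x hx => rw [mul_smul_comm, map_smul, map_smul, hx, mul_smul_comm]
    | hmono c' b =>
      rw [sym_mul_mono, wproj_mono, wproj_mono, mul_ite, mul_zero, sym_mul_mono]
      congr 1
      simp only [List.length_cons, add_smul, one_smul, eq_iff_iff, eq_sub_iff_add_eq]
      rw [add_right_comm]
  have hext : ∀ (g : G) (b : M₁) (x : SymExt R M₀ M₁),
      wproj R M₀ M₁ g₀ g₁ g ((1 ⊗ₜ[R] ExteriorAlgebra.ι R b) * x) =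
        (1 ⊗ₜ[R] ExteriorAlgebra.ι R b) * wproj R M₀ M₁ g₀ g₁ (g - g₁) x := by
    intro g c x
    induction x using mono_induction with
    | h0 => simp
    | hadd x y hx hy => rw [mul_add, map_add, map_add, hx, hy, mul_add]
    | hsmul r x hx => rw [mul_smul_comm, map_smul, map_smul, hx, mul_smul_comm]
    | hmono c' b =>
      rw [← mono_cons, wproj_mono, wproj_mono, mul_ite, mul_zero, ← mono_cons]
      congr 1
      simp only [List.length_cons, add_smul, one_smul, eq_iff_iff, eq_sub_iff_add_eq]
      rw [add_assoc]
  induction x using mono_induction generalizing g with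
  | h0 => simp
  | hadd x y hx hy => simp only [map_add, hx, hy]
  | hsmul r x hx => simp only [map_smul, hx]
  | hmono c b =>
    induction b generalizing g with
    | nil =>
      rw [koszul_mono_nil, map_zero, wproj_mono]
      split_ifs
      · rw [koszul_mono_nil]
      · rw [map_zero]
    | cons b l ih =>
      rw [mono_cons, koszul_ι_mul, map_sub, hsym, hext, ih, hext, koszul_ι_mul, add_sub_cancel_right,
        show g - g₁ - g₀ + g₁ = g - g₀ by abel]

theorem wproj_piece {g₀ g₁ g : G} {h k : ℕ} {x : SymExt R M₀ M₁} (hx : x ∈ piece R M₀ M₁ h k)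
    (hg : h • g₀ + k • g₁ = g) : wproj R M₀ M₁ g₀ g₁ g x = x := by
  classical
  induction hx using Submodule.span_induction with
  | mem x hx =>
    obtain ⟨c, b, hc, hb, rfl⟩ := hx
    rw [wproj_mono, if_pos]
    rw [← hg, show c.length = h by exact_mod_cast hc, show b.length = k by exact_mod_cast hb]
  | zero => simp
  | add x y _ _ h1 h2 => rw [map_add, h1, h2]
  | smul r x _ h => rw [map_smul, h]

theorem wproj_piece_mul {G : Type*} [AddCommGroup G] {g₀ g₁ : G} (g : G) {h k : ℕ}
    {a : SymExt R M₀ M₁} (ha : a ∈ piece R M₀ M₁ h k) (x : SymExt R M₀ M₁) :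
    wproj R M₀ M₁ g₀ g₁ g (a * x) = a * wproj R M₀ M₁ g₀ g₁ (g - (h • g₀ + k • g₁)) x := by
  classical
  induction ha using Submodule.span_induction with
  | mem a ha =>
    obtain ⟨c, b, hc, hb, rfl⟩ := ha
    obtain rfl : c.length = h := by exact_mod_cast hc
    obtain rfl : b.length = k := by exact_mod_cast hb
    induction x using mono_induction with
    | h0 => simp
    | hadd x y hx hy => rw [mul_add, map_add, map_add, hx, hy, mul_add]
    | hsmul r x hx => rw [mul_smul_comm, map_smul, map_smul, hx, mul_smul_comm]
    | hmono c' b' =>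
      rw [mono_mul, wproj_mono, wproj_mono, mul_ite, mul_zero, mono_mul]
      congr 1
      simp only [List.length_append, add_smul, eq_iff_iff, eq_sub_iff_add_eq]
      rw [add_comm (c'.length • g₀ + _), add_add_add_comm]
  | zero => simp
  | add a b _ _ h1 h2 => rw [add_mul, map_add, h1, h2, add_mul]
  | smul r a _ h => rw [smul_mul_assoc, map_smul, h, smul_mul_assoc]

/-- A weight part of an element of `Sym M₀ ⊗ Λ M₁`, for a family of mixed degrees. -/
theorem piece_eq_bot_of_neg {h k : ℤ} (hk : h < 0 ∨ k < 0) : piece R M₀ M₁ h k = ⊥ := by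
  rw [piece, Submodule.span_eq_bot]
  rintro _ ⟨c, b, hc, hb, -⟩
  omega

variable (R M₀ M₁) in
/-- The projection to the part `K_i^n`. -/
noncomputable def totProj (m : ℕ) (i n : ℤ) : SymExt R M₀ M₁ →ₗ[R] SymExt R M₀ M₁ :=
  wproj R M₀ M₁ (G := ℤ × ZMod 2) (2, 0) (1 - m, 1) ((m + 1) * n - 2 * i, n)

/-- With `h = p + mq - i`, `k = q - p` one has `2h + (1 - m)k = (m + 1)(p + q) - 2i` and `k ≡ p + q`
mod 2. Conversely these two conditions recover `p = (n - k)/2` and `q = (n + k)/2`. So all of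
`K_i^n` is a single weight space, although it collects many bidegrees. -/
theorem tot_weight_iff {m : ℕ} {i n : ℤ} {h k : ℕ} :
    h • ((2, 0) : ℤ × ZMod 2) + k • ((1 - m, 1) : ℤ × ZMod 2) =
      (((m + 1) * n - 2 * i : ℤ), (n : ZMod 2)) ↔
    ∃ p q : ℤ, p + q = n ∧ p + m * q - i = h ∧ q - p = k := by
  simp only [Prod.smul_mk, smul_zero, Prod.mk_add_mk, zero_add, Prod.mk.injEq, nsmul_eq_mul,
    mul_one]
  constructor
  · rintro ⟨h1, h2⟩
    rw [← Int.cast_natCast, ZMod.intCast_eq_intCast_iff_dvd_sub] at h2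
    obtain ⟨t, ht⟩ := h2
    push_cast at ht
    refine ⟨t, t + k, by linarith, ?_, by ring⟩
    have : n = 2 * t + k := by linarith
    subst this
    linarith
  · rintro ⟨p, q, rfl, h1, h2⟩
    refine ⟨?_, ?_⟩
    · rw [← h1]; have : (k : ℤ) = q - p := h2.symm
      rw [this]; ring
    · rw [← Int.cast_natCast, ZMod.intCast_eq_intCast_iff_dvd_sub]
      exact ⟨p, by push_cast; linarith⟩

theorem mono_mem_tot {m : ℕ} {i n : ℤ} {c : List M₀} {b : List M₁}
    (h : c.length • ((2, 0) : ℤ × ZMod 2) + b.length • ((1 - m, 1) : ℤ × ZMod 2) =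
      (((m + 1) * n - 2 * i : ℤ), (n : ZMod 2))) : mono c b ∈ tot R M₀ M₁ m i n := by
  obtain ⟨p, q, h1, h2, h3⟩ := tot_weight_iff.mp h
  have := mono_mem (R := R) c b
  rw [← h2, ← h3] at this
  exact piece_le_tot p q h1 this

theorem totProj_mem (m : ℕ) (i n : ℤ) (x : SymExt R M₀ M₁) :
    totProj R M₀ M₁ m i n x ∈ tot R M₀ M₁ m i n := by
  classical
  induction x using mono_induction with
  | h0 => simp
  | hadd x y hx hy => rw [map_add]; exact add_mem hx hy
  | hsmul r x hx => rw [map_smul]; exact Submodule.smul_mem _ _ hx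
  | hmono c b =>
    rw [totProj, wproj_mono]
    split_ifs with h
    · exact mono_mem_tot h
    · exact zero_mem _

theorem totProj_of_mem {m : ℕ} {i n : ℤ} {x : SymExt R M₀ M₁} (hx : x ∈ tot R M₀ M₁ m i n) :
    totProj R M₀ M₁ m i n x = x := by
  have h := tot_induction ((totProj R M₀ M₁ m i n).toAddMonoidHom - AddMonoidHom.id _) ⊥ ?_ hx
  · exact sub_eq_zero.mp h
  · intro p q hpq y hy
    change totProj R M₀ M₁ m i n y - y = 0
    -- Pieces of negative degree vanish; the weight computation `wproj_piece` is for natural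
    -- degrees.
    rcases lt_or_ge (p + m * q - i) 0 with h | h
    · rw [piece_eq_bot_of_neg (Or.inl h), Submodule.mem_bot] at hy
      simp [hy]
    rcases lt_or_ge (q - p) 0 with h' | h'
    · rw [piece_eq_bot_of_neg (Or.inr h'), Submodule.mem_bot] at hy
      simp [hy]
    obtain ⟨h, hh⟩ := Int.eq_ofNat_of_zero_le h
    obtain ⟨k, hk⟩ := Int.eq_ofNat_of_zero_le h'
    rw [hh, hk] at hy
    rw [sub_eq_zero]
    exact wproj_piece hy (tot_weight_iff.mpr ⟨p, q, hpq, hh, hk⟩)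

/-- Both parts of `D` have weight `(m + 1, 1)`: for `d` it is `(2, 0) - (1 - m, 1)`, for `a` it is
`m(2, 0) + (1 - m, 1)`. -/
theorem totProj_totD (d : M₁ →ₗ[R] M₀) {m : ℕ} {a : SymExt R M₀ M₁} (ha : a ∈ piece R M₀ M₁ m 1)
    (i n : ℤ) (x : SymExt R M₀ M₁) :
    totProj R M₀ M₁ m i (n + 1) (totD d a x) = totD d a (totProj R M₀ M₁ m i n x) := by
  rw [totD_apply, totD_apply, map_add, totProj, totProj, wproj_koszul,
    wproj_piece_mul _ (k := 1) (by exact_mod_cast ha)]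
  have h1 : (1 : ZMod 2) + 1 = 0 := rfl
  congr 3
  · congr 1
    ext
    · simp only [Prod.fst_add, Prod.fst_sub]; ring
    · simp only [Prod.snd_add, Prod.snd_sub]; push_cast; linear_combination h1
  · congr 1
    ext
    · simp only [Prod.fst_add, Prod.fst_sub, one_smul, Prod.smul_fst]
      simp only [nsmul_eq_mul]
      ring
    · simp only [Prod.snd_add, Prod.snd_sub, one_smul, Prod.smul_snd, smul_zero]; push_cast; ring

end Grading
end SymExt

namespace SymExt

/-! ### Null homotopies and the contraction of the total complex -/

section Contraction

variable {R M₀ M₁ : Type*} [CommRing R] [AddCommGroup M₀] [Module R M₀]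
  [AddCommGroup M₁] [Module R M₁]

/-- The contraction with `w ∈ M₁^∨` on `Sym M₀ ⊗ Λ M₁`. -/
noncomputable def ctr (w : Module.Dual R M₁) : SymExt R M₀ M₁ →ₗ[R] SymExt R M₀ M₁ :=
  LinearMap.lTensor (SymmetricAlgebra R M₀)
    (CliffordAlgebra.contractLeft (Q := (0 : QuadraticForm R M₁)) w)

theorem ctr_ι_mul (w : Module.Dual R M₁) (b : M₁) (x : SymExt R M₀ M₁) :
    ctr w ((1 ⊗ₜ[R] ExteriorAlgebra.ι R b) * x) =
      w b • x - (1 ⊗ₜ[R] ExteriorAlgebra.ι R b) * ctr w x := by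
  induction x using TensorProduct.induction_on with
  | zero => simp
  | tmul s y =>
    have := CliffordAlgebra.contractLeft_ι_mul (Q := (0 : QuadraticForm R M₁)) w b y
    change LinearMap.lTensor _ _ _ = _ - _ * LinearMap.lTensor _ _ _
    rw [Algebra.TensorProduct.tmul_mul_tmul, one_mul, LinearMap.lTensor_tmul,
      LinearMap.lTensor_tmul, Algebra.TensorProduct.tmul_mul_tmul, one_mul,
      ← TensorProduct.tmul_smul, ← TensorProduct.tmul_sub]
    exact congrArg _ this
  | add x y hx hy => rw [mul_add, map_add, map_add, hx, hy, mul_add, smul_add]; abel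

theorem ctr_sym_mul (w : Module.Dual R M₁) (s : SymmetricAlgebra R M₀) (x : SymExt R M₀ M₁) :
    ctr w ((s ⊗ₜ[R] 1) * x) = (s ⊗ₜ[R] 1) * ctr w x := by
  induction x using TensorProduct.induction_on with
  | zero => simp
  | tmul t y => simp [ctr]
  | add x y hx hy => rw [mul_add, map_add, map_add, mul_add, hx, hy]

theorem ctr_mono_nil (w : Module.Dual R M₁) (c : List M₀) :
    ctr w (mono c [] : SymExt R M₀ M₁) = 0 := by
  have h : CliffordAlgebra.contractLeft (Q := (0 : QuadraticForm R M₁)) w 1 = 0 :=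
    CliffordAlgebra.contractLeft_one 0 w
  rw [mono, ctr, LinearMap.lTensor_tmul]
  refine Eq.trans (congrArg _ ?_) (TensorProduct.tmul_zero _ _)
  exact h

/-- The anticommutator of the two odd derivations kills the generators: contraction yields
constants, which `d` kills, and `d` yields elements of `Sym`, which contraction kills. -/
theorem ctr_koszul (d : M₁ →ₗ[R] M₀) (w : Module.Dual R M₁) (x : SymExt R M₀ M₁) :
    koszul d (ctr w x) + ctr w (koszul d x) = 0 := by
  induction x using mono_induction with
  | h0 => simp
  | hadd x y hx hy => simp only [map_add]; rw [add_add_add_comm, hx, hy, add_zero]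
  | hsmul r x hx => simp only [map_smul]; rw [← smul_add, hx, smul_zero]
  | hmono c b =>
    induction b with
    | nil => rw [ctr_mono_nil, koszul_mono_nil, map_zero, map_zero, add_zero]
    | cons b l ih =>
      have h0 := congrArg (((1 : SymmetricAlgebra R M₀) ⊗ₜ[R] ExteriorAlgebra.ι R b) * ·) ih
      simp only [mul_add, mul_zero] at h0
      rw [mono_cons, ctr_ι_mul, koszul_ι_mul, map_sub, map_sub, map_smul, koszul_ι_mul, ctr_sym_mul,
        ctr_ι_mul]
      refine Eq.trans ?_ h0
      abel

/-- The coefficient `(id ⊗ w) a ∈ Sym M₀` of an element `a ∈ Sym M₀ ⊗ Λ M₁`. -/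
noncomputable def coef (w : Module.Dual R M₁) : SymExt R M₀ M₁ →ₗ[R] SymmetricAlgebra R M₀ :=
  (TensorProduct.rid R (SymmetricAlgebra R M₀)).toLinearMap.comp
    (LinearMap.lTensor (SymmetricAlgebra R M₀)
      ((ExteriorAlgebra.algebraMapInv : ExteriorAlgebra R M₁ →ₐ[R] R).toLinearMap.comp
        (CliffordAlgebra.contractLeft (Q := (0 : QuadraticForm R M₁)) w)))

theorem contractLeft_ι' (w : Module.Dual R M₁) (b : M₁) :
    CliffordAlgebra.contractLeft (Q := (0 : QuadraticForm R M₁)) w (ExteriorAlgebra.ι R b) =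
      algebraMap R (ExteriorAlgebra R M₁) (w b) :=
  CliffordAlgebra.contractLeft_ι 0 w b

theorem coef_tmul_ι (w : Module.Dual R M₁) (s : SymmetricAlgebra R M₀) (b : M₁) :
    coef w (s ⊗ₜ[R] ExteriorAlgebra.ι R b) = w b • s := by
  rw [coef, LinearMap.comp_apply, LinearMap.lTensor_tmul, LinearMap.comp_apply, contractLeft_ι']
  simp [ExteriorAlgebra.algebraMapInv]

/-- Contraction is an odd `Sym`-linear derivation, and on exterior degree one it returns the
coefficient. -/
theorem ctr_mul (w : Module.Dual R M₁) {h : ℤ} {a : SymExt R M₀ M₁}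
    (ha : a ∈ piece R M₀ M₁ h 1) (x : SymExt R M₀ M₁) :
    ctr w (a * x) = (coef w a ⊗ₜ[R] 1) * x - a * ctr w x := by
  refine piece_one_induction (fun a => ctr w (a * x) = (coef w a ⊗ₜ[R] 1) * x - a * ctr w x)
    ?_ ?_ ?_ ?_ ha
  · simp
  · intro a b _ _ h1 h2
    simp only [add_mul, map_add, h1, h2, TensorProduct.add_tmul]; abel
  · intro r a h1
    simp only [smul_mul_assoc, map_smul, h1, smul_sub, ← TensorProduct.smul_tmul']
  · intro s b
    rw [mul_assoc, ctr_sym_mul, ctr_ι_mul, mul_sub, ← mul_assoc,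
      Algebra.TensorProduct.tmul_mul_tmul, mul_one, one_mul, coef_tmul_ι, mul_smul_comm,
      ← smul_mul_assoc, TensorProduct.smul_tmul']

theorem ι_mul_add_mul_ι {h : ℤ} {a : SymExt R M₀ M₁} (ha : a ∈ piece R M₀ M₁ h 1) (b : M₁) :
    a * (1 ⊗ₜ[R] ExteriorAlgebra.ι R b) + (1 ⊗ₜ[R] ExteriorAlgebra.ι R b) * a = 0 := by
  refine piece_one_induction
    (fun a => a * (1 ⊗ₜ[R] ExteriorAlgebra.ι R b) + (1 ⊗ₜ[R] ExteriorAlgebra.ι R b) * a = 0)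
    ?_ ?_ ?_ ?_ ha
  · simp
  · intro x y _ _ h1 h2
    rw [add_mul, mul_add, add_add_add_comm, h1, h2, add_zero]
  · intro r x h1
    rw [smul_mul_assoc, mul_smul_comm, ← smul_add, h1, smul_zero]
  · intro s b'
    simp only [Algebra.TensorProduct.tmul_mul_tmul, one_mul, mul_one]
    rw [ι_mul_ι b b', TensorProduct.tmul_neg, add_neg_cancel]

/-- The ideal of `Sym M₀` defining the common zeros of `d` and `a`: it is generated by the image
of `d` and the coefficients of `a`. -/
def baseIdeal (d : M₁ →ₗ[R] M₀) (a : SymExt R M₀ M₁) : Ideal (SymmetricAlgebra R M₀) :=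
  Ideal.span (Set.range (fun b => SymmetricAlgebra.ι R M₀ (d b)) ∪ Set.range fun w => coef w a)

/-- Multiplication by an element of the base ideal is homotopic to zero. -/
theorem exists_nullHomotopy (d : M₁ →ₗ[R] M₀) {h : ℤ} {a : SymExt R M₀ M₁}
    (ha : a ∈ piece R M₀ M₁ h 1) {s : SymmetricAlgebra R M₀} (hs : s ∈ baseIdeal d a) :
    ∃ σ : SymExt R M₀ M₁ →ₗ[R] SymExt R M₀ M₁,
      (∀ (t : SymmetricAlgebra R M₀) x, σ ((t ⊗ₜ[R] 1) * x) = (t ⊗ₜ[R] 1) * σ x) ∧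
      ∀ x, totD d a (σ x) + σ (totD d a x) = (s ⊗ₜ[R] 1) * x := by
  induction hs using Submodule.span_induction with
  | mem s hs =>
    rcases hs with ⟨b, rfl⟩ | ⟨w, rfl⟩
    -- Wedging with `b` anticommutes with `ã`, so its anticommutator with `D` is multiplication by
    -- `d b`.
    · refine ⟨LinearMap.mulLeft R (1 ⊗ₜ[R] ExteriorAlgebra.ι R b), fun t x => ?_, fun x => ?_⟩
      · simp only [LinearMap.mulLeft_apply]
        rw [← mul_assoc, ← sym_comm, mul_assoc]
      · have h0 := congrArg (· * x) (ι_mul_add_mul_ι ha b)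
        simp only [add_mul, zero_mul, mul_assoc] at h0
        simp only [LinearMap.mulLeft_apply, totD_apply, koszul_ι_mul, mul_add]
        rw [← sub_eq_zero]
        refine Eq.trans ?_ h0
        abel
    -- Contraction anticommutes with `d̃`, so only its anticommutator with `ã` remains, and this is
    -- the coefficient.
    · refine ⟨ctr w, fun t x => ctr_sym_mul w t x, fun x => ?_⟩
      rw [totD_apply, totD_apply, map_add, ctr_mul w ha, ← sub_eq_zero]
      refine Eq.trans ?_ (ctr_koszul d w x)
      abel
  | zero => exact ⟨0, by simp, by simp⟩
  | add s t _ _ h1 h2 =>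
    obtain ⟨σ, hσ, hσ'⟩ := h1
    obtain ⟨τ, hτ, hτ'⟩ := h2
    refine ⟨σ + τ, fun t x => by simp [hσ, hτ, mul_add], fun x => ?_⟩
    rw [LinearMap.add_apply, LinearMap.add_apply, map_add, TensorProduct.add_tmul, add_mul, ← hσ',
      ← hτ']
    abel
  | smul r s _ h1 =>
    obtain ⟨σ, hσ, hσ'⟩ := h1
    have hD : ∀ x, totD d a ((r ⊗ₜ[R] 1) * x) = (r ⊗ₜ[R] 1) * totD d a x := fun x => by
      rw [totD_apply, totD_apply, koszul_sym_mul, mul_add, ← mul_assoc, ← sym_comm, mul_assoc]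
    refine ⟨(LinearMap.mulLeft R (r ⊗ₜ[R] 1)).comp σ, fun t x => ?_, fun x => ?_⟩
    · rw [LinearMap.comp_apply, LinearMap.comp_apply, hσ, LinearMap.mulLeft_apply,
        LinearMap.mulLeft_apply, ← mul_assoc, ← sym_comm, mul_assoc]
    · rw [LinearMap.comp_apply, LinearMap.comp_apply, LinearMap.mulLeft_apply,
        LinearMap.mulLeft_apply, hD, ← mul_add, hσ', ← mul_assoc,
        Algebra.TensorProduct.tmul_mul_tmul, mul_one, smul_eq_mul]

theorem totD_sym_mul (d : M₁ →ₗ[R] M₀) (a : SymExt R M₀ M₁) (t : SymmetricAlgebra R M₀)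
    (x : SymExt R M₀ M₁) : totD d a ((t ⊗ₜ[R] 1) * x) = (t ⊗ₜ[R] 1) * totD d a x := by
  rw [totD_apply, totD_apply, koszul_sym_mul, mul_add, ← mul_assoc, ← sym_comm, mul_assoc]

/-- Division by the `N`-th power of a basis element. -/
theorem exists_division {ι₀ : Type*} (e : Module.Basis ι₀ R M₀) (j : ι₀) (N : ℕ) :
    ∃ δ : SymExt R M₀ M₁ →ₗ[R] SymExt R M₀ M₁,
      (∀ x, δ (((SymmetricAlgebra.ι R M₀ (e j) ^ N) ⊗ₜ[R] 1) * x) = x) ∧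
      ∀ i ≠ j, ∀ x, δ (((SymmetricAlgebra.ι R M₀ (e i) ^ N) ⊗ₜ[R] 1) * x) =
        ((SymmetricAlgebra.ι R M₀ (e i) ^ N) ⊗ₜ[R] 1) * δ x := by
  classical
  set E := SymmetricAlgebra.equivMvPolynomial e with hE
  -- Monomials not divisible by `X_j ^ N` are dropped. Divisibility by `X_j ^ N` is not affected by
  -- a factor `X_i ^ N` with `i ≠ j`, hence the commutation.
  let q : MvPolynomial ι₀ R →ₗ[R] MvPolynomial ι₀ R :=
    { toFun := fun p => p.divMonomial (Finsupp.single j N)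
      map_add' := fun p p' => MvPolynomial.add_divMonomial _ _ _
      map_smul' := fun r p => by
        ext m
        simp [MvPolynomial.coeff_divMonomial] }
  let δ₀ : SymmetricAlgebra R M₀ →ₗ[R] SymmetricAlgebra R M₀ :=
    E.symm.toLinearMap.comp (q.comp E.toLinearMap)
  have hq : ∀ p, q p = p.divMonomial (Finsupp.single j N) := fun p => rfl
  have hpow : ∀ i, E ((SymmetricAlgebra.ι R M₀ (e i)) ^ N) =
      MvPolynomial.monomial (Finsupp.single i N) 1 := fun i => by
    rw [map_pow, hE, SymmetricAlgebra.equivMvPolynomial_ι_apply, MvPolynomial.X_pow_eq_monomial]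
  have h1 : ∀ s, δ₀ ((SymmetricAlgebra.ι R M₀ (e j)) ^ N * s) = s := fun s => by
    simp only [δ₀, LinearMap.comp_apply, AlgEquiv.toLinearMap_apply]
    rw [map_mul, hpow, hq, MvPolynomial.divMonomial_monomial_mul, AlgEquiv.symm_apply_apply]
  have h2 : ∀ i ≠ j, ∀ s, δ₀ ((SymmetricAlgebra.ι R M₀ (e i)) ^ N * s) =
      (SymmetricAlgebra.ι R M₀ (e i)) ^ N * δ₀ s := fun i hij s => by
    simp only [δ₀, LinearMap.comp_apply, AlgEquiv.toLinearMap_apply]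
    apply E.injective
    rw [AlgEquiv.apply_symm_apply, map_mul E, map_mul E, AlgEquiv.apply_symm_apply, hpow, hq, hq]
    ext m
    rw [MvPolynomial.coeff_divMonomial, MvPolynomial.coeff_monomial_mul',
      MvPolynomial.coeff_monomial_mul', MvPolynomial.coeff_divMonomial]
    have hiff : Finsupp.single i N ≤ Finsupp.single j N + m ↔ Finsupp.single i N ≤ m := by
      rw [Finsupp.single_le_iff, Finsupp.single_le_iff, Finsupp.add_apply,
        Finsupp.single_eq_of_ne hij, zero_add]
    by_cases hc : Finsupp.single i N ≤ m
    · rw [if_pos (hiff.mpr hc), if_pos hc, add_tsub_assoc_of_le hc]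
    · rw [if_neg (hc ∘ hiff.mp), if_neg hc]
  refine ⟨LinearMap.rTensor _ δ₀, fun x => ?_, fun i hij x => ?_⟩
  · induction x using TensorProduct.induction_on with
    | zero => simp
    | tmul s y =>
      rw [Algebra.TensorProduct.tmul_mul_tmul, one_mul, LinearMap.rTensor_tmul, h1]
    | add x y hx hy => rw [mul_add, map_add, hx, hy]
  · induction x using TensorProduct.induction_on with
    | zero => simp
    | tmul s y =>
      rw [Algebra.TensorProduct.tmul_mul_tmul, one_mul, LinearMap.rTensor_tmul,
        LinearMap.rTensor_tmul, h2 i hij, Algebra.TensorProduct.tmul_mul_tmul, one_mul]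
    | add x y hx hy => rw [mul_add, map_add, map_add, hx, hy, mul_add]

/-- If powers of a basis of `M₀` lie in the base ideal, then the total complex is contractible on
the ideal generated by these powers. -/
theorem exists_contraction (d : M₁ →ₗ[R] M₀) {h : ℤ} {a : SymExt R M₀ M₁}
    (ha : a ∈ piece R M₀ M₁ h 1) (hd : koszul d a = 0) {ι₀ : Type*} [Finite ι₀]
    (e : Module.Basis ι₀ R M₀) (N : ℕ)
    (he : ∀ j, (SymmetricAlgebra.ι R M₀ (e j)) ^ N ∈ baseIdeal d a) :
    ∃ H : SymExt R M₀ M₁ →ₗ[R] SymExt R M₀ M₁, ∀ j x,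
      totD d a (H (((SymmetricAlgebra.ι R M₀ (e j) ^ N) ⊗ₜ[R] 1) * x)) +
        H (totD d a (((SymmetricAlgebra.ι R M₀ (e j) ^ N) ⊗ₜ[R] 1) * x)) =
        ((SymmetricAlgebra.ι R M₀ (e j) ^ N) ⊗ₜ[R] 1) * x := by
  classical
  have := Fintype.ofFinite ι₀
  set y : ι₀ → SymExt R M₀ M₁ := fun j => (SymmetricAlgebra.ι R M₀ (e j) ^ N) ⊗ₜ[R] 1 with hy
  set D := totD d a with hD
  have hDD : ∀ x, D (D x) = 0 := totD_totD d ha hd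
  suffices key : ∀ s : Finset ι₀, ∃ H : SymExt R M₀ M₁ →ₗ[R] SymExt R M₀ M₁, ∀ j ∈ s, ∀ x,
      D (H (y j * x)) + H (D (y j * x)) = y j * x by
    obtain ⟨H, hH⟩ := key Finset.univ
    exact ⟨H, fun j => hH j (Finset.mem_univ j)⟩
  intro s
  induction s using Finset.induction_on with
  | empty => exact ⟨0, by simp⟩
  | insert j s hj ih =>
    obtain ⟨H, hH⟩ := ih
    obtain ⟨σ, hσ, hσD⟩ := exists_nullHomotopy d ha (he j)
    obtain ⟨δ, hδ, hδ'⟩ := exists_division (M₁ := M₁) e j N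
    have hDy : ∀ i x, D (y i * x) = y i * D x := fun i x => totD_sym_mul d a _ x
    have hσy : ∀ i x, σ (y i * x) = y i * σ x := fun i x => hσ _ x
    -- Divide by `y j`, then apply the null homotopy of `y j`. The resulting chain map `B = DK + KD`
    -- is the identity on multiples of `y j` and commutes with `y i` for `i ∈ s`.
    let K : SymExt R M₀ M₁ →ₗ[R] SymExt R M₀ M₁ := σ.comp δ
    let B : SymExt R M₀ M₁ →ₗ[R] SymExt R M₀ M₁ := D.comp K + K.comp D
    have hB : ∀ x, B x = D (σ (δ x)) + σ (δ (D x)) := fun x => rfl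
    have hBj : ∀ x, B (y j * x) = y j * x := fun x => by
      rw [hB, hDy, hδ, hδ, hσD]
    have hBi : ∀ i ∈ s, ∀ x, B (y i * x) = y i * B x := fun i hi x => by
      have hij : i ≠ j := fun h => hj (h ▸ hi)
      rw [hB, hB, hDy, hδ' i hij, hδ' i hij, hσy, hσy, hDy, mul_add]
    have hBD : ∀ x, B (D x) = D (B x) := fun x => by
      rw [hB, hB, hDD, map_zero, map_zero, add_zero, map_add, hDD, zero_add]
    -- The anticommutator of `D` with this map is `(DH + HD)(1 - B) + B`. On multiples of `y j` one
    -- has `B = 1`; on multiples of `y i` the operator `1 - B` stays among them, where `DH + HD =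
    -- 1`.
    refine ⟨H + K - H.comp B, fun i hi x => ?_⟩
    have hexp : ∀ z, D ((H + K - H.comp B) z) + (H + K - H.comp B) (D z) =
        (D (H (z - B z)) + H (D (z - B z))) + B z := fun z => by
      have hKz : B z = D (K z) + K (D z) := rfl
      simp only [LinearMap.sub_apply, LinearMap.add_apply, LinearMap.comp_apply, map_sub, map_add,
        hBD]
      rw [← sub_eq_zero]
      nth_rewrite 5 [hKz]
      abel
    rw [hexp]
    rcases Finset.mem_insert.mp hi with rfl | hi
    · rw [hBj, sub_self]; simp
    · rw [hBi i hi, ← mul_sub, hH i hi, mul_sub]; abel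

end Contraction
end SymExt

namespace SymExt

/-! ### Monomial bases of `K_i^n`, and contraction in large degrees -/

section MonoBasis

variable {R M₀ M₁ : Type*} [CommRing R] [AddCommGroup M₀] [Module R M₀]
  [AddCommGroup M₁] [Module R M₁] {ι₀ ι₁ : Type*}

/-- The list of indices of a monomial. -/
noncomputable def symList (α : ι₀ →₀ ℕ) : List ι₀ := (Finsupp.toMultiset α).toList

theorem length_symList (α : ι₀ →₀ ℕ) : (symList α).length = α.degree := by
  rw [symList, Multiset.length_toList, Finsupp.card_toMultiset, Finsupp.degree]
  rfl

/-- The increasing list of the elements of a finite set. -/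
noncomputable def extList [LinearOrder ι₁] (s : Finset ι₁) : List ι₁ :=
  List.ofFn (Set.powersetCard.ofFinEmbEquiv.symm (Set.powersetCard.prodEquiv.symm s).2)

theorem length_extList [LinearOrder ι₁] (s : Finset ι₁) : (extList s).length = s.card := by
  rw [extList, List.length_ofFn]
  rfl

theorem symmetricAlgebra_basis_apply (e : Module.Basis ι₀ R M₀) (α : ι₀ →₀ ℕ) :
    e.symmetricAlgebra α =
      (((symList α).map e).map (SymmetricAlgebra.ι R M₀)).prod := by
  have h1 : e.symmetricAlgebra α =
      (SymmetricAlgebra.equivMvPolynomial e).symm (MvPolynomial.monomial α 1) := by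
    simp [Module.Basis.symmetricAlgebra]
  rw [h1, MvPolynomial.monomial_eq, map_one, one_mul, map_finsuppProd, symList,
    List.map_map, ← Multiset.prod_coe, ← Multiset.map_coe, Multiset.coe_toList,
    Finsupp.toMultiset_map, Finsupp.prod_toMultiset,
    Finsupp.prod_mapDomain_index (fun _ => pow_zero _) (fun _ _ _ => pow_add _ _ _)]
  refine Finset.prod_congr rfl fun i _ => ?_
  change (SymmetricAlgebra.equivMvPolynomial e).symm (MvPolynomial.X i ^ α i) = _
  rw [map_pow, SymmetricAlgebra.equivMvPolynomial_symm_X]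
  rfl

/-- The basis of `Sym M₀ ⊗ Λ M₁` given by bases of `M₀` and `M₁`. -/
noncomputable def monoBasis [LinearOrder ι₁] (e : Module.Basis ι₀ R M₀) (b : Module.Basis ι₁ R M₁) :
    Module.Basis ((ι₀ →₀ ℕ) × Finset ι₁) R (SymExt R M₀ M₁) :=
  e.symmetricAlgebra.tensorProduct b.ExteriorAlgebra

theorem monoBasis_apply [LinearOrder ι₁] (e : Module.Basis ι₀ R M₀) (b : Module.Basis ι₁ R M₁)
    (x : (ι₀ →₀ ℕ) × Finset ι₁) :
    monoBasis e b x = mono ((symList x.1).map e) ((extList x.2).map b) := by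
  obtain ⟨α, s⟩ := x
  rw [monoBasis, Module.Basis.tensorProduct_apply, mono, symmetricAlgebra_basis_apply,
    ExteriorAlgebra.basis_apply, extList, List.map_map, List.map_ofFn]
  refine congrArg _ ?_
  rw [List.map_ofFn]
  exact ExteriorAlgebra.ιMulti_apply (R := R) _

/-- The monomials of `K_i^n`. -/
def totIndex (m : ℕ) (i n : ℤ) : Set ((ι₀ →₀ ℕ) × Finset ι₁) :=
  {x | x.1.degree • ((2, 0) : ℤ × ZMod 2) + x.2.card • ((1 - m, 1) : ℤ × ZMod 2) =
      (((m + 1) * n - 2 * i : ℤ), (n : ZMod 2))}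

theorem totIndex_eq {m : ℕ} {i n : ℤ} {x : (ι₀ →₀ ℕ) × Finset ι₁} (hx : x ∈ totIndex m i n) :
    2 * (x.1.degree : ℤ) + x.2.card * (1 - m) = (m + 1) * n - 2 * i := by
  have := congrArg Prod.fst hx
  simp only [Prod.fst_add, Prod.smul_fst] at this
  simp only [nsmul_eq_mul] at this
  linarith

theorem finite_totIndex [Finite ι₀] [Finite ι₁] (m : ℕ) (i n : ℤ) :
    (totIndex m i n : Set ((ι₀ →₀ ℕ) × Finset ι₁)).Finite := by
  classical
  have := Fintype.ofFinite ι₀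
  have := Fintype.ofFinite ι₁
  -- The weight equation gives `2 deg = (m + 1)n - 2i + (m - 1)|s|`, so the symmetric degree is at
  -- most `B`.
  let B : ℕ := ((m + 1) * n - 2 * i + m * Fintype.card ι₁).toNat
  have hfin : ((Finset.range (B + 1)).biUnion fun k =>
      Finset.finsuppAntidiag (Finset.univ : Finset ι₀) k : Set (ι₀ →₀ ℕ)).Finite :=
    Finset.finite_toSet _
  refine (hfin.prod (Set.finite_univ (α := Finset ι₁))).subset fun x hx => ⟨?_, trivial⟩
  have h1 := totIndex_eq hx
  have h2 : (x.2.card : ℤ) * m ≤ m * Fintype.card ι₁ := by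
    rw [mul_comm]
    exact mul_le_mul_of_nonneg_left (by exact_mod_cast Finset.card_le_univ x.2) (by positivity)
  have h3 : (0 : ℤ) ≤ x.2.card := by positivity
  have hB : x.1.degree < B + 1 := by
    have h4 : (0 : ℤ) ≤ x.1.degree := by positivity
    have : (x.1.degree : ℤ) ≤ (m + 1) * n - 2 * i + m * Fintype.card ι₁ := by linarith
    omega
  simp only [Finset.coe_biUnion, Set.mem_iUnion]
  refine ⟨x.1.degree, by simpa using hB, ?_⟩
  rw [Finset.mem_coe, Finset.mem_finsuppAntidiag]
  exact ⟨(Finsupp.degree_eq_sum x.1).symm, Finset.subset_univ _⟩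

/-- The weight equation would make twice the symmetric degree negative: `(m - 1)|s|` cannot
compensate `(m + 1)n` once `n < -rank M₁`. -/
theorem totIndex_eq_empty [Fintype ι₁] {m : ℕ} {i n : ℤ} (hi : 0 ≤ i)
    (hn : n < -(Fintype.card ι₁ : ℤ)) :
    (totIndex m i n : Set ((ι₀ →₀ ℕ) × Finset ι₁)) = ∅ := by
  refine Set.eq_empty_of_forall_notMem fun x hx => ?_
  have h1 := totIndex_eq hx
  have h2 : (x.2.card : ℤ) ≤ Fintype.card ι₁ := by exact_mod_cast Finset.card_le_univ x.2
  have h4 : (0 : ℤ) ≤ x.1.degree := by positivity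
  have h5 : (0 : ℤ) ≤ x.2.card := by positivity
  have hm : (0 : ℤ) ≤ m := by positivity
  nlinarith [mul_nonneg hm (sub_nonneg.mpr h2), mul_nonneg hm (sub_nonneg.mpr hn.le)]

variable [LinearOrder ι₁] (e : Module.Basis ι₀ R M₀) (b : Module.Basis ι₁ R M₁)

theorem totProj_monoBasis {m : ℕ} {i n : ℤ}
    [DecidablePred (· ∈ (totIndex m i n : Set ((ι₀ →₀ ℕ) × Finset ι₁)))]
    (x : (ι₀ →₀ ℕ) × Finset ι₁) :
    totProj R M₀ M₁ m i n (monoBasis e b x) = if x ∈ totIndex m i n then monoBasis e b x else 0 := by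
  classical
  rw [monoBasis_apply, totProj, wproj_mono, List.length_map, List.length_map, length_symList,
    length_extList]
  exact if_congr Iff.rfl rfl rfl

theorem monoBasis_mem_tot {m : ℕ} {i n : ℤ} {x : (ι₀ →₀ ℕ) × Finset ι₁}
    (hx : x ∈ totIndex m i n) : monoBasis e b x ∈ tot R M₀ M₁ m i n := by
  classical
  have := totProj_mem m i n (monoBasis e b x)
  rwa [totProj_monoBasis, if_pos hx] at this

theorem tot_eq_span (m : ℕ) (i n : ℤ) :
    tot R M₀ M₁ m i n = Submodule.span R (monoBasis e b '' totIndex m i n) := by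
  classical
  refine le_antisymm (fun z hz => ?_) (Submodule.span_le.mpr ?_)
  · rw [← totProj_of_mem hz, ← (monoBasis e b).linearCombination_repr z,
      Finsupp.linearCombination_apply, Finsupp.sum, map_sum]
    refine Submodule.sum_mem _ fun x _ => ?_
    rw [map_smul, totProj_monoBasis]
    split_ifs with h
    · exact Submodule.smul_mem _ _ (Submodule.subset_span ⟨x, h, rfl⟩)
    · rw [smul_zero]; exact zero_mem _
  · rintro _ ⟨x, hx, rfl⟩
    exact monoBasis_mem_tot e b hx

/-- The basis of `K_i^n` given by bases of `M₀` and `M₁`. -/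
noncomputable def totBasis (m : ℕ) (i n : ℤ) :
    Module.Basis (totIndex m i n : Set ((ι₀ →₀ ℕ) × Finset ι₁)) R (tot R M₀ M₁ m i n) :=
  (Module.Basis.span ((monoBasis e b).linearIndependent.comp _
    (Subtype.val_injective (p := (· ∈ totIndex m i n))))).map
    (LinearEquiv.ofEq _ _ (by
      rw [tot_eq_span e b, Set.range_comp, Subtype.range_coe_subtype]; rfl))

theorem coe_totBasis (m : ℕ) (i n : ℤ) (x : (totIndex m i n : Set ((ι₀ →₀ ℕ) × Finset ι₁))) :
    (totBasis e b m i n x : SymExt R M₀ M₁) = monoBasis e b x := by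
  rw [totBasis, Module.Basis.map_apply, LinearEquiv.coe_ofEq_apply, Module.Basis.span_apply]
  rfl

theorem tot_eq_bot (e : Module.Basis ι₀ R M₀) (b : Module.Basis ι₁ R M₁) [Fintype ι₁] {m : ℕ}
    {i n : ℤ} (hi : 0 ≤ i) (hn : n < -(Fintype.card ι₁ : ℤ)) : tot R M₀ M₁ m i n = ⊥ := by
  rw [tot_eq_span e b, totIndex_eq_empty hi hn, Set.image_empty, Submodule.span_empty]

theorem monoBasis_eq_pow_mul {α : ι₀ →₀ ℕ} {s : Finset ι₁} {j : ι₀} {N : ℕ} (h : N ≤ α j) :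
    monoBasis e b (α, s) = ((SymmetricAlgebra.ι R M₀ (e j) ^ N) ⊗ₜ[R] 1) *
      monoBasis e b (α - Finsupp.single j N, s) := by
  rw [monoBasis, Module.Basis.tensorProduct_apply, Module.Basis.tensorProduct_apply,
    Algebra.TensorProduct.tmul_mul_tmul, one_mul]
  congr 1
  apply (SymmetricAlgebra.equivMvPolynomial e).injective
  rw [map_mul, map_pow, SymmetricAlgebra.equivMvPolynomial_ι_apply]
  simp only [Module.Basis.symmetricAlgebra, Module.Basis.map_apply, MvPolynomial.coe_basisMonomials,
    AlgEquiv.toLinearEquiv_apply, AlgEquiv.apply_symm_apply]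
  rw [MvPolynomial.X_pow_eq_monomial, MvPolynomial.monomial_mul, one_mul,
    add_tsub_cancel_of_le (Finsupp.single_le_iff.mpr h)]

/-- If powers of a basis of `M₀` lie in the base ideal, then the complexes `K_i` are contractible
in large degrees. -/
theorem exists_tot_contraction [Fintype ι₀] (e : Module.Basis ι₀ R M₀)
    (b : Module.Basis ι₁ R M₁) (d : M₁ →ₗ[R] M₀) {m : ℕ} {a : SymExt R M₀ M₁}
    (hm : 1 ≤ m) (ha : a ∈ piece R M₀ M₁ m 1) (hd : koszul d a = 0) (N : ℕ)
    (he : ∀ j, (SymmetricAlgebra.ι R M₀ (e j)) ^ N ∈ baseIdeal d a) :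
    ∃ H : SymExt R M₀ M₁ →ₗ[R] SymExt R M₀ M₁, ∀ i : ℕ, i ≤ m → ∀ n : ℤ,
      ((Fintype.card ι₀ * N + m + 1 : ℕ) : ℤ) ≤ n → ∀ z ∈ tot R M₀ M₁ m i n,
      totD d a (totProj R M₀ M₁ m i (n - 1) (H z)) +
        totProj R M₀ M₁ m i n (H (totD d a z)) = z := by
  obtain ⟨H, hH⟩ := exists_contraction d ha hd e N he
  refine ⟨H, fun i hi n hn z hz => ?_⟩
  have key : totD d a (H z) + H (totD d a z) = z := by
    rw [tot_eq_span e b] at hz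
    induction hz using Submodule.span_induction with
    | mem z hz =>
      obtain ⟨⟨α, s⟩, hx, rfl⟩ := hz
      have h1 := totIndex_eq hx
      simp only at h1
      -- From `2 deg ≥ (m + 1)n - 2i` with `i ≤ m` and `m ≥ 1` follows `deg ≥ n - m`. This is where
      -- `m + 1` in the bound on `n` comes from.
      have h2 : (Fintype.card ι₀ * N : ℤ) < α.degree := by
        have h3 : (0 : ℤ) ≤ s.card * (m - 1) :=
          mul_nonneg (by positivity) (by have : (1 : ℤ) ≤ m := by exact_mod_cast hm
                                         linarith)
        have h4 : (i : ℤ) ≤ m := by exact_mod_cast hi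
        push_cast at hn
        have h5 : (0 : ℤ) ≤ n := by
          have : (0 : ℤ) ≤ Fintype.card ι₀ * N := by positivity
          linarith
        have h6 : (1 : ℤ) ≤ m := by exact_mod_cast hm
        nlinarith
      have h3 : Fintype.card ι₀ * N < ∑ j, α j := by
        rw [← Finsupp.degree_eq_sum]; exact_mod_cast h2
      -- Pigeonhole: some `e j ^ N` divides the monomial, so `H` contracts on it.
      obtain ⟨j, -, hj⟩ : ∃ j ∈ Finset.univ, N < α j := by
        by_contra! hcon
        have : ∑ j, α j ≤ _ := Finset.sum_le_card_nsmul Finset.univ α N hcon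
        rw [Finset.card_univ, smul_eq_mul] at this
        omega
      rw [monoBasis_eq_pow_mul e b hj.le]
      exact hH j _
    | zero => simp
    | add x y _ _ h1 h2 => simp only [map_add]; rw [add_add_add_comm, h1, h2]
    | smul r x _ h => simp only [map_smul]; rw [← smul_add, h]
  -- `H` need not be homogeneous. As `D` is, projecting `DH + HD = 1` to the correct weight leaves a
  -- homogeneous contraction.
  have h2 := totProj_totD d ha (i : ℤ) (n - 1) (H z)
  rw [sub_add_cancel] at h2
  rw [← h2, ← map_add, key, totProj_of_mem hz]

end MonoBasis
end SymExt

namespace SymExt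

/-! ### Homotopy invariance of Koszul homology, by the algebra of forms on a line -/

section Homotopy

variable {R M₀ M₁ M₀' M₁' : Type*} [CommRing R] [AddCommGroup M₀] [Module R M₀]
  [AddCommGroup M₁] [Module R M₁] [AddCommGroup M₀'] [Module R M₀'] [AddCommGroup M₁'] [Module R M₁']

/-- Moving an odd generator past two others changes the sign twice. -/
theorem ι_mul_ι_comm (b b' : M₁) (x : SymExt R M₀ M₁) :
    ((1 ⊗ₜ[R] ExteriorAlgebra.ι R b) * (1 ⊗ₜ[R] ExteriorAlgebra.ι R b')) * x =
      x * ((1 ⊗ₜ[R] ExteriorAlgebra.ι R b) * (1 ⊗ₜ[R] ExteriorAlgebra.ι R b')) := by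
  have key : ∀ y : ExteriorAlgebra R M₁,
      Commute (ExteriorAlgebra.ι R b * ExteriorAlgebra.ι R b') y := by
    intro y
    induction y using ExteriorAlgebra.induction with
    | algebraMap r => exact Algebra.commute_algebraMap_right _ _
    | ι v =>
      change _ * _ = _ * _
      rw [mul_assoc, ι_mul_ι b' v, mul_neg, ← mul_assoc, ι_mul_ι b v, neg_mul, neg_neg, mul_assoc]
    | mul a b ha hb => exact ha.mul_right hb
    | add a b ha hb => exact ha.add_right hb
  induction x using TensorProduct.induction_on with
  | zero => simp
  | tmul t y =>
    simp only [Algebra.TensorProduct.tmul_mul_tmul, one_mul, mul_one]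
    rw [(key y).eq]
  | add x y hx hy => rw [mul_add, add_mul, hx, hy]

variable (R M₀' M₁') in
/-- The odd variable `dt`. -/
noncomputable def dtElt : SymExt R M₀' (M₁' × R) := 1 ⊗ₜ[R] ExteriorAlgebra.ι R (0, 1)

/-- The images `g c + t d'(σ c) + dt σ c` of the elements of `M₀`. -/
noncomputable def pathSym (g₀ : M₀ →ₗ[R] M₀') (d' : M₁' →ₗ[R] M₀') (σ : M₀ →ₗ[R] M₁') :
    M₀ →ₗ[R] Polynomial (SymExt R M₀' (M₁' × R)) :=
  let i₀ : M₀' →ₗ[R] SymExt R M₀' (M₁' × R) :=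
    ((TensorProduct.mk R _ _).flip 1).comp (SymmetricAlgebra.ι R M₀')
  let i₁ : M₁' →ₗ[R] SymExt R M₀' (M₁' × R) :=
    ((TensorProduct.mk R _ _ 1).comp (ExteriorAlgebra.ι R)).comp (LinearMap.inl R M₁' R)
  Polynomial.CAlgHom.toLinearMap.comp
      (i₀.comp g₀ + (LinearMap.mulLeft R (dtElt R M₀' M₁')).comp (i₁.comp σ)) +
    (LinearMap.mulLeft R Polynomial.X).comp
      (Polynomial.CAlgHom.toLinearMap.comp (i₀.comp (d'.comp σ)))

theorem pathSym_apply (g₀ : M₀ →ₗ[R] M₀') (d' : M₁' →ₗ[R] M₀') (σ : M₀ →ₗ[R] M₁') (c : M₀) :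
    pathSym g₀ d' σ c =
      Polynomial.C (SymmetricAlgebra.ι R M₀' (g₀ c) ⊗ₜ[R] 1 +
        dtElt R M₀' M₁' * (1 ⊗ₜ[R] ExteriorAlgebra.ι R (σ c, 0))) +
      Polynomial.X * Polynomial.C (SymmetricAlgebra.ι R M₀' (d' (σ c)) ⊗ₜ[R] 1) := rfl

/-- The images `g b + t σ(d b)` of the elements of `M₁`. -/
noncomputable def pathExt (g₁ : M₁ →ₗ[R] M₁') (d : M₁ →ₗ[R] M₀) (σ : M₀ →ₗ[R] M₁') :
    M₁ →ₗ[R] Polynomial (SymExt R M₀' (M₁' × R)) :=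
  let i₁ : M₁' →ₗ[R] SymExt R M₀' (M₁' × R) :=
    ((TensorProduct.mk R _ _ 1).comp (ExteriorAlgebra.ι R)).comp (LinearMap.inl R M₁' R)
  Polynomial.CAlgHom.toLinearMap.comp (i₁.comp g₁) +
    (LinearMap.mulLeft R Polynomial.X).comp
      (Polynomial.CAlgHom.toLinearMap.comp (i₁.comp (σ.comp d)))

theorem pathExt_apply (g₁ : M₁ →ₗ[R] M₁') (d : M₁ →ₗ[R] M₀) (σ : M₀ →ₗ[R] M₁') (b : M₁) :
    (pathExt g₁ d σ b : Polynomial (SymExt R M₀' (M₁' × R))) =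
      Polynomial.C (1 ⊗ₜ[R] ExteriorAlgebra.ι R (g₁ b, 0)) +
      Polynomial.X * Polynomial.C (1 ⊗ₜ[R] ExteriorAlgebra.ι R (σ (d b), 0)) := rfl

theorem commute_C {A : Type*} [Ring A] {a : A} (h : ∀ x, a * x = x * a) (p : Polynomial A) :
    Commute (Polynomial.C a) p := by
  refine Polynomial.ext fun n => ?_
  rw [Polynomial.coeff_C_mul, Polynomial.coeff_mul_C, h]

/-- All summands of `g c + t d'(σ c) + dt σ c` are even. Centrality lets the universal property of
`Sym` apply although the target algebra is not commutative. -/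
theorem commute_pathSym (g₀ : M₀ →ₗ[R] M₀') (d' : M₁' →ₗ[R] M₀') (σ : M₀ →ₗ[R] M₁') (c : M₀)
    (p : Polynomial (SymExt R M₀' (M₁' × R))) : Commute (pathSym g₀ d' σ c) p := by
  rw [pathSym_apply]
  refine Commute.add_left (commute_C (fun x => ?_) p)
    (Commute.mul_left (Polynomial.X_mul) (commute_C (fun x => sym_comm _ x) p))
  rw [add_mul, mul_add, sym_comm, dtElt, ι_mul_ι_comm]

theorem C_add_X_mul_C_sq {A : Type*} [Ring A] {u v : A} (hu : u * u = 0) (hv : v * v = 0)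
    (huv : u * v + v * u = 0) :
    (Polynomial.C u + Polynomial.X * Polynomial.C v) *
      (Polynomial.C u + Polynomial.X * Polynomial.C v) = 0 := by
  have h1 : ∀ p, Polynomial.C u * (Polynomial.X * p) = Polynomial.X * (Polynomial.C u * p) :=
    fun p => by rw [← mul_assoc, ← Polynomial.X_mul_C, mul_assoc]
  have h2 : ∀ p, Polynomial.C v * (Polynomial.X * p) = Polynomial.X * (Polynomial.C v * p) :=
    fun p => by rw [← mul_assoc, ← Polynomial.X_mul_C, mul_assoc]
  have h3 := congrArg Polynomial.C huv
  rw [map_add, map_zero] at h3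
  rw [add_mul, mul_add, mul_add, h1, mul_assoc Polynomial.X, mul_assoc Polynomial.X, h2,
    ← Polynomial.C_mul, ← Polynomial.C_mul, ← Polynomial.C_mul, ← Polynomial.C_mul, hu, hv,
    map_zero, mul_zero, mul_zero, zero_add, add_zero, ← mul_add, h3, mul_zero]

/-- The homomorphism from `Sym M₀` to the center given by `pathSym`. -/
noncomputable def pathSymHom (g₀ : M₀ →ₗ[R] M₀') (d' : M₁' →ₗ[R] M₀') (σ : M₀ →ₗ[R] M₁') :
    SymmetricAlgebra R M₀ →ₐ[R] Subalgebra.center R (Polynomial (SymExt R M₀' (M₁' × R))) :=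
  SymmetricAlgebra.lift ((pathSym g₀ d' σ).codRestrict
    (Subalgebra.toSubmodule (Subalgebra.center R (Polynomial (SymExt R M₀' (M₁' × R)))))
    fun c => (Subalgebra.mem_center_iff (R := R)).mpr fun p => (commute_pathSym g₀ d' σ c p).symm.eq)

theorem commute_pathSymHom (g₀ : M₀ →ₗ[R] M₀') (d' : M₁' →ₗ[R] M₀') (σ : M₀ →ₗ[R] M₁')
    (s : SymmetricAlgebra R M₀) (p : Polynomial (SymExt R M₀' (M₁' × R))) :
    Commute (((Subalgebra.center R (Polynomial (SymExt R M₀' (M₁' × R)))).val.comp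
      (pathSymHom g₀ d' σ)) s) p :=
  ((Subalgebra.mem_center_iff (R := R)).mp (pathSymHom g₀ d' σ s).2 _).symm

/-- The homomorphism `Sym M₀ ⊗ Λ M₁ → (Sym M₀' ⊗ Λ M₁')[t, dt]` given by a homotopy `σ`. -/
noncomputable def pathMap (g₀ : M₀ →ₗ[R] M₀') (g₁ : M₁ →ₗ[R] M₁') (d : M₁ →ₗ[R] M₀)
    (d' : M₁' →ₗ[R] M₀') (σ : M₀ →ₗ[R] M₁') :
    SymExt R M₀ M₁ →ₐ[R] Polynomial (SymExt R M₀' (M₁' × R)) :=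
  Algebra.TensorProduct.lift
    ((Subalgebra.center R (Polynomial (SymExt R M₀' (M₁' × R)))).val.comp
      (pathSymHom g₀ d' σ))
    (ExteriorAlgebra.lift R ⟨pathExt g₁ d σ, fun b => by
      have h1 := ι_mul_ι (R := R) ((g₁ b, 0) : M₁' × R) (σ (d b), 0)
      rw [pathExt_apply]
      refine C_add_X_mul_C_sq ?_ ?_ ?_ <;>
        simp [Algebra.TensorProduct.tmul_mul_tmul, h1, TensorProduct.tmul_neg]⟩)
    fun s x => commute_pathSymHom g₀ d' σ s _

theorem pathMap_sym (g₀ : M₀ →ₗ[R] M₀') (g₁ : M₁ →ₗ[R] M₁') (d : M₁ →ₗ[R] M₀)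
    (d' : M₁' →ₗ[R] M₀') (σ : M₀ →ₗ[R] M₁') (c : M₀) :
    pathMap g₀ g₁ d d' σ (SymmetricAlgebra.ι R M₀ c ⊗ₜ[R] 1) = pathSym g₀ d' σ c := by
  refine (Algebra.TensorProduct.lift_tmul _ _ _ _ _).trans ?_
  rw [map_one, mul_one, AlgHom.comp_apply,
    pathSymHom, SymmetricAlgebra.lift_ι_apply]
  rfl

theorem pathMap_ext (g₀ : M₀ →ₗ[R] M₀') (g₁ : M₁ →ₗ[R] M₁') (d : M₁ →ₗ[R] M₀)
    (d' : M₁' →ₗ[R] M₀') (σ : M₀ →ₗ[R] M₁') (b : M₁) :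
    pathMap g₀ g₁ d d' σ (1 ⊗ₜ[R] ExteriorAlgebra.ι R b) = pathExt g₁ d σ b := by
  refine (Algebra.TensorProduct.lift_tmul _ _ _ _ _).trans ?_
  rw [map_one, one_mul, ExteriorAlgebra.lift_ι_apply]

/-- Ring homomorphisms out of `Sym M₀ ⊗ Λ M₁` are determined by their values on generators. -/
theorem ringHom_eq_map (E : SymExt R M₀ M₁ →+* SymExt R M₀' M₁') (g₀ : M₀ →ₗ[R] M₀')
    (g₁ : M₁ →ₗ[R] M₁') (hr : ∀ (r : R) x, E (r • x) = r • E x)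
    (h₀ : ∀ c, E (SymmetricAlgebra.ι R M₀ c ⊗ₜ[R] 1) = SymmetricAlgebra.ι R M₀' (g₀ c) ⊗ₜ[R] 1)
    (h₁ : ∀ b, E (1 ⊗ₜ[R] ExteriorAlgebra.ι R b) = 1 ⊗ₜ[R] ExteriorAlgebra.ι R (g₁ b))
    (x : SymExt R M₀ M₁) : E x = map (RingHom.id R) g₀ g₁ x := by
  induction x using mono_induction with
  | h0 => simp
  | hadd x y hx hy => rw [map_add, map_add, hx, hy]
  | hsmul r x hx => rw [hr, map_smul', hx]; rfl
  | hmono c b =>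
    rw [map_mono]
    induction b with
    | nil =>
      induction c with
      | nil => simp [mono, ← Algebra.TensorProduct.one_def]
      | cons c l ih => rw [← sym_mul_mono, map_mul, ih, h₀, List.map_nil, sym_mul_mono]; rfl
    | cons b l ih => rw [mono_cons, map_mul, ih, h₁, List.map_cons, mono_cons]

/-- The total differential of `(Sym M₀' ⊗ Λ M₁')[t, dt]`. -/
noncomputable def pathD (d' : M₁' →ₗ[R] M₀') :
    Polynomial (SymExt R M₀' (M₁' × R)) →+ Polynomial (SymExt R M₀' (M₁' × R)) :=
  ((Polynomial.toFinsuppIso _).symm.toAddMonoidHom.comp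
    (((AddMonoidAlgebra.coeffAddEquiv).symm.toAddMonoidHom.comp
    (Finsupp.mapRange.addMonoidHom
      (koszul (d'.comp (LinearMap.fst R M₁' R))).toAddMonoidHom)).comp
      AddMonoidAlgebra.coeffAddEquiv.toAddMonoidHom)).comp
    (Polynomial.toFinsuppIso _).toAddMonoidHom +
  (AddMonoidHom.mulLeft (Polynomial.C (dtElt R M₀' M₁'))).comp
    Polynomial.derivative.toAddMonoidHom

theorem coeff_pathD (d' : M₁' →ₗ[R] M₀') (p : Polynomial (SymExt R M₀' (M₁' × R))) (k : ℕ) :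
    (pathD d' p).coeff k = koszul (d'.comp (LinearMap.fst R M₁' R)) (p.coeff k) +
      (k + 1) • (dtElt R M₀' M₁' * p.coeff (k + 1)) := by
  change (_ + Polynomial.C (dtElt R M₀' M₁') * Polynomial.derivative p).coeff k = _
  rw [Polynomial.coeff_add, Polynomial.coeff_C_mul, Polynomial.coeff_derivative]
  congr 1
  rw [← mul_assoc, nsmul_eq_mul', Nat.cast_add, Nat.cast_one]

theorem pathD_sym_mul (d' : M₁' →ₗ[R] M₀') (s : SymmetricAlgebra R M₀')
    (p : Polynomial (SymExt R M₀' (M₁' × R))) :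
    pathD d' (Polynomial.C (s ⊗ₜ[R] 1) * p) = Polynomial.C (s ⊗ₜ[R] 1) * pathD d' p := by
  refine Polynomial.ext fun k => ?_
  rw [coeff_pathD, Polynomial.coeff_C_mul, Polynomial.coeff_C_mul, Polynomial.coeff_C_mul,
    coeff_pathD, koszul_sym_mul, mul_add, mul_smul_comm, ← mul_assoc _ (dtElt R M₀' M₁'),
    sym_comm s (dtElt R M₀' M₁'), mul_assoc]

theorem sub_add_nsmul_neg_mul {A : Type*} [Ring A] (k : ℕ) (x u t v : A) :
    x - u + k • (-t * v) = x - (u + k • (t * v)) := by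
  rw [neg_mul, smul_neg]
  abel

theorem pathD_ι_mul (d' : M₁' →ₗ[R] M₀') (b : M₁' × R) (p : Polynomial (SymExt R M₀' (M₁' × R))) :
    pathD d' (Polynomial.C (1 ⊗ₜ[R] ExteriorAlgebra.ι R b) * p) =
      Polynomial.C (SymmetricAlgebra.ι R M₀' (d' b.1) ⊗ₜ[R] 1) * p -
        Polynomial.C (1 ⊗ₜ[R] ExteriorAlgebra.ι R b) * pathD d' p := by
  refine Polynomial.ext fun k => ?_
  have h : dtElt R M₀' M₁' * (1 ⊗ₜ[R] ExteriorAlgebra.ι R b) =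
      -((1 ⊗ₜ[R] ExteriorAlgebra.ι R b) * dtElt R M₀' M₁') := by
    rw [dtElt, Algebra.TensorProduct.tmul_mul_tmul, Algebra.TensorProduct.tmul_mul_tmul,
      ι_mul_ι _ b, TensorProduct.tmul_neg]
  rw [coeff_pathD, Polynomial.coeff_sub, Polynomial.coeff_C_mul, Polynomial.coeff_C_mul,
    Polynomial.coeff_C_mul, Polynomial.coeff_C_mul, coeff_pathD, koszul_ι_mul, mul_add,
    mul_smul_comm, ← mul_assoc, h, ← mul_assoc]
  exact sub_add_nsmul_neg_mul _ _ _ _ _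

theorem pathD_X_mul (d' : M₁' →ₗ[R] M₀') (p : Polynomial (SymExt R M₀' (M₁' × R))) :
    pathD d' (Polynomial.X * p) =
      Polynomial.X * pathD d' p + Polynomial.C (dtElt R M₀' M₁') * p := by
  refine Polynomial.ext fun k => ?_
  rw [coeff_pathD, Polynomial.coeff_add, Polynomial.coeff_C_mul, Polynomial.coeff_X_mul]
  cases k with
  | zero => simp
  | succ k =>
    rw [Polynomial.coeff_X_mul, Polynomial.coeff_X_mul, coeff_pathD, add_smul _ 1, one_smul,
      add_assoc]

theorem neg_mul_sub_zero_add {A : Type*} [Ring A] (t x : A) : -(t * (x - 0)) + t * x = 0 := by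
  rw [sub_zero, neg_add_cancel]

theorem path_identity {A : Type*} [Ring A] (γ t s X δ P β Q : A) :
    (γ + t * s + X * δ) * P - (β + X * s) * Q =
      γ * P - β * Q + (X * (δ * P - s * Q) + t * s * P) := by
  noncomm_ring

/-- `pathMap` is a map of differential graded algebras. On `c ∈ M₀` the terms `-dt d'(σ c)` and `dt
d'(σ c)` cancel; on `b ∈ M₁` both sides are `d'(g₁ b) + t d'(σ(d b)) + dt σ(d b)`. -/
theorem pathMap_koszul (g₀ : M₀ →ₗ[R] M₀') (g₁ : M₁ →ₗ[R] M₁') (d : M₁ →ₗ[R] M₀)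
    (d' : M₁' →ₗ[R] M₀') (σ : M₀ →ₗ[R] M₁') (hg : ∀ b, g₀ (d b) = d' (g₁ b))
    (x : SymExt R M₀ M₁) :
    pathMap g₀ g₁ d d' σ (koszul d x) = pathD d' (pathMap g₀ g₁ d d' σ x) := by
  have hdt : ∀ p, pathD d' (Polynomial.C (dtElt R M₀' M₁') * p) =
      - (Polynomial.C (dtElt R M₀' M₁') * pathD d' p) := by
    intro p
    rw [dtElt, pathD_ι_mul]
    simp only [map_zero, TensorProduct.zero_tmul, zero_mul]
    exact zero_sub (G := Polynomial (SymExt R M₀' (M₁' × R))) _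
  induction x using mono_induction with
  | h0 => simp
  | hadd x y hx hy => simp only [map_add, hx, hy]
  | hsmul r x hx =>
    have h1 : ∀ (p : Polynomial (SymExt R M₀' (M₁' × R))), pathD d' (r • p) = r • pathD d' p := by
      intro p
      refine Polynomial.ext fun k => ?_
      rw [coeff_pathD, Polynomial.coeff_smul, Polynomial.coeff_smul, Polynomial.coeff_smul,
        coeff_pathD, map_smul, mul_smul_comm, smul_add, smul_comm r]
    rw [map_smul, map_smul, map_smul, h1, hx]
  | hmono c b =>
    induction b with
    | nil =>
      rw [koszul_mono_nil, map_zero]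
      induction c with
      | nil =>
        have h1 : (mono [] [] : SymExt R M₀ M₁) = 1 := by
          simp [mono, ← Algebra.TensorProduct.one_def]
        have h2 : koszul (d'.comp (LinearMap.fst R M₁' R)) (1 : SymExt R M₀' (M₁' × R)) = 0 := by
          have := koszul_mono_nil (d'.comp (LinearMap.fst R M₁' R)) []
          rwa [show (mono [] [] : SymExt R M₀' (M₁' × R)) = 1 by
            simp [mono, ← Algebra.TensorProduct.one_def]] at this
        refine Polynomial.ext fun k => ?_
        rw [h1, map_one, coeff_pathD, Polynomial.coeff_one, Polynomial.coeff_one,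
          if_neg (Nat.succ_ne_zero k)]
        split_ifs <;> simp [h2]
      | cons c l ih =>
        rw [← sym_mul_mono, map_mul, pathMap_sym, pathSym_apply, Polynomial.C_add,
          Polynomial.C_mul, add_mul, add_mul, map_add, map_add, pathD_sym_mul, ← ih,
          mul_assoc, hdt, pathD_ι_mul, mul_assoc, pathD_X_mul, pathD_sym_mul, ← ih]
        simp only [mul_zero, zero_add]
        exact (neg_mul_sub_zero_add (A := Polynomial (SymExt R M₀' (M₁' × R))) _ _).symm
    | cons b l ih =>
      rw [mono_cons, koszul_ι_mul, map_sub, map_mul, map_mul, map_mul, pathMap_sym, pathMap_ext,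
        ih, pathSym_apply, pathExt_apply, Polynomial.C_add, Polynomial.C_mul,
        add_mul (Polynomial.C _) _ (pathMap g₀ g₁ d d' σ (mono c l)), map_add, pathD_ι_mul,
        mul_assoc Polynomial.X _ (pathMap g₀ g₁ d d' σ (mono c l)), pathD_X_mul, pathD_ι_mul, hg,
        ← mul_assoc]
      exact path_identity (A := Polynomial (SymExt R M₀' (M₁' × R))) _ _ _ _ _ _ _ _

/-- Homotopic maps agree on Koszul homology, in characteristic `0`. -/
theorem map_sub_map_mem_range (hR : ∀ k : ℕ, k ≠ 0 → IsUnit (k : R)) (g₀ : M₀ →ₗ[R] M₀')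
    (g₁ : M₁ →ₗ[R] M₁') (d : M₁ →ₗ[R] M₀) (d' : M₁' →ₗ[R] M₀') (σ : M₀ →ₗ[R] M₁')
    (hg : ∀ b, g₀ (d b) = d' (g₁ b)) {x : SymExt R M₀ M₁} (hx : koszul d x = 0) :
    ∃ y, map (RingHom.id R) (g₀ + d'.comp σ) (g₁ + σ.comp d) x - map (RingHom.id R) g₀ g₁ x =
      koszul d' y := by
  set π := map (RingHom.id R) (LinearMap.id : M₀' →ₗ[R] M₀') (LinearMap.fst R M₁' R) with hπ
  have hπs : ∀ s, π (SymmetricAlgebra.ι R M₀' s ⊗ₜ[R] 1) = SymmetricAlgebra.ι R M₀' s ⊗ₜ[R] 1 :=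
    fun s => map_ι₀ _ _ _ s
  have hπe : ∀ b, π (1 ⊗ₜ[R] ExteriorAlgebra.ι R b) = 1 ⊗ₜ[R] ExteriorAlgebra.ι R b.1 :=
    fun b => map_ι₁ _ _ _ b
  have hπdt : π (dtElt R M₀' M₁') = 0 := by rw [dtElt, hπe]; simp
  set P := pathMap g₀ g₁ d d' σ x with hP
  -- Evaluation at the endpoints `t = 1` and `t = 0` with `dt = 0` recovers the two maps on `x`.
  let ev : Bool → Polynomial (SymExt R M₀' (M₁' × R)) →+* SymExt R M₀' M₁' := fun t =>
    Polynomial.eval₂RingHom' π (if t then 1 else 0) (fun a => by split_ifs <;> simp)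
  have hev : ∀ t, ev t P = map (RingHom.id R) (if t then g₀ + d'.comp σ else g₀)
      (if t then g₁ + σ.comp d else g₁) x := by
    intro t
    have hC : ∀ a, ev t (Polynomial.C a) = π a := fun a => Polynomial.eval₂_C _ _
    have hX : ev t Polynomial.X = if t then 1 else 0 := Polynomial.eval₂_X _ _
    refine ringHom_eq_map ((ev t).comp (pathMap g₀ g₁ d d' σ).toRingHom) _ _ ?_ ?_ ?_ x
    · intro r x
      change ev t (pathMap g₀ g₁ d d' σ (r • x)) = r • ev t (pathMap g₀ g₁ d d' σ x)
      have h1 : r • pathMap g₀ g₁ d d' σ x =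
          Polynomial.C (algebraMap R _ r) * pathMap g₀ g₁ d d' σ x := Algebra.smul_def r _
      rw [map_smul, h1, map_mul, hC, hπ, map_algebraMap]
      exact (Algebra.smul_def r _).symm
    · intro c
      change ev t (pathMap g₀ g₁ d d' σ _) = _
      rw [pathMap_sym, pathSym_apply, map_add, map_mul, hC, hC, hX, map_add, map_mul, hπdt, hπs, hπs]
      cases t <;> simp [TensorProduct.add_tmul]
    · intro b
      change ev t (pathMap g₀ g₁ d d' σ _) = _
      rw [pathMap_ext, pathExt_apply, map_add, map_mul, hC, hC, hX, hπe, hπe]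
      cases t <;> simp [TensorProduct.tmul_add]
  have hD : ∀ k, koszul (d'.comp (LinearMap.fst R M₁' R)) (P.coeff k) =
      -((k + 1) • (dtElt R M₀' M₁' * P.coeff (k + 1))) := by
    intro k
    have h1 := pathMap_koszul g₀ g₁ d d' σ hg x
    rw [hx, map_zero] at h1
    have h2 := coeff_pathD d' P k
    rw [← h1, Polynomial.coeff_zero] at h2
    exact (neg_eq_of_add_eq_zero_left h2.symm).symm
  -- Contraction with the dual of `dt`. Applied to `d P_k = -(k + 1) dt P_{k+1}`, and then setting
  -- `dt = 0`, it exhibits `(k + 1) P_{k+1}` as a boundary. Dividing by `k + 1` is the integration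
  -- over `t`.
  let w : Module.Dual R (M₁' × R) := LinearMap.snd R M₁' R
  have hK : ∀ k : ℕ, ∃ y, π (P.coeff (k + 1)) = koszul d' y := by
    intro k
    obtain ⟨u, hu⟩ := hR (k + 1) (Nat.succ_ne_zero k)
    have h1 := ctr_koszul (d'.comp (LinearMap.fst R M₁' R)) w (P.coeff k)
    rw [hD, map_neg, map_nsmul, dtElt, ctr_ι_mul] at h1
    have h2 := congrArg π h1
    rw [map_add, map_neg, map_nsmul, map_sub, map_mul, hπe, map_zero,
      hπ, map_koszul (RingHom.id R) LinearMap.id (LinearMap.fst R M₁' R) _ d' (fun _ => rfl),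
      ← hπ] at h2
    have h3 : π (w (0, 1) • P.coeff (k + 1)) = π (P.coeff (k + 1)) := by
      rw [show w (0, 1) = 1 from rfl, one_smul]
    rw [h3, map_zero, TensorProduct.tmul_zero, zero_mul, sub_zero, ← sub_eq_add_neg, sub_eq_zero] at h2
    refine ⟨(↑u⁻¹ : R) • π (ctr w (P.coeff k)), ?_⟩
    rw [map_smul, h2, ← Nat.cast_smul_eq_nsmul R, ← hu, smul_smul, Units.inv_mul, one_smul]
  choose y hy using hK
  refine ⟨∑ k ∈ Finset.range P.natDegree, y k, ?_⟩
  have h1 := hev true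
  have h0 := hev false
  simp only [if_true, Bool.false_eq_true, if_false] at h0 h1
  rw [← h1, ← h0, map_sum]
  have e1 : ev true P = ∑ k ∈ Finset.range (P.natDegree + 1), π (P.coeff k) := by
    change Polynomial.eval₂ π 1 P = _
    rw [Polynomial.eval₂_eq_sum_range]
    simp
  have e0 : ev false P = π (P.coeff 0) := by
    change Polynomial.eval₂ π 0 P = _
    rw [Polynomial.eval₂_at_zero]
  -- The difference of the endpoint values is the sum of the coefficients of positive degree, all of
  -- them boundaries.
  rw [e1, e0, Finset.sum_range_succ', add_sub_cancel_right]
  exact Finset.sum_congr rfl fun k _ => hy k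

end Homotopy
end SymExt

namespace SymExt

/-! ### From Koszul homology to total homology -/

section DoubleComplex

variable {R M₀ M₁ M₀' M₁' : Type*} [CommRing R] [AddCommGroup M₀] [Module R M₀]
  [AddCommGroup M₁] [Module R M₁] [AddCommGroup M₀'] [Module R M₀'] [AddCommGroup M₁'] [Module R M₁']

theorem wproj_map {G : Type*} [AddCommMonoid G] (g₀ g₁ g : G) (f₀ : M₀ →ₗ[R] M₀')
    (f₁ : M₁ →ₗ[R] M₁') (x : SymExt R M₀ M₁) :
    wproj R M₀' M₁' g₀ g₁ g (map (RingHom.id R) f₀ f₁ x) =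
      map (RingHom.id R) f₀ f₁ (wproj R M₀ M₁ g₀ g₁ g x) := by
  classical
  induction x using mono_induction with
  | h0 => simp
  | hadd x y hx hy => simp only [map_add, hx, hy]
  | hsmul r x hx =>
    rw [map_smul', LinearMap.map_smul, LinearMap.map_smul, map_smul', hx, RingHom.id_apply]
  | hmono c b =>
    rw [map_mono, wproj_mono, wproj_mono, List.length_map, List.length_map]
    split_ifs
    · rw [map_mono]
    · rw [map_zero]

variable (R M₀ M₁) in
/-- The projection to the part of `K_i^n` of second degree `q`. -/
noncomputable def bideg (m : ℕ) (i n q : ℤ) : SymExt R M₀ M₁ →ₗ[R] SymExt R M₀ M₁ :=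
  wproj R M₀ M₁ (G := ℤ × ℤ) (1, 0) (0, 1) (n - q + m * q - i, 2 * q - n)

theorem wproj_mem_piece (h k : ℤ) (x : SymExt R M₀ M₁) :
    wproj R M₀ M₁ (G := ℤ × ℤ) (1, 0) (0, 1) (h, k) x ∈ piece R M₀ M₁ h k := by
  classical
  induction x using mono_induction with
  | h0 => simp
  | hadd x y hx hy => rw [map_add]; exact add_mem hx hy
  | hsmul r x hx => rw [map_smul]; exact Submodule.smul_mem _ _ hx
  | hmono c b =>
    rw [wproj_mono]
    split_ifs with hc
    · simp at hc
      exact Submodule.subset_span ⟨c, b, hc.1, hc.2, rfl⟩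
    · exact zero_mem _

theorem wproj_of_mem_piece {h k : ℤ} (g : ℤ × ℤ) {x : SymExt R M₀ M₁}
    (hx : x ∈ piece R M₀ M₁ h k) :
    wproj R M₀ M₁ (G := ℤ × ℤ) (1, 0) (0, 1) g x = if (h, k) = g then x else 0 := by
  classical
  induction hx using Submodule.span_induction with
  | mem x hx =>
    obtain ⟨c, b, rfl, rfl, rfl⟩ := hx
    rw [wproj_mono]
    simp
  | zero => simp
  | add x y _ _ h1 h2 => rw [map_add, h1, h2]; split_ifs <;> simp
  | smul r x _ h => rw [map_smul, h]; split_ifs <;> simp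

theorem bideg_mem_piece (m : ℕ) (i n q : ℤ) (x : SymExt R M₀ M₁) :
    bideg R M₀ M₁ m i n q x ∈ piece R M₀ M₁ (n - q + m * q - i) (2 * q - n) :=
  wproj_mem_piece _ _ _

theorem bideg_mem_tot (m : ℕ) (i n q : ℤ) (x : SymExt R M₀ M₁) :
    bideg R M₀ M₁ m i n q x ∈ tot R M₀ M₁ m i n := by
  have h := bideg_mem_piece m i n q x
  rw [show 2 * q - n = q - (n - q) by ring] at h
  exact piece_le_tot (n - q) q (by ring) h

theorem bideg_bideg (m : ℕ) (i n q q' : ℤ) (x : SymExt R M₀ M₁) :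
    bideg R M₀ M₁ m i n q (bideg R M₀ M₁ m i n q' x) =
      if q' = q then bideg R M₀ M₁ m i n q' x else 0 := by
  rw [bideg, wproj_of_mem_piece _ (bideg_mem_piece m i n q' x)]
  refine if_congr ⟨fun h => ?_, fun h => by rw [h]⟩ rfl rfl
  have := congrArg Prod.snd h
  simp only at this
  omega

theorem bideg_koszul (d : M₁ →ₗ[R] M₀) (m : ℕ) (i n q : ℤ) (x : SymExt R M₀ M₁) :
    bideg R M₀ M₁ m i (n + 1) q (koszul d x) = koszul d (bideg R M₀ M₁ m i n q x) := by
  rw [bideg, wproj_koszul, bideg]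
  congr 3
  ext <;> simp <;> ring

/-- The Koszul part preserves `q` and multiplication by `a` raises it by one, so the lowest
component of a total cycle is a Koszul cycle. -/
theorem bideg_totD (d : M₁ →ₗ[R] M₀) {m : ℕ} {a : SymExt R M₀ M₁} (ha : a ∈ piece R M₀ M₁ m 1)
    (i n q : ℤ) (x : SymExt R M₀ M₁) :
    bideg R M₀ M₁ m i (n + 1) q (totD d a x) =
      koszul d (bideg R M₀ M₁ m i n q x) + a * bideg R M₀ M₁ m i n (q - 1) x := by
  rw [totD_apply, map_add, bideg_koszul]
  congr 1
  rw [bideg, wproj_piece_mul _ (k := 1) (by exact_mod_cast ha), bideg]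
  congr 3
  ext <;> simp <;> ring

theorem eq_zero_of_bideg {m : ℕ} {i n : ℤ} {x : SymExt R M₀ M₁} (hx : x ∈ tot R M₀ M₁ m i n)
    (h : ∀ q, bideg R M₀ M₁ m i n q x = 0) : x = 0 := by
  obtain ⟨s, hs, -⟩ := exists_sum_wproj (G := ℤ × ℤ) (1, 0) (0, 1) x
  rw [hs]
  refine Finset.sum_eq_zero fun g _ => ?_
  by_cases hg : ∃ q, g = (n - q + m * q - i, 2 * q - n)
  · obtain ⟨q, rfl⟩ := hg
    exact h q
  · refine tot_induction (wproj R M₀ M₁ (G := ℤ × ℤ) (1, 0) (0, 1) g).toAddMonoidHom ⊥ ?_ hx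
    intro p q hpq y hy
    change wproj R M₀ M₁ (G := ℤ × ℤ) (1, 0) (0, 1) g y = 0
    rw [wproj_of_mem_piece g hy, if_neg]
    rintro rfl
    exact hg ⟨q, by ext <;> simp <;> omega⟩

theorem map_totD (f₀ : M₀ →ₗ[R] M₀') (f₁ : M₁ →ₗ[R] M₁') (d : M₁ →ₗ[R] M₀) (d' : M₁' →ₗ[R] M₀')
    (hf : ∀ b, f₀ (d b) = d' (f₁ b)) (α x : SymExt R M₀ M₁) :
    map (RingHom.id R) f₀ f₁ (totD d α x) =
      totD d' (map (RingHom.id R) f₀ f₁ α) (map (RingHom.id R) f₀ f₁ x) := by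
  rw [totD_apply, totD_apply, map_add, map_mul, map_koszul _ _ _ d d' hf]

/-- If `f` induces an isomorphism on Koszul homology, then it induces one on total homology. -/
theorem exists_totD_of_koszul (f₀ : M₀ →ₗ[R] M₀') (f₁ : M₁ →ₗ[R] M₁') (d : M₁ →ₗ[R] M₀)
    (d' : M₁' →ₗ[R] M₀') (hf : ∀ b, f₀ (d b) = d' (f₁ b)) {m : ℕ} {α : SymExt R M₀ M₁}
    (hα : α ∈ piece R M₀ M₁ m 1) (hdα : koszul d α = 0)
    (hcone : ∀ y z, koszul d y = 0 → koszul d' z = map (RingHom.id R) f₀ f₁ y →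
      ∃ y' z', y = koszul d y' ∧ z = map (RingHom.id R) f₀ f₁ y' + koszul d' z')
    (B : ℤ) (hB : ∀ h k : ℤ, B < k → piece R M₀ M₁ h k = ⊥ ∧ piece R M₀' M₁' h k = ⊥)
    {i n : ℤ} {y : SymExt R M₀ M₁} {z : SymExt R M₀' M₁'}
    (hy : y ∈ tot R M₀ M₁ m i (n + 1)) (hz : z ∈ tot R M₀' M₁' m i n) (hDy : totD d α y = 0)
    (hDz : totD d' (map (RingHom.id R) f₀ f₁ α) z = map (RingHom.id R) f₀ f₁ y) :
    ∃ y' ∈ tot R M₀ M₁ m i n, ∃ z' ∈ tot R M₀' M₁' m i (n - 1), y = totD d α y' ∧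
      z = map (RingHom.id R) f₀ f₁ y' + totD d' (map (RingHom.id R) f₀ f₁ α) z' := by
  set f := map (RingHom.id R) f₀ f₁ with hfdef
  have ha : f α ∈ piece R M₀' M₁' m 1 := map_mem_piece _ _ _ hα
  have hda : koszul d' (f α) = 0 := by rw [← map_koszul _ _ _ d d' hf, hdα, map_zero]
  -- Induction over the filtration by `q`; `t` bounds the number of steps left. Once `2q ≥ B + n +
  -- 2`, the exterior degrees `2q - (n + 1)` of `y` and `2q - n` of `z` exceed `B`, and nothing
  -- remains.
  have key : ∀ (t : ℕ) (q : ℤ) (y : SymExt R M₀ M₁) (z : SymExt R M₀' M₁'),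
      B + n + 2 - 2 * q ≤ t →
      y ∈ tot R M₀ M₁ m i (n + 1) → z ∈ tot R M₀' M₁' m i n → totD d α y = 0 →
      totD d' (f α) z = f y → (∀ q' < q, bideg R M₀ M₁ m i (n + 1) q' y = 0 ∧
        bideg R M₀' M₁' m i n q' z = 0) →
      ∃ y' ∈ tot R M₀ M₁ m i n, ∃ z' ∈ tot R M₀' M₁' m i (n - 1), y = totD d α y' ∧
        z = f y' + totD d' (f α) z' := by
    intro t
    induction t with
    | zero =>
      intro q y z hq hy hz _ _ hlow
      have h1 : y = 0 := eq_zero_of_bideg hy fun q' => by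
        by_cases hq' : q' < q
        · exact (hlow q' hq').1
        · have := bideg_mem_piece m i (n + 1) q' y
          rwa [(hB _ _ (by push_cast at hq; omega)).1, Submodule.mem_bot] at this
      have h2 : z = 0 := eq_zero_of_bideg hz fun q' => by
        by_cases hq' : q' < q
        · exact (hlow q' hq').2
        · have := bideg_mem_piece m i n q' z
          rwa [(hB _ _ (by push_cast at hq; omega)).2, Submodule.mem_bot] at this
      exact ⟨0, zero_mem _, 0, zero_mem _, by simp [h1], by simp [h2]⟩
    | succ t ih =>
      intro q y z hq hy hz hDy hDz hlow
      have h1 : koszul d (bideg R M₀ M₁ m i (n + 1) q y) = 0 := by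
        have := bideg_totD d hα i (n + 1) q y
        rw [hDy, map_zero, (hlow (q - 1) (by omega)).1, mul_zero, add_zero] at this
        exact this.symm
      have h2 : koszul d' (bideg R M₀' M₁' m i n q z) = f (bideg R M₀ M₁ m i (n + 1) q y) := by
        have := bideg_totD d' ha i n q z
        rw [hDz, (hlow (q - 1) (by omega)).2, mul_zero, add_zero] at this
        rw [← this]
        exact wproj_map _ _ _ _ _ _
      -- The lowest component is a cycle of the Koszul cone, hence a boundary. Subtracting the total
      -- boundary of homogeneous primitives `u`, `v` removes it and changes only components of
      -- larger `q`.
      obtain ⟨y', z', hy', hz'⟩ := hcone _ _ h1 h2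
      set u := bideg R M₀ M₁ m i n q y' with hu
      set v := bideg R M₀' M₁' m i (n - 1) q z' with hv
      have e1 : bideg R M₀ M₁ m i (n + 1) q y = koszul d u := by
        have := congrArg (bideg R M₀ M₁ m i (n + 1) q) hy'
        rwa [bideg_bideg, if_pos rfl, bideg_koszul] at this
      have e2 : bideg R M₀' M₁' m i n q z = f u + koszul d' v := by
        have := congrArg (bideg R M₀' M₁' m i n q) hz'
        have h3 := bideg_koszul d' m i (n - 1) q z'
        rw [sub_add_cancel] at h3
        have h4 : bideg R M₀' M₁' m i n q (f y') = f u := wproj_map _ _ _ _ _ _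
        rwa [bideg_bideg, if_pos rfl, map_add, h3, h4] at this
      have hum : u ∈ tot R M₀ M₁ m i n := bideg_mem_tot _ _ _ _ _
      have hvm : v ∈ tot R M₀' M₁' m i (n - 1) := bideg_mem_tot _ _ _ _ _
      have hDv : totD d' (f α) v ∈ tot R M₀' M₁' m i n := by
        have := totD_mem_tot d' ha hvm
        rwa [sub_add_cancel] at this
      obtain ⟨y₁, hy₁, z₁, hz₁, e3, e4⟩ := ih (q + 1) (y - totD d α u)
        (z - f u - totD d' (f α) v) (by push_cast at hq; omega)
        (sub_mem hy (totD_mem_tot d hα hum))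
        (sub_mem (sub_mem hz (map_mem_tot _ _ _ hum)) hDv)
        (by rw [map_sub, hDy, totD_totD d hα hdα, sub_zero])
        (by rw [map_sub, map_sub, hDz, totD_totD d' ha hda, sub_zero, map_sub, hfdef,
              map_totD f₀ f₁ d d' hf])
        (by
          intro q' hq'
          have e5 : ∀ q', bideg R M₀ M₁ m i n q' u = if q = q' then u else 0 :=
            fun q' => bideg_bideg _ _ _ _ _ _
          have e6 : ∀ q', bideg R M₀' M₁' m i (n - 1) q' v = if q = q' then v else 0 :=
            fun q' => bideg_bideg _ _ _ _ _ _
          have e7 : bideg R M₀' M₁' m i n q' (f u) = f (bideg R M₀ M₁ m i n q' u) :=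
            wproj_map _ _ _ _ _ _
          have e8 := bideg_totD d' ha i (n - 1) q' v
          rw [sub_add_cancel] at e8
          rw [map_sub, map_sub, map_sub, bideg_totD d hα, e7, e8, e5, e5, e6, e6,
            if_neg (show q ≠ q' - 1 by omega), if_neg (show q ≠ q' - 1 by omega), mul_zero,
            add_zero, mul_zero, add_zero]
          rcases eq_or_ne q q' with rfl | hne
          · rw [if_pos rfl, if_pos rfl, e1, e2, sub_self, add_sub_cancel_left, sub_self]
            exact ⟨rfl, rfl⟩
          · have h9 := hlow q' (by omega)
            rw [if_neg hne, if_neg hne, h9.1, h9.2]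
            simp)
      refine ⟨u + y₁, add_mem hum hy₁, v + z₁, add_mem hvm hz₁, ?_, ?_⟩
      · rw [map_add, ← e3, add_sub_cancel]
      · rw [map_add, map_add, add_add_add_comm, ← e4]
        abel
  -- Below `q = (n - 1)/2`, rounded down, the exterior degrees `2q - (n + 1)` and `2q - n` are
  -- negative.
  refine key (B + n + 2 - 2 * ((n - 1) / 2)).toNat ((n - 1) / 2) y z (Int.self_le_toNat _)
    hy hz hDy hDz fun q' hq' => ⟨?_, ?_⟩
  · have := bideg_mem_piece m i (n + 1) q' y
    rwa [piece_eq_bot_of_neg (Or.inr (by omega)), Submodule.mem_bot] at this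
  · have := bideg_mem_piece m i n q' z
    rwa [piece_eq_bot_of_neg (Or.inr (by omega)), Submodule.mem_bot] at this

/-- A homotopy equivalence induces an isomorphism on Koszul homology, in characteristic `0`. -/
theorem koszul_cone_exact (hR : ∀ k : ℕ, k ≠ 0 → IsUnit (k : R)) (f₀ : M₀ →ₗ[R] M₀')
    (f₁ : M₁ →ₗ[R] M₁') (d : M₁ →ₗ[R] M₀) (d' : M₁' →ₗ[R] M₀') (hf : ∀ b, f₀ (d b) = d' (f₁ b))
    (g₀ : M₀' →ₗ[R] M₀) (g₁ : M₁' →ₗ[R] M₁) (hg : ∀ b, g₀ (d' b) = d (g₁ b))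
    (σ : M₀ →ₗ[R] M₁) (σ' : M₀' →ₗ[R] M₁')
    (h₀ : ∀ c, c = g₀ (f₀ c) + d (σ c)) (h₁ : ∀ b, b = g₁ (f₁ b) + σ (d b))
    (h₀' : ∀ c, c = f₀ (g₀ c) + d' (σ' c)) (h₁' : ∀ b, b = f₁ (g₁ b) + σ' (d' b))
    (y : SymExt R M₀ M₁) (z : SymExt R M₀' M₁') (hy : koszul d y = 0)
    (hz : koszul d' z = map (RingHom.id R) f₀ f₁ y) :
    ∃ y' z', y = koszul d y' ∧ z = map (RingHom.id R) f₀ f₁ y' + koszul d' z' := by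
  set f := map (RingHom.id R) f₀ f₁ with hfdef
  set g := map (RingHom.id R) g₀ g₁ with hgdef
  have hfk : ∀ x, f (koszul d x) = koszul d' (f x) := map_koszul _ _ _ d d' hf
  have hgk : ∀ x, g (koszul d' x) = koszul d (g x) := map_koszul _ _ _ d' d hg
  have hid : ∀ x : SymExt R M₀ M₁, map (RingHom.id R) LinearMap.id LinearMap.id x = x := fun x =>
    (ringHom_eq_map (RingHom.id _) LinearMap.id LinearMap.id (fun _ _ => rfl) (fun _ => rfl)
      (fun _ => rfl) x).symm
  have hid' : ∀ x : SymExt R M₀' M₁', map (RingHom.id R) LinearMap.id LinearMap.id x = x :=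
    fun x => (ringHom_eq_map (RingHom.id _) LinearMap.id LinearMap.id (fun _ _ => rfl)
      (fun _ => rfl) (fun _ => rfl) x).symm
  have hgf : ∀ x, koszul d x = 0 → ∃ w, x = g (f x) + koszul d w := by
    intro x hx
    obtain ⟨w, hw⟩ := map_sub_map_mem_range hR (g₀.comp f₀) (g₁.comp f₁) d d σ
      (fun b => by simp [hf, hg]) hx
    rw [show g₀.comp f₀ + d.comp σ = LinearMap.id from LinearMap.ext fun c => (h₀ c).symm,
      show g₁.comp f₁ + σ.comp d = LinearMap.id from LinearMap.ext fun b => (h₁ b).symm, hid] at hw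
    refine ⟨w, ?_⟩
    rw [← hw, hgdef, hfdef, map_map (RingHom.id R) f₀ f₁ (RingHom.id R) g₀ g₁ (RingHom.id R)
      (g₀.comp f₀) (g₁.comp f₁) (RingHom.id R) LinearMap.id LinearMap.id (fun _ => rfl)
      (fun _ => rfl) (fun _ => rfl), hid, add_sub_cancel]
  have hfg : ∀ x, koszul d' x = 0 → ∃ w, x = f (g x) + koszul d' w := by
    intro x hx
    obtain ⟨w, hw⟩ := map_sub_map_mem_range hR (f₀.comp g₀) (f₁.comp g₁) d' d' σ'
      (fun b => by simp [hf, hg]) hx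
    rw [show f₀.comp g₀ + d'.comp σ' = LinearMap.id from LinearMap.ext fun c => (h₀' c).symm,
      show f₁.comp g₁ + σ'.comp d' = LinearMap.id from LinearMap.ext fun b => (h₁' b).symm,
      hid'] at hw
    refine ⟨w, ?_⟩
    rw [← hw, hgdef, hfdef, map_map (RingHom.id R) g₀ g₁ (RingHom.id R) f₀ f₁ (RingHom.id R)
      (f₀.comp g₀) (f₁.comp g₁) (RingHom.id R) LinearMap.id LinearMap.id (fun _ => rfl)
      (fun _ => rfl) (fun _ => rfl), hid', add_sub_cancel]
  obtain ⟨w, hw⟩ := hgf y hy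
  -- `g (f y)` is the boundary of `g z`, so `y` is a boundary. The defect `z - f (g z + w)` is then
  -- a cycle and equals `f g` of itself up to a boundary; adding its image under `g`, also a cycle,
  -- corrects the primitive.
  have e1 : y = koszul d (g z + w) := by rw [map_add, ← hgk, hz, ← hw]
  obtain ⟨z', hz'⟩ := hfg (z - f (g z + w)) (by rw [map_sub, ← hfk, ← e1, hz, sub_self])
  refine ⟨g z + w + g (z - f (g z + w)), z', ?_, ?_⟩
  · rw [map_add, ← e1, ← hgk, map_sub, hz, ← hfk, ← e1, sub_self, map_zero, add_zero]
  · rw [map_add, add_assoc, ← hz', add_sub_cancel]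

end DoubleComplex
end SymExt

/-! ### Graded Nakayama lemma and projective Nullstellensatz -/

section Nakayama

variable {R κ σ : Type*} [CommRing R] [Field κ]

theorem MvPolynomial.mem_ideal_smul_homogeneousSubmodule {I : Ideal R} {L : ℕ}
    {q : MvPolynomial σ R} (hq : q.IsHomogeneous L) (hI : ∀ d, q.coeff d ∈ I) :
    q ∈ I • MvPolynomial.homogeneousSubmodule σ R L := by
  rw [q.as_sum]
  refine Submodule.sum_mem _ fun d hd => ?_
  have h1 : MvPolynomial.monomial d (q.coeff d) = q.coeff d • MvPolynomial.monomial d (1 : R) := by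
    rw [MvPolynomial.smul_monomial, smul_eq_mul, mul_one]
  rw [h1]
  refine Submodule.smul_mem_smul (hI d) ?_
  refine MvPolynomial.isHomogeneous_monomial _ ?_
  by_contra h
  exact MvPolynomial.mem_support_iff.mp hd (hq.coeff_eq_zero h)

/-- If a homogeneous ideal contains powers of the variables modulo a maximal ideal, then it does so
after inverting an element. -/
theorem MvPolynomial.exists_C_mul_X_pow_mem [Finite σ] (φ : R →+* κ)
    (hφ : Function.Surjective φ) (S : Set (MvPolynomial σ R))
    (hS : ∀ p ∈ S, ∃ n, p.IsHomogeneous n)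
    (hX : ∀ j, ∃ N, (X j ^ N : MvPolynomial σ κ) ∈ (Ideal.span S).map (MvPolynomial.map φ)) :
    ∃ (r : R) (L : ℕ), φ r ≠ 0 ∧ ∀ j, C r * X j ^ L ∈ Ideal.span S := by
  classical
  have := Fintype.ofFinite σ
  choose N₀ hN₀ using hX
  set N := ∑ j, N₀ j with hN
  have hXN : ∀ j, ∃ g ∈ Ideal.span S, MvPolynomial.map φ (X j ^ N - g) = 0 := by
    intro j
    have h1 : (X j ^ N : MvPolynomial σ κ) ∈ (Ideal.span S).map (MvPolynomial.map φ) := by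
      rw [hN, ← Nat.add_sub_cancel' (Finset.single_le_sum (f := N₀) (fun _ _ => Nat.zero_le _)
        (Finset.mem_univ j)), pow_add]
      exact Ideal.mul_mem_right _ _ (hN₀ j)
    obtain ⟨g, hg, hg'⟩ := (Ideal.mem_map_iff_of_surjective _
      (MvPolynomial.map_surjective φ hφ)).mp h1
    exact ⟨g, hg, by rw [map_sub, hg', map_pow, map_X, sub_self]⟩
  -- Every monomial of degree `L` has an exponent larger than `N`.
  set L := Fintype.card σ * N + 1 with hL
  have hhom : ∀ p ∈ Ideal.span S, MvPolynomial.homogeneousComponent L p ∈ Ideal.span S :=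
    fun p hp => let _ := MvPolynomial.gradedAlgebra (σ := σ) (R := R)
      MvPolynomial.homogeneousComponent_mem_of_mem (Ideal.homogeneous_span _ _ fun x hx => hS x hx) hp L
  -- Replace a factor `X_j ^ N` by an element `g` of the ideal congruent to it modulo the kernel of
  -- `φ`, and take the degree-`L` part, which keeps the first term in the ideal because the ideal is
  -- homogeneous.
  have hle : MvPolynomial.homogeneousSubmodule σ R L ≤ (Ideal.span S).restrictScalars R ⊔
      RingHom.ker φ • MvPolynomial.homogeneousSubmodule σ R L := by
    intro f hf
    rw [f.as_sum]
    refine Submodule.sum_mem _ fun d hd => ?_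
    have hdL : d.degree = L := by
      by_contra h
      exact MvPolynomial.mem_support_iff.mp hd (IsHomogeneous.coeff_eq_zero hf h)
    obtain ⟨j, -, hj⟩ : ∃ j ∈ Finset.univ, N < d j := by
      by_contra! hcon
      have : ∑ j, d j ≤ _ := Finset.sum_le_card_nsmul Finset.univ d N hcon
      rw [Finset.card_univ, smul_eq_mul, ← Finsupp.degree_eq_sum] at this
      omega
    obtain ⟨g, hg, hg'⟩ := hXN j
    set c := f.coeff d
    have h1 : MvPolynomial.monomial d c =
        MvPolynomial.monomial (d - Finsupp.single j N) c * X j ^ N := by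
      rw [MvPolynomial.X_pow_eq_monomial, MvPolynomial.monomial_mul, mul_one,
        tsub_add_cancel_of_le (Finsupp.single_le_iff.mpr hj.le)]
    set u := MvPolynomial.monomial (d - Finsupp.single j N) c
    have h2 : MvPolynomial.monomial d c = MvPolynomial.homogeneousComponent L (u * g) +
        MvPolynomial.homogeneousComponent L (u * (X j ^ N - g)) := by
      rw [← map_add, ← mul_add, add_sub_cancel, ← h1]
      exact (MvPolynomial.homogeneousComponent_eq_self (isHomogeneous_monomial c hdL)).symm
    rw [h2]
    refine Submodule.add_mem_sup (hhom _ (Ideal.mul_mem_left _ _ hg))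
      (mem_ideal_smul_homogeneousSubmodule (homogeneousComponent_isHomogeneous _ _) fun d => ?_)
    rw [coeff_homogeneousComponent]
    split_ifs
    · rw [RingHom.mem_ker, ← MvPolynomial.coeff_map, map_mul, hg', mul_zero, coeff_zero]
    · exact zero_mem _
  -- Nakayama's lemma applies because the polynomials of a fixed degree form a finitely generated
  -- module. It gives `φ r = 1`.
  obtain ⟨r, hr, hr'⟩ := Submodule.exists_sub_one_mem_and_smul_le_of_fg_of_le_sup
    (MvPolynomial.homogeneousSubmodule_fg (R := R) (σ := σ) L) le_rfl hle
  refine ⟨r, L, fun h0 => ?_, fun j => ?_⟩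
  · rw [RingHom.mem_ker, map_sub, h0, map_one] at hr
    simp at hr
  · have := hr' (Submodule.smul_mem_pointwise_smul _ r _ (show (X j ^ L : MvPolynomial σ R) ∈ _ from
      isHomogeneous_X_pow j L))
    rwa [Submodule.restrictScalars_mem, MvPolynomial.smul_eq_C_mul] at this

/-- Homogeneous version of the Nullstellensatz: a set of polynomials with no nonzero common zero in
the special fibre generates powers of the variables after inverting an element. -/
theorem MvPolynomial.exists_C_mul_X_pow_mem_of_zeros [IsAlgClosed κ] [Finite σ] (φ : R →+* κ)
    (hφ : Function.Surjective φ) (S : Set (MvPolynomial σ R))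
    (hS : ∀ p ∈ S, ∃ n, p.IsHomogeneous n)
    (hz : ∀ v : σ → κ, (∀ p ∈ S, MvPolynomial.eval₂ φ v p = 0) → v = 0) :
    ∃ (r : R) (L : ℕ), φ r ≠ 0 ∧ ∀ j, C r * X j ^ L ∈ Ideal.span S := by
  refine exists_C_mul_X_pow_mem φ hφ S hS fun j => ?_
  -- By the Nullstellensatz it is enough that `X j` vanishes on the zero locus, which contains at
  -- most the origin.
  change X j ∈ Ideal.radical _
  rw [← MvPolynomial.vanishingIdeal_zeroLocus_eq_radical (K := κ), mem_vanishingIdeal_iff]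
  intro v hv
  have : v = 0 := hz v fun p hp => by
    have := hv (MvPolynomial.map φ p) (Ideal.mem_map_of_mem _ (Ideal.subset_span hp))
    rwa [MvPolynomial.aeval_def, MvPolynomial.eval₂_map] at this
  simp [this]

end Nakayama

namespace SymExt
open EulerK

/-! ### Nondegeneracy on a fibre and the base ideal -/

section Fibre

variable {R M₀ M₁ : Type u} [CommRing R] [AddCommGroup M₀] [Module R M₀]
  [AddCommGroup M₁] [Module R M₁] {κ : Type u} [Field κ]

theorem coef_map {R R' M₀ M₁ M₀' M₁' : Type*} [CommRing R] [CommRing R']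
    [AddCommGroup M₀] [Module R M₀] [AddCommGroup M₁] [Module R M₁]
    [AddCommGroup M₀'] [Module R' M₀'] [AddCommGroup M₁'] [Module R' M₁']
    (φ : R →+* R') (g₀ : M₀ →ₛₗ[φ] M₀') (g₁ : M₁ →ₛₗ[φ] M₁') (w : Module.Dual R M₁)
    (w' : Module.Dual R' M₁') (hw : ∀ b, w' (g₁ b) = φ (w b)) {h : ℤ} {a : SymExt R M₀ M₁}
    (ha : a ∈ piece R M₀ M₁ h 1) : coef w' (map φ g₀ g₁ a) = symMap φ g₀ (coef w a) := by
  have hs : ∀ (r : R) (s : SymmetricAlgebra R M₀), symMap φ g₀ (r • s) = φ r • symMap φ g₀ s := by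
    intro r s
    rw [Algebra.smul_def, Algebra.smul_def, map_mul, symMap_algebraMap]
  refine piece_one_induction (fun a => coef w' (map φ g₀ g₁ a) = symMap φ g₀ (coef w a))
    ?_ ?_ ?_ ?_ ha
  · simp
  · intro x y _ _ hx hy; simp only [map_add, hx, hy]
  · intro r x hx; rw [map_smul', LinearMap.map_smul, LinearMap.map_smul, hx, hs]
  · intro s b
    rw [Algebra.TensorProduct.tmul_mul_tmul, mul_one, one_mul, map_tmul, extMap_ι, coef_tmul_ι,
      coef_tmul_ι, hs, hw]

/-- The base ideal is compatible with base change. The bases of `M₁` and `M₁'` are there to carry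
functionals `w` to the target; without them a coefficient of `a` need not map to a coefficient of
its image. -/
theorem symMap_mem_baseIdeal {R R' M₀ M₁ M₀' M₁' ι₁ : Type*} [CommRing R] [CommRing R']
    [AddCommGroup M₀] [Module R M₀] [AddCommGroup M₁] [Module R M₁]
    [AddCommGroup M₀'] [Module R' M₀'] [AddCommGroup M₁'] [Module R' M₁']
    (φ : R →+* R') (g₀ : M₀ →ₛₗ[φ] M₀') (g₁ : M₁ →ₛₗ[φ] M₁') (d : M₁ →ₗ[R] M₀)
    (d' : M₁' →ₗ[R'] M₀') (hd : ∀ b, g₀ (d b) = d' (g₁ b)) (b : Module.Basis ι₁ R M₁)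
    (b' : Module.Basis ι₁ R' M₁') (hb : ∀ j, g₁ (b j) = b' j) {h : ℤ} {a : SymExt R M₀ M₁}
    (ha : a ∈ piece R M₀ M₁ h 1) {s : SymmetricAlgebra R M₀} (hs : s ∈ baseIdeal d a) :
    symMap φ g₀ s ∈ baseIdeal d' (map φ g₀ g₁ a) := by
  induction hs using Submodule.span_induction with
  | mem s hs =>
    rcases hs with ⟨c, rfl⟩ | ⟨w, rfl⟩
    · refine Ideal.subset_span (Or.inl ⟨g₁ c, ?_⟩)
      simp only
      rw [symMap_ι, hd]
    · refine Ideal.subset_span (Or.inr ⟨b'.constr ℕ fun j => φ (w (b j)), ?_⟩)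
      refine coef_map φ g₀ g₁ w _ (fun c => ?_) ha
      have hc : c ∈ Submodule.span R (Set.range b) := by rw [b.span_eq]; trivial
      induction hc using Submodule.span_induction with
      | mem x hx => obtain ⟨i, rfl⟩ := hx; rw [hb, Module.Basis.constr_basis]
      | zero => simp
      | add x y _ _ hx hy => simp only [map_add, hx, hy]
      | smul r x _ hx =>
        rw [LinearMap.map_smulₛₗ, LinearMap.map_smul, LinearMap.map_smul, hx, smul_eq_mul,
          smul_eq_mul, map_mul]
  | zero => simp
  | add x y _ _ h1 h2 => rw [map_add]; exact add_mem h1 h2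
  | smul r x _ h => rw [smul_eq_mul, map_mul]; exact Ideal.mul_mem_left _ _ h

theorem isHomogeneous_equivMvPolynomial_ι {ι₀ : Type*} (e : Module.Basis ι₀ R M₀) (c : M₀) :
    (SymmetricAlgebra.equivMvPolynomial e (SymmetricAlgebra.ι R M₀ c)).IsHomogeneous 1 := by
  have hc : c ∈ Submodule.span R (Set.range e) := by rw [e.span_eq]; trivial
  rw [← MvPolynomial.mem_homogeneousSubmodule]
  induction hc using Submodule.span_induction with
  | mem x hx =>
    obtain ⟨i, rfl⟩ := hx
    rw [SymmetricAlgebra.equivMvPolynomial_ι_apply]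
    exact MvPolynomial.isHomogeneous_X _ _
  | zero => simp
  | add x y _ _ hx hy => simp only [map_add]; exact add_mem hx hy
  | smul r x _ hx => simp only [map_smul]; exact Submodule.smul_mem _ _ hx

theorem isHomogeneous_equivMvPolynomial_coef {ι₀ : Type*} (e : Module.Basis ι₀ R M₀)
    (w : Module.Dual R M₁) {m : ℕ} {a : SymExt R M₀ M₁} (ha : a ∈ piece R M₀ M₁ m 1) :
    (SymmetricAlgebra.equivMvPolynomial e (coef w a)).IsHomogeneous m := by
  rw [← MvPolynomial.mem_homogeneousSubmodule]
  induction ha using Submodule.span_induction with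
  | mem x hx =>
    obtain ⟨c, b, hc, hb, rfl⟩ := hx
    obtain rfl : c.length = m := by exact_mod_cast hc
    have hb' : b.length = 1 := by exact_mod_cast hb
    obtain ⟨b, rfl⟩ := List.length_eq_one_iff.mp hb'
    rw [mono, List.map_singleton, List.prod_singleton, coef_tmul_ι, map_smul]
    refine Submodule.smul_mem _ _ ?_
    clear hb hb' hc
    induction c with
    | nil =>
      rw [List.map_nil, List.prod_nil, map_one]
      exact MvPolynomial.isHomogeneous_one ι₀ R
    | cons c l ih =>
      rw [List.map_cons, List.prod_cons, map_mul, List.length_cons, add_comm]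
      exact (isHomogeneous_equivMvPolynomial_ι e c).mul ih
  | zero => simp
  | add x y _ _ hx hy => simp only [map_add]; exact add_mem hx hy
  | smul r x _ hx => simp only [map_smul]; exact Submodule.smul_mem _ _ hx

/-- The base ideal of a nondegenerate form has no nonzero zeros in the fibre. -/
theorem eq_zero_of_baseIdeal {ι₀ ι₁ : Type*} (e : Module.Basis ι₀ R M₀) (b : Module.Basis ι₁ R M₁)
    (φ : R →+* κ) (hφ : Function.Surjective φ) (d : M₁ →ₗ[R] M₀) {m : ℕ} {a : SymExt R M₀ M₁}
    (ha : a ∈ piece R M₀ M₁ m 1) (hnd : EulerK.FibreNondegenerate φ d a) (v : ι₀ → κ)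
    (hv : ∀ s ∈ baseIdeal d a,
      MvPolynomial.eval₂ φ v (SymmetricAlgebra.equivMvPolynomial e s) = 0) : v = 0 := by
  let _ := φ.toAlgebra
  obtain ⟨c, hc, hnd⟩ := hnd
  set dκ : κ ⊗[R] M₁ →ₗ[κ] κ ⊗[R] M₀ := d.baseChange κ with hdκ
  -- The zero `v` regarded as a functional on the fibre of `M₀`. It kills the image of `d` because
  -- the elements `d b` lie in the base ideal, so it is a vector of `H₀^∨`.
  let V : κ ⊗[R] M₀ →ₗ[κ] κ := (e.baseChange κ).constr ℕ v
  have hV : ∀ j, V (1 ⊗ₜ[R] e j) = v j := by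
    intro j
    rw [← Module.Basis.baseChange_apply, Module.Basis.constr_basis]
  have hVι : ∀ x : M₀, V (1 ⊗ₜ[R] x) = MvPolynomial.eval₂ φ v
      (SymmetricAlgebra.equivMvPolynomial e (SymmetricAlgebra.ι R M₀ x)) := by
    intro x
    have hx : x ∈ Submodule.span R (Set.range e) := by rw [e.span_eq]; trivial
    induction hx using Submodule.span_induction with
    | mem x hx =>
      obtain ⟨j, rfl⟩ := hx
      rw [hV, SymmetricAlgebra.equivMvPolynomial_ι_apply, MvPolynomial.eval₂_X]
    | zero => simp
    | add x y _ _ hx hy => simp only [map_add, TensorProduct.tmul_add, hx, hy, MvPolynomial.eval₂_add]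
    | smul r x _ hx =>
      have h1 : (1 : κ) ⊗ₜ[R] (r • x) = φ r • ((1 : κ) ⊗ₜ[R] x) :=
        (toFibre φ M₀).map_smulₛₗ r x
      rw [h1, map_smul, hx, map_smul, map_smul, MvPolynomial.smul_eq_C_mul, MvPolynomial.eval₂_mul,
        MvPolynomial.eval₂_C, smul_eq_mul]
  have hVd : LinearMap.range dκ ≤ LinearMap.ker V := by
    rintro _ ⟨x, rfl⟩
    induction x using TensorProduct.induction_on with
    | zero => simp
    | tmul t x =>
      have h1 : dκ (t ⊗ₜ[R] x) = t • (1 ⊗ₜ[R] d x) := by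
        rw [hdκ, LinearMap.baseChange_tmul, TensorProduct.smul_tmul', smul_eq_mul, mul_one]
      rw [LinearMap.mem_ker, h1, map_smul, hVι, hv _ (Ideal.subset_span (Or.inl ⟨x, rfl⟩)),
        smul_zero]
    | add x y hx hy => rw [map_add]; exact add_mem hx hy
  let V' : Module.Dual κ ((κ ⊗[R] M₀) ⧸ LinearMap.range dκ) := (LinearMap.range dκ).liftQ V hVd
  have hV'0 : V' = 0 := by
    refine hnd V' fun w => ?_
    -- A functional on `H₁` extends to the fibre of `M₁` and lifts to a functional `w'` on `M₁`, by
    -- a basis and the surjectivity of `φ`. The value of `S(w)` at `v` is then that of the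
    -- coefficient of `a` along `w'`, an element of the base ideal.
    obtain ⟨w₁, hw₁⟩ := LinearMap.exists_extend w
    choose ψ hψ using hφ
    let w' : Module.Dual R M₁ := b.constr ℕ fun j => ψ (w₁ (1 ⊗ₜ[R] b j))
    have hw' : ∀ x, w₁ (toFibre φ M₁ x) = φ (w' x) := by
      intro x
      have hx : x ∈ Submodule.span R (Set.range b) := by rw [b.span_eq]; trivial
      induction hx using Submodule.span_induction with
      | mem x hx =>
        obtain ⟨j, rfl⟩ := hx
        rw [Module.Basis.constr_basis, hψ]
        rfl
      | zero => simp
      | add x y _ _ hx hy => simp only [map_add, hx, hy]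
      | smul r x _ hx =>
        rw [LinearMap.map_smulₛₗ, LinearMap.map_smul, LinearMap.map_smul, hx, smul_eq_mul,
          smul_eq_mul, map_mul]
    have h1 := coef_map φ ((LinearMap.range dκ).mkQ.comp (toFibre φ M₀)) (toFibre φ M₁) w' w₁ hw' ha
    have h2 : ∀ c, coef w₁ (TensorProduct.map LinearMap.id ((ExteriorAlgebra.ι κ).comp
        (LinearMap.ker dκ).subtype) c) =
        TensorProduct.rid κ (SymmetricAlgebra κ ((κ ⊗[R] M₀) ⧸ LinearMap.range dκ))
          (TensorProduct.map LinearMap.id w c) := by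
      intro c
      induction c using TensorProduct.induction_on with
      | zero => simp
      | tmul s x =>
        rw [TensorProduct.map_tmul, TensorProduct.map_tmul, LinearMap.comp_apply, LinearMap.id_apply,
          coef_tmul_ι, TensorProduct.rid_tmul, ← hw₁]
        rfl
      | add x y hx hy => simp only [map_add, hx, hy]
    rw [← h2, hc, h1]
    have h3 : ∀ s : SymmetricAlgebra R M₀, SymmetricAlgebra.lift (A := κ) V'
        (symMap φ ((LinearMap.range dκ).mkQ.comp (toFibre φ M₀)) s) =
          MvPolynomial.eval₂ φ v (SymmetricAlgebra.equivMvPolynomial e s) := by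
      intro s
      induction s using SymmetricAlgebra.induction with
      | algebraMap r =>
        rw [symMap_algebraMap, AlgHom.commutes, AlgEquiv.commutes, MvPolynomial.algebraMap_eq,
          MvPolynomial.eval₂_C]
        rfl
      | ι x => rw [symMap_ι, SymmetricAlgebra.lift_ι_apply, ← hVι]; rfl
      | mul x y hx hy => rw [map_mul, map_mul, hx, hy, map_mul, MvPolynomial.eval₂_mul]
      | add x y hx hy => rw [map_add, map_add, hx, hy, map_add, MvPolynomial.eval₂_add]
    rw [h3]
    exact hv _ (Ideal.subset_span (Or.inr ⟨w', rfl⟩))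
  funext j
  rw [← hV j]
  exact LinearMap.congr_fun hV'0 ((LinearMap.range dκ).mkQ (1 ⊗ₜ[R] e j))

/-- If a form is nondegenerate on a fibre, then, after inverting an element, the base ideal contains
powers of a basis. -/
theorem exists_smul_pow_mem_baseIdeal [IsAlgClosed κ] {ι₀ ι₁ : Type*} [Finite ι₀]
    (e : Module.Basis ι₀ R M₀) (b : Module.Basis ι₁ R M₁)
    (φ : R →+* κ) (hφ : Function.Surjective φ) (d : M₁ →ₗ[R] M₀) {m : ℕ} {a : SymExt R M₀ M₁}
    (ha : a ∈ piece R M₀ M₁ m 1) (hnd : EulerK.FibreNondegenerate φ d a) :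
    ∃ (r : R) (N : ℕ), φ r ≠ 0 ∧ ∀ j, r • SymmetricAlgebra.ι R M₀ (e j) ^ N ∈ baseIdeal d a := by
  set E := SymmetricAlgebra.equivMvPolynomial e with hE
  let S : Set (SymmetricAlgebra R M₀) := Set.range (fun b => SymmetricAlgebra.ι R M₀ (d b)) ∪
    Set.range (fun w => coef w a)
  have hS : baseIdeal d a = Ideal.span S := rfl
  have hspan : Ideal.span (E '' S) = (Ideal.span S).map E := (Ideal.map_span E S).symm
  obtain ⟨r, N, hr, h⟩ := MvPolynomial.exists_C_mul_X_pow_mem_of_zeros φ hφ (E '' S)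
    (by
      rintro _ ⟨_, ⟨x, rfl⟩ | ⟨w, rfl⟩, rfl⟩
      · exact ⟨1, isHomogeneous_equivMvPolynomial_ι e _⟩
      · exact ⟨m, isHomogeneous_equivMvPolynomial_coef e w ha⟩)
    (fun v hv => eq_zero_of_baseIdeal e b φ hφ d ha hnd v fun s hs => by
      rw [hS] at hs
      induction hs using Submodule.span_induction with
      | mem s hs => exact hv _ ⟨s, hs, rfl⟩
      | zero => simp
      | add x y _ _ hx hy => rw [map_add, MvPolynomial.eval₂_add, hx, hy, add_zero]
      | smul r x _ hx => rw [smul_eq_mul, map_mul, MvPolynomial.eval₂_mul, hx, mul_zero])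
  refine ⟨r, N, hr, fun j => ?_⟩
  have h1 := h j
  rw [hspan, Ideal.mem_map_iff_of_surjective _ E.surjective] at h1
  obtain ⟨x, hx, hx'⟩ := h1
  have : x = r • SymmetricAlgebra.ι R M₀ (e j) ^ N := by
    apply E.injective
    rw [map_smul, map_pow, hE, SymmetricAlgebra.equivMvPolynomial_ι_apply, MvPolynomial.smul_eq_C_mul]
    exact hx'
  rw [hS, ← this]
  exact hx

end Fibre
end SymExt

/-! ### Sheaves of modules through their sections -/

namespace AlgebraicGeometry.EulerK

variable {X : Scheme.{u}} {M N K : X.Modules}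

theorem resM_resM {U V W : X.Opens} (h : V ≤ U) (h' : W ≤ V) (x : Γ(M, U)) :
    resM M h' (resM M h x) = resM M (h'.trans h) x :=
  (ConcreteCategory.congr_hom (M.presheaf.map_comp (homOfLE h).op (homOfLE h').op) x).symm

theorem resM_self {U : X.Opens} (x : Γ(M, U)) : resM M le_rfl x = x :=
  ConcreteCategory.congr_hom (M.presheaf.map_id (op U)) x

theorem resO_self {U : X.Opens} (x : Γ(X, U)) : resO le_rfl x = x :=
  ConcreteCategory.congr_hom (X.presheaf.map_id (op U)) x

theorem onSections_comp (f : M ⟶ N) (g : N ⟶ K) (U : X.Opens) (x : Γ(M, U)) :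
    onSections (f ≫ g) U x = onSections g U (onSections f U x) := rfl

theorem onSections_id (U : X.Opens) (x : Γ(M, U)) : onSections (𝟙 M) U x = x := rfl

theorem onSections_add (f g : M ⟶ N) (U : X.Opens) (x : Γ(M, U)) :
    onSections (f + g) U x = onSections f U x + onSections g U x := rfl

theorem onSections_neg (f : M ⟶ N) (U : X.Opens) (x : Γ(M, U)) :
    onSections (-f) U x = -onSections f U x := rfl

theorem onSections_zero (U : X.Opens) (x : Γ(M, U)) : onSections (0 : M ⟶ N) U x = 0 := rfl

/-- Sections that agree locally are equal. -/
theorem section_ext {U : X.Opens} {s t : Γ(M, U)}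
    (h : ∀ x ∈ U, ∃ (V : X.Opens) (_ : x ∈ V) (hV : V ≤ U), resM M hV s = resM M hV t) : s = t := by
  choose! V hxV hV hst using h
  refine TopCat.Sheaf.eq_of_locally_eq' ⟨M.presheaf, M.isSheaf⟩ (fun x : U => V x.1) U
    (fun x => homOfLE (hV x.1 x.2)) (fun x hx => ?_) s t fun x => hst x.1 x.2
  exact TopologicalSpace.Opens.mem_iSup.mpr ⟨⟨x, hx⟩, hxV x hx⟩

/-- Gluing of sections. -/
theorem section_glue {U : X.Opens} {ι : Type u} (V : ι → X.Opens) (hV : ∀ i, V i ≤ U)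
    (hU : ∀ x ∈ U, ∃ i, x ∈ V i) (s : ∀ i, Γ(M, V i))
    (h : ∀ i j (W : X.Opens) (hi : W ≤ V i) (hj : W ≤ V j), resM M hi (s i) = resM M hj (s j)) :
    ∃ t : Γ(M, U), ∀ i, resM M (hV i) t = s i := by
  obtain ⟨t, ht, -⟩ := TopCat.Sheaf.existsUnique_gluing' ⟨M.presheaf, M.isSheaf⟩ V U
    (fun i => homOfLE (hV i)) (fun x hx => TopologicalSpace.Opens.mem_iSup.mpr (hU x hx)) s
    fun i j => h i j _ _ _
  exact ⟨t, ht⟩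

/-- Functions that agree locally are equal. -/
theorem function_ext {U : X.Opens} {s t : Γ(X, U)}
    (h : ∀ x ∈ U, ∃ (V : X.Opens) (_ : x ∈ V) (hV : V ≤ U), resO hV s = resO hV t) : s = t := by
  choose! V hxV hV hst using h
  refine TopCat.Sheaf.eq_of_locally_eq' X.sheaf (fun x : U => V x.1) U
    (fun x => homOfLE (hV x.1 x.2)) (fun x hx => ?_) s t fun x => hst x.1 x.2
  exact TopologicalSpace.Opens.mem_iSup.mpr ⟨⟨x, hx⟩, hxV x hx⟩

/-- Gluing of functions. -/
theorem function_glue {U : X.Opens} {ι : Type u} (V : ι → X.Opens) (hV : ∀ i, V i ≤ U)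
    (hU : ∀ x ∈ U, ∃ i, x ∈ V i) (s : ∀ i, Γ(X, V i))
    (h : ∀ i j (W : X.Opens) (hi : W ≤ V i) (hj : W ≤ V j), resO hi (s i) = resO hj (s j)) :
    ∃ t : Γ(X, U), ∀ i, resO (hV i) t = s i := by
  obtain ⟨t, ht, -⟩ := TopCat.Sheaf.existsUnique_gluing' X.sheaf V U
    (fun i => homOfLE (hV i)) (fun x hx => TopologicalSpace.Opens.mem_iSup.mpr (hU x hx)) s
    fun i j => h i j _ _ _
  exact ⟨t, ht⟩

/-- Sections on `U`, as a functor to abelian groups. -/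
noncomputable def sectionsAb (U : X.Opens) : X.Modules ⥤ Ab :=
  Scheme.Modules.toPresheaf X ⋙ (evaluation _ _).obj (op U)

instance (U : X.Opens) : (sectionsAb U).Additive where
  map_add := rfl

noncomputable instance (U : X.Opens) : PreservesFiniteLimits (sectionsAb U) :=
  have : PreservesFiniteLimits (Scheme.Modules.toPresheaf X) :=
    PreservesLimits.preservesFiniteLimits _
  have : PreservesFiniteLimits ((evaluation (TopologicalSpace.Opens X)ᵒᵖ Ab.{u}).obj (op U)) :=
    ⟨fun _ _ _ => inferInstance⟩
  comp_preservesFiniteLimits _ _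

/-- Sections are left exact. -/
theorem exists_section_of_exact {S : ShortComplex X.Modules} (hS : S.Exact) [Mono S.f]
    {U : X.Opens} (y : Γ(S.X₂, U)) (hy : onSections S.g U y = 0) :
    ∃ z : Γ(S.X₁, U), onSections S.f U z = y := by
  have key : (∀ S : ShortComplex X.Modules, S.Exact ∧ Mono S.f →
      (S.map (sectionsAb U)).Exact ∧ Mono ((sectionsAb U).map S.f)) ↔
      PreservesFiniteLimits (sectionsAb U) :=
    (Functor.preservesFiniteLimits_tfae (sectionsAb U)).out 1 3
  have h := key.mpr inferInstance S ⟨hS, inferInstance⟩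
  exact (ShortComplex.ab_exact_iff _).mp h.1 y hy

theorem onSections_injective (f : M ⟶ N) [Mono f] (U : X.Opens) :
    Function.Injective (onSections f U) := by
  have : Mono ((sectionsAb U).map f) := inferInstance
  exact (AddCommGrpCat.mono_iff_injective _).mp this

theorem mono_of_onSections (f : M ⟶ N)
    (h : ∀ (U : X.Opens) (s : Γ(M, U)), onSections f U s = 0 → s = 0) : Mono f := by
  refine Preadditive.mono_of_cancel_zero _ fun {P} g hg => ?_
  ext U s
  exact h U _ (ConcreteCategory.congr_hom (congrArg (fun k => k.app U) hg) s)

theorem epi_of_onSections (f : M ⟶ N)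
    (h : ∀ (U : X.Opens) (t : Γ(N, U)), ∀ x ∈ U, ∃ (V : X.Opens) (_ : x ∈ V) (hV : V ≤ U)
      (s : Γ(M, V)), onSections f V s = resM N hV t) : Epi f := by
  refine Preadditive.epi_of_cancel_zero _ fun {P} g hg => ?_
  ext U t
  refine section_ext fun x hx => ?_
  obtain ⟨V, hxV, hV, s, hs⟩ := h U t x hx
  refine ⟨V, hxV, hV, ?_⟩
  change resM P hV (onSections g U t) = resM P hV 0
  rw [resM_onSections, ← hs, ← onSections_comp, hg, map_zero]
  rfl

/-- Exactness from local exactness on sections. -/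
theorem exact_of_onSections (S : ShortComplex X.Modules)
    (h : ∀ (U : X.Opens) (y : Γ(S.X₂, U)), onSections S.g U y = 0 → ∀ x ∈ U,
      ∃ (V : X.Opens) (_ : x ∈ V) (hV : V ≤ U) (z : Γ(S.X₁, V)),
        onSections S.f V z = resM S.X₂ hV y) : S.Exact := by
  rw [S.exact_iff_epi_kernel_lift]
  refine epi_of_onSections _ fun U t x hx => ?_
  obtain ⟨V, hxV, hV, z, hz⟩ := h U (onSections (kernel.ι S.g) U t) (by
    rw [← onSections_comp, kernel.condition]; rfl) x hx
  refine ⟨V, hxV, hV, z, onSections_injective (kernel.ι S.g) V ?_⟩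
  rw [← onSections_comp, kernel.lift_ι, hz, resM_onSections]

theorem isIso_of_onSections (f : M ⟶ N)
    (h₁ : ∀ (U : X.Opens) (s : Γ(M, U)), onSections f U s = 0 → s = 0)
    (h₂ : ∀ (U : X.Opens) (t : Γ(N, U)), ∀ x ∈ U, ∃ (V : X.Opens) (_ : x ∈ V) (hV : V ≤ U)
      (s : Γ(M, V)), onSections f V s = resM N hV t) : IsIso f := by
  have := mono_of_onSections f h₁
  have := epi_of_onSections f h₂
  exact isIso_of_mono_of_epi f

section Sheafification

variable (P : X.PresheafOfModules)

/-- The associated sheaf. -/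
noncomputable abbrev shf : X.Modules :=
  (PresheafOfModules.sheafification (𝟙 X.ringCatSheaf.obj)).obj P

/-- The unit of sheafification on sections. -/
noncomputable def shfUnit (U : X.Opens) : P.presheaf.obj (op U) →+ Γ(shf P, U) :=
  ((CategoryTheory.toSheafify (Opens.grothendieckTopology X) P.presheaf).app (op U)).hom

theorem shfUnit_res {U V : X.Opens} (h : V ≤ U) (x : P.presheaf.obj (op U)) :
    resM (shf P) h (shfUnit P U x) = shfUnit P V (P.presheaf.map (homOfLE h).op x) :=
  (ConcreteCategory.congr_hom ((CategoryTheory.toSheafify (Opens.grothendieckTopology X)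
    P.presheaf).naturality (homOfLE h).op) x).symm

theorem shfUnit_smul {U : X.Opens} (r : Γ(X, U)) (x : P.obj (op U)) :
    shfUnit P U ((show X.ringCatSheaf.obj.obj (op U) from r) • x : P.obj (op U)) =
      r • shfUnit P U x :=
  (((PresheafOfModules.sheafificationAdjunction (𝟙 X.ringCatSheaf.obj)).unit.app P).app
    (op U)).hom.map_smul (show X.ringCatSheaf.obj.obj (op U) from r) x

theorem shfUnit_locally_injective {U : X.Opens} (x : P.presheaf.obj (op U))
    (hx : shfUnit P U x = 0) : ∀ p ∈ U, ∃ (V : X.Opens) (_ : p ∈ V) (hV : V ≤ U),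
      P.presheaf.map (homOfLE hV).op x = 0 := by
  intro p hp
  have h := CategoryTheory.Presheaf.equalizerSieve_mem (Opens.grothendieckTopology X)
    (CategoryTheory.toSheafify (Opens.grothendieckTopology X) P.presheaf) x 0
    (by rw [map_zero]; exact hx)
  obtain ⟨V, f, hf, hpV⟩ := h p hp
  exact ⟨V, hpV, f.le, hf.trans (map_zero _)⟩

theorem shfUnit_locally_surjective {U : X.Opens} (t : Γ(shf P, U)) :
    ∀ p ∈ U, ∃ (V : X.Opens) (_ : p ∈ V) (hV : V ≤ U) (s : P.presheaf.obj (op V)),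
      shfUnit P V s = resM (shf P) hV t := by
  intro p hp
  have h := CategoryTheory.Presheaf.imageSieve_mem (Opens.grothendieckTopology X)
    (CategoryTheory.toSheafify (Opens.grothendieckTopology X) P.presheaf) (U := op U) t
  obtain ⟨V, f, ⟨s, hs⟩, hpV⟩ := h p hp
  exact ⟨V, hpV, f.le, s, hs⟩

theorem onSections_shfUnit {P Q : X.PresheafOfModules} (f : P ⟶ Q) (U : X.Opens)
    (x : P.presheaf.obj (op U)) :
    onSections ((PresheafOfModules.sheafification (𝟙 X.ringCatSheaf.obj)).map f : shf P ⟶ shf Q) U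
      (shfUnit P U x) = shfUnit Q U (f.app (op U) x) :=
  (ConcreteCategory.congr_hom (NatTrans.congr_app (CategoryTheory.toSheafify_naturality
    (Opens.grothendieckTopology X) ((PresheafOfModules.toPresheaf _).map f)) (op U)) x).symm

end Sheafification

end AlgebraicGeometry.EulerK

namespace AlgebraicGeometry.EulerK

variable {X : Scheme.{u}} {M N K : X.Modules}

/-- An epimorphism of sheaves of modules is locally surjective on sections. -/
theorem exists_section_of_epi (f : M ⟶ N) [Epi f] {U : X.Opens} (t : Γ(N, U)) :
    ∀ x ∈ U, ∃ (V : X.Opens) (_ : x ∈ V) (hV : V ≤ U) (s : Γ(M, V)),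
      onSections f V s = resM N hV t := by
  let φ := (Scheme.Modules.toPresheafOfModules X).map f
  let S : ShortComplex X.PresheafOfModules := ShortComplex.mk φ (cokernel.π φ) (cokernel.condition φ)
  have hS : S.Exact := S.exact_of_g_is_cokernel (cokernelIsCokernel φ)
  let C := cokernel φ
  -- The map from `N` to the sheafified presheaf cokernel of `f`. It vanishes after composition with
  -- the epimorphism `f`, hence is zero; so the class of `t` in the presheaf cokernel is locally
  -- zero, which is local liftability.
  let g : N ⟶ shf C := ⟨PresheafOfModules.homMk
    { app := fun V => AddCommGrpCat.ofHom ((shfUnit C V.unop).comp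
        ((cokernel.π φ).app V).hom.toAddMonoidHom)
      naturality := fun V W k => by
        ext x
        change shfUnit C W.unop ((cokernel.π φ).app W (N.presheaf.map k x)) =
          (shf C).presheaf.map k (shfUnit C V.unop ((cokernel.π φ).app V x))
        refine Eq.trans ?_ (shfUnit_res C k.unop.le _).symm
        exact congrArg _ (ConcreteCategory.congr_hom
          (((PresheafOfModules.toPresheaf _).map (cokernel.π φ)).naturality k) x) }
    (fun V r x => by
      change shfUnit C V.unop ((cokernel.π φ).app V (r • x)) = _
      refine Eq.trans ?_ (shfUnit_smul C (U := V.unop) r _)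
      exact congrArg _ (((cokernel.π φ).app V).hom.map_smul r x))⟩
  have hg : g = 0 := by
    rw [← cancel_epi f, comp_zero]
    ext V s
    change shfUnit C V ((cokernel.π φ).app (op V) (φ.app (op V) s)) = 0
    have h : (φ ≫ cokernel.π φ).app (op V) s = 0 := by rw [cokernel.condition]; rfl
    rw [← map_zero (shfUnit C V)]
    exact congrArg _ h
  have ht : shfUnit C U ((cokernel.π φ).app (op U) t) = 0 :=
    ConcreteCategory.congr_hom (congrArg (fun k : N ⟶ shf C => k.app U) hg) t
  intro x hx
  obtain ⟨V, hxV, hV, h⟩ := shfUnit_locally_injective C _ ht x hx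
  refine ⟨V, hxV, hV, ?_⟩
  have h' : (cokernel.π φ).app (op V) (resM N hV t) = 0 := by
    refine Eq.trans ?_ h
    exact ConcreteCategory.congr_hom
          (((PresheafOfModules.toPresheaf _).map (cokernel.π φ)).naturality (homOfLE hV).op) t
  have hSV := hS.map (PresheafOfModules.evaluation X.ringCatSheaf.obj (op V))
  rw [ShortComplex.moduleCat_exact_iff] at hSV
  exact hSV (resM N hV t) h'

/-- Exact sequences are locally exact on sections. -/
theorem exists_section_of_exact' {S : ShortComplex X.Modules} (hS : S.Exact) {U : X.Opens}
    (y : Γ(S.X₂, U)) (hy : onSections S.g U y = 0) :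
    ∀ x ∈ U, ∃ (V : X.Opens) (_ : x ∈ V) (hV : V ≤ U) (z : Γ(S.X₁, V)),
      onSections S.f V z = resM S.X₂ hV y := by
  have := S.exact_iff_epi_kernel_lift.mp hS
  have hk : (ShortComplex.mk (kernel.ι S.g) S.g (kernel.condition _)).Exact :=
    ShortComplex.exact_of_f_is_kernel _ (kernelIsKernel S.g)
  obtain ⟨k, hk⟩ := exists_section_of_exact hk y hy
  intro x hx
  obtain ⟨V, hxV, hV, z, hz⟩ := exists_section_of_epi (kernel.lift S.g S.f S.zero) k x hx
  refine ⟨V, hxV, hV, z, ?_⟩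
  rw [← hk, ← kernel.lift_ι S.g S.f S.zero, onSections_comp, hz, resM_onSections]

end AlgebraicGeometry.EulerK

/-! ### Quasi-isomorphisms and mapping cones -/

namespace AlgebraicGeometry.EulerK

open CochainComplex in
-- In the homotopy category the quasi-isomorphisms are the maps whose cone lies in the subcategory
-- of acyclic complexes.
theorem quasiIso_iff_exactAt_mappingCone {C : Type*} [Category C] [Abelian C]
    {K L : CochainComplex C ℤ} (φ : K ⟶ L) :
    QuasiIso φ ↔ ∀ n, (mappingCone φ).ExactAt n := by
  rw [← HomologicalComplex.mem_quasiIso_iff, ← HomotopyCategory.quotient_map_mem_quasiIso_iff,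
    HomotopyCategory.quasiIso_eq_trW_subcategoryAcyclic]
  exact (ObjectProperty.trW_iff_of_distinguished _ _
    (HomotopyCategory.mappingCone_triangleh_distinguished φ)).trans
    (HomotopyCategory.quotient_obj_mem_subcategoryAcyclic_iff_exactAt _)

variable {X : Scheme.{u}}

theorem exactAt_of_onSections (K : CochainComplex X.Modules ℤ) (n : ℤ)
    (h : ∀ (U : X.Opens) (y : Γ(K.X n, U)), onSections (K.d n (n + 1)) U y = 0 → ∀ x ∈ U,
      ∃ (V : X.Opens) (_ : x ∈ V) (hV : V ≤ U) (z : Γ(K.X (n - 1), V)),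
        onSections (K.d (n - 1) n) V z = resM (K.X n) hV y) : K.ExactAt n := by
  rw [HomologicalComplex.exactAt_iff' K (n - 1) n (n + 1) (by simp) (by simp)]
  exact exact_of_onSections _ h

/-- A morphism of complexes is a quasi-isomorphism if its cone is locally exact on sections. -/
theorem quasiIso_of_onSections {K L : CochainComplex X.Modules ℤ} (φ : K ⟶ L)
    (h : ∀ (n : ℤ) (U : X.Opens) (y : Γ(K.X (n + 1), U)) (z : Γ(L.X n, U)),
      onSections (K.d (n + 1) (n + 2)) U y = 0 →
      onSections (L.d n (n + 1)) U z = onSections (φ.f (n + 1)) U y → ∀ x ∈ U,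
      ∃ (V : X.Opens) (_ : x ∈ V) (hV : V ≤ U) (y' : Γ(K.X n, V)) (z' : Γ(L.X (n - 1), V)),
        onSections (K.d n (n + 1)) V y' = resM (K.X (n + 1)) hV y ∧
        onSections (φ.f n) V y' + onSections (L.d (n - 1) n) V z' = resM (L.X n) hV z) :
    QuasiIso φ := by
  rw [quasiIso_iff_exactAt_mappingCone]
  intro n
  refine exactAt_of_onSections _ n fun U w hw x hx => ?_
  let fst (i j : ℤ) (hij : i + 1 = j) := (CochainComplex.mappingCone.fst φ).1.v i j hij
  let snd (i : ℤ) := (CochainComplex.mappingCone.snd φ).v i i (add_zero i)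
  -- The signs: the cocycle condition for `w` reads `d (fst w) = 0` and `φ (fst w) + d (snd w) = 0`,
  -- so the pair to lift is `y = fst w`, `z = -snd w`.
  obtain ⟨V, hxV, hV, y', z', hy, hz⟩ := h n U (onSections (fst n (n + 1) rfl) U w)
    (-(onSections (snd n) U w)) (by
      have e := congrArg (fun k => onSections k U w)
        (CochainComplex.mappingCone.d_fst_v φ n (n + 1) (n + 2) rfl (by ring))
      simp only [onSections_comp, hw, map_zero] at e
      change 0 = -(onSections _ U (onSections (fst n (n + 1) rfl) U w)) at e
      exact neg_eq_zero.mp e.symm) (by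
      have e := congrArg (fun k => onSections k U w)
        (CochainComplex.mappingCone.d_snd_v φ n (n + 1) rfl)
      simp only [onSections_comp, onSections_add, hw, map_zero] at e
      rw [map_neg]
      exact (eq_neg_of_add_eq_zero_left e.symm).symm) x hx
  refine ⟨V, hxV, hV, -(onSections ((CochainComplex.mappingCone.inl φ).v n (n - 1) (by ring)) V y')
    - onSections ((CochainComplex.mappingCone.inr φ).f (n - 1)) V z', ?_⟩
  have e₁ := congrArg (fun k => onSections k V y')
    (CochainComplex.mappingCone.inl_v_d φ n (n - 1) (n + 1) (by ring) (by ring))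
  have e₂ := congrArg (fun k => onSections k V z')
    (CochainComplex.mappingCone.inr_f_d φ (n - 1) n)
  have e₃ := congrArg (fun k => onSections k V (resM _ hV w))
    (CochainComplex.mappingCone.id_X φ n (n + 1) rfl)
  simp only [sub_eq_add_neg, onSections_comp, onSections_add, onSections_neg, onSections_id] at e₁ e₂ e₃
  rw [map_sub, map_neg, e₁, e₂, ← e₃, hy, resM_onSections]
  have e₄ : onSections ((CochainComplex.mappingCone.snd φ).v n n (add_zero n)) V (resM _ hV w) =
      -(onSections (φ.f n) V y' + onSections (L.d (n - 1) n) V z') := by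
    rw [hz, map_neg, neg_neg, ← resM_onSections]
  rw [e₄, map_neg, map_add]
  abel

end AlgebraicGeometry.EulerK

/-! ### Frames of locally free sheaves -/

namespace AlgebraicGeometry.EulerK

variable {X : Scheme.{u}} {M N K : X.Modules}

/-- Sections `gᵢ` of `M` on `U` that form a basis of `M` on every open subset of `U`. -/
def IsFrame {ι : Type*} [Fintype ι] {U : X.Opens} (g : ι → Γ(M, U)) : Prop :=
  ∀ (W : X.Opens) (h : W ≤ U),
    Function.Bijective fun c : ι → Γ(X, W) => ∑ j, c j • resM M h (g j)

/-- The structure sheaf as a sheaf of modules. -/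
noncomputable abbrev unitMod (X : Scheme.{u}) : X.Modules := SheafOfModules.unit X.ringCatSheaf

/-- The free sheaf of modules. -/
noncomputable abbrev freeMod (X : Scheme.{u}) (I : Type u) : X.Modules :=
  SheafOfModules.free (R := X.ringCatSheaf) I

noncomputable def freeInj (I : Type u) (i : I) : unitMod X ⟶ freeMod X I :=
  SheafOfModules.ιFree (R := X.ringCatSheaf) i

noncomputable def freeColim (I : Type u) : IsColimit (Cofan.mk (freeMod X I) (freeInj I)) :=
  SheafOfModules.isColimitFreeCofan (R := X.ringCatSheaf) I

/-- The section `1`. -/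
noncomputable def unitOne (U : X.Opens) : Γ(unitMod X, U) := (1 : Γ(X, U))

theorem unitOne_res {U V : X.Opens} (h : V ≤ U) : resM (unitMod X) h (unitOne U) = unitOne V :=
  map_one (resO h)

theorem smul_unitOne {U : X.Opens} (c : Γ(X, U)) :
    c • unitOne U = (show Γ(unitMod X, U) from c) :=
  mul_one c

/-- The map `𝒪 → M` given by a global section. -/
noncomputable def unitDesc (g : Γ(M, ⊤)) : unitMod X ⟶ M :=
  ⟨PresheafOfModules.homMk
    { app := fun V => AddCommGrpCat.ofHom
        ((LinearMap.toSpanSingleton Γ(X, V.unop) Γ(M, V.unop) (resM M le_top g)).toAddMonoidHom)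
      naturality := fun V W k => by
        ext (x : Γ(X, V.unop))
        change resO k.unop.le x • resM M le_top g = resM M k.unop.le (x • resM M le_top g)
        rw [LinearMap.map_smulₛₗ, resM_resM] }
    (fun V r x => (LinearMap.toSpanSingleton Γ(X, V.unop) Γ(M, V.unop) (resM M le_top g)).map_smul
        r x)⟩

/-- A finite coproduct in an additive category is a biproduct; its projections give coordinates on
sections, which the colimit description alone does not. -/
theorem sum_proj_inj {I : Type u} [Fintype I] [DecidableEq I] :
    ∃ p : I → (freeMod X I ⟶ unitMod X),
      (∀ i j, freeInj I i ≫ p j = if i = j then 𝟙 _ else 0) ∧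
        ∑ j, p j ≫ freeInj I j = 𝟙 _ := by
  let p (j : I) : freeMod X I ⟶ unitMod X :=
    Cofan.IsColimit.desc (freeColim I) fun i => if i = j then 𝟙 _ else 0
  have hp : ∀ i j, freeInj I i ≫ p j = if i = j then 𝟙 _ else 0 := fun i j =>
    Cofan.IsColimit.fac (freeColim I) _ i
  refine ⟨p, hp, Cofan.IsColimit.hom_ext (freeColim I) _ _ fun i => ?_⟩
  change freeInj I i ≫ _ = freeInj I i ≫ _
  rw [Preadditive.comp_sum, Category.comp_id, Finset.sum_eq_single i]
  · rw [← Category.assoc, hp, if_pos rfl, Category.id_comp]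
  · intro j _ hj
    rw [← Category.assoc, hp, if_neg hj.symm, zero_comp]
  · simp

theorem onSections_sum {ι : Type*} (s : Finset ι) (f : ι → (M ⟶ N)) (U : X.Opens) (x : Γ(M, U)) :
    onSections (∑ i ∈ s, f i) U x = ∑ i ∈ s, onSections (f i) U x := by
  classical
  induction s using Finset.induction_on with
  | empty => rfl
  | insert a s ha ih => rw [Finset.sum_insert ha, Finset.sum_insert ha, onSections_add, ih]

/-- A sheaf of modules is free if and only if it has a global frame. -/
theorem nonempty_iso_free_iff {I : Type u} [Fintype I] :
    Nonempty (N ≅ freeMod X I) ↔ ∃ g : I → Γ(N, ⊤), IsFrame g := by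
  classical
  obtain ⟨p, hp, hs⟩ := sum_proj_inj (X := X) (I := I)
  have hpi : ∀ i j (V : X.Opens) (x : Γ(unitMod X, V)),
      onSections (p j) V (onSections (freeInj I i) V x) = if i = j then x else 0 := by
    intro i j V x
    rw [← onSections_comp, hp]
    split_ifs <;> rfl
  have hsum : ∀ (V : X.Opens) (x : Γ(freeMod X I, V)),
      ∑ j, onSections (freeInj I j) V (onSections (p j) V x) = x := by
    intro V x
    have := congrArg (fun k => onSections k V x) hs
    simpa only [onSections_sum, onSections_comp, onSections_id] using this
  constructor
  · rintro ⟨e⟩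
    refine ⟨fun i => onSections e.inv ⊤ (onSections (freeInj I i) ⊤ (unitOne ⊤)), fun W h => ?_⟩
    have key : (fun c : I → Γ(X, W) => ∑ j, c j • resM N h
        (onSections e.inv ⊤ (onSections (freeInj I j) ⊤ (unitOne ⊤)))) = fun c =>
        onSections e.inv W (∑ j, onSections (freeInj I j) W (show Γ(unitMod X, W) from c j)) := by
      funext c
      rw [map_sum]
      refine Finset.sum_congr rfl fun j _ => ?_
      rw [resM_onSections, resM_onSections, unitOne_res, ← map_smul, ← map_smul, smul_unitOne]
    rw [key, Function.bijective_iff_has_inverse]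
    refine ⟨fun x j => onSections (p j) W (onSections e.hom W x), fun c => ?_, fun x => ?_⟩
    · funext j
      dsimp only
      rw [← onSections_comp e.inv, e.inv_hom_id, onSections_id, map_sum, Finset.sum_eq_single j]
      · exact (hpi j j W _).trans (if_pos rfl)
      · intro i _ hi
        exact (hpi i j W _).trans (if_neg hi)
      · simp
    · dsimp only
      rw [hsum, ← onSections_comp, e.hom_inv_id, onSections_id]
  · rintro ⟨g, hg⟩
    let f : freeMod X I ⟶ N := Cofan.IsColimit.desc (freeColim I) fun i => unitDesc (g i)
    have hf : ∀ i, freeInj I i ≫ f = unitDesc (g i) := fun i =>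
      Cofan.IsColimit.fac (freeColim I) _ i
    have key : ∀ (V : X.Opens) (x : Γ(freeMod X I, V)), onSections f V x =
        ∑ j, (show Γ(X, V) from onSections (p j) V x) • resM N le_top (g j) := by
      intro V x
      conv_lhs => rw [← hsum V x, map_sum]
      refine Finset.sum_congr rfl fun j _ => ?_
      rw [← onSections_comp, hf]
      rfl
    have := isIso_of_onSections f (fun V x hx => by
      rw [key] at hx
      have h0 := (hg V le_top).1 (hx.trans (by simp : (0 : Γ(N, V)) =
        ∑ j, (0 : I → Γ(X, V)) j • resM N le_top (g j)))
      rw [← hsum V x]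
      refine Finset.sum_eq_zero fun j _ => ?_
      have : onSections (p j) V x = 0 := congrFun h0 j
      rw [this, map_zero]) (fun V t x hx => ⟨V, hx, le_rfl, by
      obtain ⟨c, hc⟩ := (hg V le_top).2 t
      refine ⟨∑ j, onSections (freeInj I j) V (show Γ(unitMod X, V) from c j), ?_⟩
      rw [resM_self, ← hc, key]
      refine Finset.sum_congr rfl fun j _ => ?_
      congr 1
      rw [map_sum, Finset.sum_eq_single j]
      · exact (hpi j j V _).trans (if_pos rfl)
      · intro i _ hi
        exact (hpi i j V _).trans (if_neg hi)
      · simp⟩)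
    exact ⟨(asIso f).symm⟩

theorem IsFrame.reindex {ι κ : Type*} [Fintype ι] [Fintype κ] {U : X.Opens} {g : ι → Γ(M, U)}
    (hg : IsFrame g) (e : κ ≃ ι) : IsFrame (g ∘ e) := by
  intro W h
  have := (hg W h).comp (e.arrowCongr (Equiv.refl Γ(X, W))).bijective
  convert this using 1
  funext c
  simp only [Function.comp_apply]
  rw [← e.sum_comp]
  simp

theorem IsFrame.res {ι : Type*} [Fintype ι] {U V : X.Opens} {g : ι → Γ(M, U)}
    (hg : IsFrame g) (hV : V ≤ U) : IsFrame fun i => resM M hV (g i) := by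
  intro W h
  simp only [resM_resM]
  exact hg W (h.trans hV)

/-- Scalars act on the restriction through `appIso`, and for the inclusion of an open subset this is
an identity. -/
theorem restrict_smul (U : X.Opens) (W : (U : Scheme.{u}).Opens) (c : Γ(U, W))
    (x : Γ(M.restrict U.ι, W)) :
    c • x = ((show Γ(X, U.ι ''ᵁ W) from c) • (show Γ(M, U.ι ''ᵁ W) from x) : Γ(M, U.ι ''ᵁ W)) := by
  have h : c • x = (((U.ι.appIso W).inv c) • (show Γ(M, U.ι ''ᵁ W) from x) : Γ(M, U.ι ''ᵁ W)) := rfl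
  rw [Scheme.Opens.ι_appIso] at h
  exact h

theorem isFrame_restrict_iff {ι : Type*} [Fintype ι] (U : X.Opens)
    (g : ι → Γ(M, U.ι ''ᵁ ⊤)) :
    IsFrame (M := M.restrict U.ι) (U := ⊤) g ↔ IsFrame g := by
  have hkey : ∀ W : (U : Scheme.{u}).Opens, (Function.Bijective fun c : ι → Γ(U, W) =>
      ∑ j, c j • resM (M.restrict U.ι) (le_top : W ≤ ⊤) (g j)) ↔
      Function.Bijective fun c : ι → Γ(X, U.ι ''ᵁ W) =>
        ∑ j, c j • resM M (U.ι.image_mono (le_top : W ≤ ⊤)) (g j) := fun W => by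
    have : (fun c : ι → Γ(U, W) => ∑ j, c j • resM (M.restrict U.ι) (le_top : W ≤ ⊤) (g j)) =
        fun c : ι → Γ(X, U.ι ''ᵁ W) => ∑ j, c j • resM M (U.ι.image_mono (le_top : W ≤ ⊤)) (g j) :=
      funext fun c => Finset.sum_congr rfl fun j _ => restrict_smul U W (c j) _
    exact iff_of_eq (congrArg Function.Bijective this)
  constructor
  · intro hg W h
    -- Open subsets of `X` inside `U` are exactly the images of open subsets of the scheme `U`.
    have hW : W = U.ι ''ᵁ (U.ι ⁻¹ᵁ W) := by
      rw [Scheme.Hom.image_preimage_eq_opensRange_inf, inf_eq_right.mpr]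
      exact h.trans (by rw [Scheme.Hom.image_top_eq_opensRange])
    generalize U.ι ⁻¹ᵁ W = W' at hW
    subst hW
    exact (hkey W').mp (hg W' le_top)
  · intro hg W h
    exact (hkey W).mpr (hg (U.ι ''ᵁ W) (U.ι.image_mono h))

/-- A sheaf is coherent and locally free if and only if it locally has a frame. -/
theorem isVect_iff_isFrame : IsVect M ↔ ∀ x : X, ∃ (U : X.Opens) (_ : x ∈ U) (n : ℕ)
    (g : Fin n → Γ(M, U)), IsFrame g := by
  refine forall_congr' fun x => ?_
  constructor
  · rintro ⟨U, hxU, n, h⟩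
    obtain ⟨g, hg⟩ := nonempty_iso_free_iff.mp h
    exact ⟨U.ι ''ᵁ ⊤, by simpa using hxU, n, _,
      ((isFrame_restrict_iff U g).mp hg).reindex Equiv.ulift.symm⟩
  · rintro ⟨U, hxU, n, g, hg⟩
    refine ⟨U, hxU, n, nonempty_iso_free_iff.mpr ⟨fun i => resM M (V := U) (W := U.ι ''ᵁ ⊤) (by rw [Scheme.Hom.image_top_eq_opensRange, Scheme.Opens.opensRange_ι]) (g i.down), ?_⟩⟩
    rw [isFrame_restrict_iff U]
    exact (hg.res _).reindex Equiv.ulift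

end AlgebraicGeometry.EulerK

open scoped Matrix

/-! ### Idempotent matrices -/

namespace Matrix

/-- The matrix with the columns `a s` of `A` and `b t` of `1 - A`. -/
def splitCols {ι R S T : Type*} [DecidableEq ι] [CommRing R] (A : Matrix ι ι R) (a : S → ι) (b : T → ι)
    (e : S ⊕ T ≃ ι) : Matrix ι ι R :=
  Matrix.of fun i k => Sum.elim (fun s => A i (a s)) (fun t => (1 - A) i (b t)) (e.symm k)

theorem map_splitCols {ι R S T R' : Type*} [DecidableEq ι] [CommRing R] [CommRing R'] (φ : R →+* R') (A : Matrix ι ι R)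
    (a : S → ι) (b : T → ι) (e : S ⊕ T ≃ ι) :
    (splitCols A a b e).map φ = splitCols (A.map φ) a b e := by
  ext i k
  simp only [splitCols, map_apply, of_apply]
  rcases e.symm k with s | t
  · simp
  · simp [Matrix.one_apply, apply_ite φ]

variable {ι : Type*} [Fintype ι] [DecidableEq ι]

/-- An idempotent splits the space as `im A ⊕ im (1 - A)`. Bases of the two summands can be chosen
among the columns of `A` and of `1 - A`, and together they form an invertible matrix. -/
theorem exists_splitCols_det_ne_zero {κ : Type*} [Field κ] (A : Matrix ι ι κ) (hA : A * A = A) :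
    ∃ (p q : ℕ) (a : Fin p → ι) (b : Fin q → ι) (e : Fin p ⊕ Fin q ≃ ι),
      (splitCols A a b e).det ≠ 0 := by
  have hA' : A * (1 - A) = 0 := by rw [mul_sub, mul_one, hA, sub_self]
  have choose_cols : ∀ B : Matrix ι ι κ, ∃ (p : ℕ) (a : Fin p → ι),
      LinearIndependent κ (B.col ∘ a) ∧
        Submodule.span κ (Set.range (B.col ∘ a)) = Submodule.span κ (Set.range B.col) := by
    intro B
    obtain ⟨σ, a, ha, hs, hl⟩ := exists_linearIndependent' κ B.col
    have : Finite σ := Finite.of_injective a ha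
    obtain ⟨p, ⟨f⟩⟩ := Finite.exists_equiv_fin σ
    refine ⟨p, a ∘ f.symm, hl.comp _ f.symm.injective, ?_⟩
    rw [← hs, ← Function.comp_assoc, Set.range_comp _ f.symm, f.symm.surjective.range_eq,
      Set.image_univ]
  obtain ⟨p, a, hal, has⟩ := choose_cols A
  obtain ⟨q, b, hbl, hbs⟩ := choose_cols (1 - A)
  have hcol : ∀ B : Matrix ι ι κ, Submodule.span κ (Set.range B.col) = LinearMap.range B.mulVecLin :=
    fun B => (Matrix.range_mulVecLin B).symm
  have hdis : Disjoint (LinearMap.range A.mulVecLin) (LinearMap.range (1 - A).mulVecLin) := by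
    rw [Submodule.disjoint_def]
    rintro _ ⟨x, rfl⟩ ⟨y, hy⟩
    simp only [mulVecLin_apply] at hy ⊢
    rw [← hA, ← mulVec_mulVec, ← hy, mulVec_mulVec, hA', zero_mulVec]
  have hli : LinearIndependent κ (Sum.elim (A.col ∘ a) ((1 - A).col ∘ b)) :=
    hal.sum_type hbl (by rwa [has, hbs, hcol, hcol])
  have hsp : ⊤ ≤ Submodule.span κ (Set.range (Sum.elim (A.col ∘ a) ((1 - A).col ∘ b))) := by
    rw [Set.Sum.elim_range, Submodule.span_union, has, hbs, hcol, hcol]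
    rintro x -
    refine Submodule.mem_sup.mpr ⟨A *ᵥ x, ⟨x, rfl⟩, (1 - A) *ᵥ x, ⟨x, rfl⟩, ?_⟩
    rw [← add_mulVec, add_sub_cancel, one_mulVec]
  let B := Module.Basis.mk hli hsp
  let e : Fin p ⊕ Fin q ≃ ι := B.indexEquiv (Pi.basisFun κ ι)
  refine ⟨p, q, a, b, e, ?_⟩
  have hcols : (splitCols A a b e).col = Sum.elim (A.col ∘ a) ((1 - A).col ∘ b) ∘ e.symm := by
    funext k i
    simp only [splitCols, col_apply, of_apply, Function.comp_apply]
    rcases e.symm k with s | t <;> rfl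
  have h : LinearIndependent κ (splitCols A a b e).col := by
    rw [hcols]
    exact hli.comp _ e.symm.injective
  rw [Matrix.linearIndependent_cols_iff_isUnit, Matrix.isUnit_iff_isUnit_det] at h
  exact h.ne_zero

variable {R : Type*} [CommRing R] {A : Matrix ι ι R} {p q : ℕ} {a : Fin p → ι} {b : Fin q → ι}
  {e : Fin p ⊕ Fin q ≃ ι}

theorem splitCols_mulVec (c : ι → R) : splitCols A a b e *ᵥ c =
    ∑ s, c (e (Sum.inl s)) • A.col (a s) + ∑ t, c (e (Sum.inr t)) • (1 - A).col (b t) := by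
  funext i
  simp only [mulVec, dotProduct, splitCols, of_apply, Pi.add_apply, Finset.sum_apply, Pi.smul_apply,
    smul_eq_mul]
  rw [← e.sum_comp, Fintype.sum_sum_type]
  simp [mul_comm]

theorem eq_zero_of_sum_col (hu : IsUnit (splitCols A a b e).det) (c : Fin p → R)
    (hc : ∑ s, c s • A.col (a s) = 0) : c = 0 := by
  have h : splitCols A a b e *ᵥ (fun k => Sum.elim c 0 (e.symm k)) = 0 := by
    rw [splitCols_mulVec]
    simpa using hc
  have h2 : (fun k => Sum.elim c 0 (e.symm k)) = 0 := by
    rw [← one_mulVec (fun k => Sum.elim c 0 (e.symm k)), ← nonsing_inv_mul _ hu, ← mulVec_mulVec, h,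
      mulVec_zero]
  funext s
  simpa using congrFun h2 (e (Sum.inl s))

/-- Expand `v` in the columns of the invertible matrix and apply `A`, which fixes `v` and the
columns of `A` and kills those of `1 - A`. -/
theorem exists_sum_col (hA : A * A = A) (hu : IsUnit (splitCols A a b e).det) (v : ι → R)
    (hv : A *ᵥ v = v) : ∃ c : Fin p → R, ∑ s, c s • A.col (a s) = v := by
  set w := (splitCols A a b e)⁻¹ *ᵥ v
  have hw : splitCols A a b e *ᵥ w = v := by
    rw [mulVec_mulVec, mul_nonsing_inv _ hu, one_mulVec]
  refine ⟨fun s => w (e (Sum.inl s)), ?_⟩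
  rw [splitCols_mulVec] at hw
  have h1 : ∀ s, A *ᵥ A.col s = A.col s := fun s => by
    rw [← mulVec_single_one, mulVec_mulVec, hA]
  have h2 : ∀ s, A *ᵥ (1 - A).col s = 0 := fun s => by
    rw [← mulVec_single_one, mulVec_mulVec, mul_sub, mul_one, hA, sub_self, zero_mulVec]
  have h3 := congrArg A.mulVecLin hw
  simp only [map_add, map_sum, map_smul, mulVecLin_apply, h1, h2, hv, smul_zero,
    Finset.sum_const_zero, add_zero] at h3
  exact h3

end Matrix

/-! ### From generators with coordinates to frames -/

namespace AlgebraicGeometry.EulerK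

variable {X : Scheme.{u}} {M N K : X.Modules}

/-- Functions that do not vanish at a point are invertible near it. -/
theorem exists_isUnit_res {U : X.Opens} {x : X} (hx : x ∈ U) (r : Γ(X, U))
    (hr : (X.evaluation U x hx).hom r ≠ 0) :
    ∃ (V : X.Opens) (_ : x ∈ V) (hV : V ≤ U), IsUnit (resO hV r) := by
  refine ⟨X.basicOpen r, ?_, X.basicOpen_le r, X.toRingedSpace.isUnit_res_basicOpen r⟩
  exact (Scheme.evaluation_ne_zero_iff_mem_basicOpen X x hx r).mp hr

/-- A frame exists near every point of an open subset on which `M` has generators `gⱼ` with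
compatible coordinates. -/
theorem exists_isFrame_of_coords {ι : Type*} [Fintype ι] {U : X.Opens} (g : ι → Γ(M, U))
    (lam : ∀ V : X.Opens, V ≤ U → (Γ(M, V) →ₗ[Γ(X, V)] (ι → Γ(X, V))))
    (hres : ∀ (V : X.Opens) (hV : V ≤ U) (s : Γ(M, U)) (j : ι),
      lam V hV (resM M hV s) j = resO hV (lam U le_rfl s j))
    (hlam : ∀ (V : X.Opens) (hV : V ≤ U) (s : Γ(M, V)), ∑ j, lam V hV s j • resM M hV (g j) = s)
    {x : X} (hx : x ∈ U) :
    ∃ (V : X.Opens) (_ : x ∈ V) (n : ℕ) (g : Fin n → Γ(M, V)), IsFrame g := by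
  classical
  -- The columns are the coordinates of the generators. This matrix is idempotent, and the
  -- coordinate map, which is injective by `hlam`, identifies the sections of `M` with its image.
  let A : ∀ (V : X.Opens), V ≤ U → Matrix ι ι Γ(X, V) := fun V hV =>
    Matrix.of fun i j => lam V hV (resM M hV (g j)) i
  have hAmap : ∀ (V : X.Opens) (hV : V ≤ U), (A U le_rfl).map (resO hV) = A V hV := by
    intro V hV
    ext i j
    simp only [A, Matrix.map_apply, Matrix.of_apply, hres, resO_self]
  have hAv : ∀ (V : X.Opens) (hV : V ≤ U) (s : Γ(M, V)), A V hV *ᵥ lam V hV s = lam V hV s := by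
    intro V hV s
    conv_rhs => rw [← hlam V hV s]
    funext i
    rw [map_sum, Finset.sum_apply]
    refine Finset.sum_congr rfl fun j _ => ?_
    rw [map_smul, Pi.smul_apply, smul_eq_mul, mul_comm]
    rfl
  have hA : ∀ (V : X.Opens) (hV : V ≤ U), A V hV * A V hV = A V hV := by
    intro V hV
    ext i j
    exact congrFun (hAv V hV (resM M hV (g j))) i
  let φ := (X.evaluation U x hx).hom
  -- Columns chosen in the residue field at `x` still form an invertible matrix where the
  -- determinant is a unit, hence near `x`; the generators of the chosen columns of `A` are a frame
  -- there.
  obtain ⟨p, q, a, b, e, hdet⟩ := Matrix.exists_splitCols_det_ne_zero ((A U le_rfl).map φ) (by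
    rw [← Matrix.map_mul, hA])
  rw [← Matrix.map_splitCols, ← RingHom.mapMatrix_apply, ← RingHom.map_det] at hdet
  obtain ⟨V, hxV, hV, hu⟩ := exists_isUnit_res hx _ hdet
  refine ⟨V, hxV, p, fun s => resM M hV (g (a s)), fun W hWV => ?_⟩
  have hW := hWV.trans hV
  have huW : IsUnit (Matrix.splitCols (A W hW) a b e).det := by
    rw [← hAmap W hW, ← Matrix.map_splitCols, ← RingHom.mapMatrix_apply, ← RingHom.map_det,
      ← resO_resO hV hWV]
    exact hu.map _
  have hlamsum : ∀ c : Fin p → Γ(X, W), lam W hW (∑ s, c s • resM M hW (g (a s))) =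
      ∑ s, c s • (A W hW).col (a s) := by
    intro c
    rw [map_sum]
    exact Finset.sum_congr rfl fun s _ => map_smul _ _ _
  simp only [resM_resM]
  constructor
  · intro c c' hcc
    rw [← sub_eq_zero]
    refine Matrix.eq_zero_of_sum_col huW _ ?_
    rw [← hlamsum]
    simp only [Pi.sub_apply, sub_smul, Finset.sum_sub_distrib]
    rw [sub_eq_zero.mpr hcc, map_zero]
  · intro s
    obtain ⟨c, hc⟩ := Matrix.exists_sum_col (hA W hW) huW _ (hAv W hW s)
    refine ⟨c, ?_⟩
    dsimp only
    rw [← hlamsum] at hc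
    rw [← hlam W hW s, ← hlam W hW (∑ s, c s • resM M hW (g (a s))), hc]

/-- The coordinates with respect to a frame. -/
noncomputable def IsFrame.equiv {ι : Type*} [Fintype ι] {U : X.Opens} {g : ι → Γ(M, U)}
    (hg : IsFrame g) {W : X.Opens} (h : W ≤ U) : (ι → Γ(X, W)) ≃ₗ[Γ(X, W)] Γ(M, W) :=
  LinearEquiv.ofBijective
    { toFun := fun c => ∑ j, c j • resM M h (g j)
      map_add' := fun c c' => by simp only [Pi.add_apply, add_smul, Finset.sum_add_distrib]
      map_smul' := fun r c => by simp [Finset.smul_sum, mul_smul] } (hg W h)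

theorem IsFrame.equiv_apply {ι : Type*} [Fintype ι] {U : X.Opens} {g : ι → Γ(M, U)}
    (hg : IsFrame g) {W : X.Opens} (h : W ≤ U) (c : ι → Γ(X, W)) :
    hg.equiv h c = ∑ j, c j • resM M h (g j) := rfl

theorem IsFrame.sum_equiv_symm {ι : Type*} [Fintype ι] {U : X.Opens} {g : ι → Γ(M, U)}
    (hg : IsFrame g) {W : X.Opens} (h : W ≤ U) (s : Γ(M, W)) :
    ∑ j, (hg.equiv h).symm s j • resM M h (g j) = s :=
  (hg.equiv h).apply_symm_apply s

theorem IsFrame.equiv_symm_res {ι : Type*} [Fintype ι] {U : X.Opens} {g : ι → Γ(M, U)}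
    (hg : IsFrame g) {V W : X.Opens} (h : V ≤ U) (hW : W ≤ V) (s : Γ(M, V)) (j : ι) :
    (hg.equiv (hW.trans h)).symm (resM M hW s) j = resO hW ((hg.equiv h).symm s j) := by
  have : resM M hW s = hg.equiv (hW.trans h) fun j => resO hW ((hg.equiv h).symm s j) := by
    conv_lhs => rw [← hg.sum_equiv_symm h s, map_sum]
    rw [hg.equiv_apply]
    refine Finset.sum_congr rfl fun j _ => ?_
    rw [LinearMap.map_smulₛₗ, resM_resM]
  rw [this, LinearEquiv.symm_apply_apply]

/-- The basis of the sections given by a frame. -/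
noncomputable def IsFrame.basis {ι : Type*} [Fintype ι] {U : X.Opens} {g : ι → Γ(M, U)}
    (hg : IsFrame g) {W : X.Opens} (h : W ≤ U) : Module.Basis ι Γ(X, W) Γ(M, W) :=
  Module.Basis.ofEquivFun (hg.equiv h).symm

theorem IsFrame.basis_apply {ι : Type*} [Fintype ι] {U : X.Opens} {g : ι → Γ(M, U)}
    (hg : IsFrame g) {W : X.Opens} (h : W ≤ U) (j : ι) : hg.basis h j = resM M h (g j) := by
  classical
  rw [IsFrame.basis, Module.Basis.coe_ofEquivFun, LinearEquiv.symm_symm]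
  dsimp only
  rw [hg.equiv_apply]
  simp [Pi.single_apply]

/-- Local injectivity and local surjectivity are enough for a frame. -/
theorem isFrame_of_locally {ι : Type*} [Fintype ι] {U : X.Opens} (g : ι → Γ(M, U))
    (hinj : ∀ (W : X.Opens) (h : W ≤ U) (c : ι → Γ(X, W)), ∑ j, c j • resM M h (g j) = 0 → c = 0)
    (hsurj : ∀ (W : X.Opens) (h : W ≤ U) (s : Γ(M, W)), ∀ x ∈ W,
      ∃ (V : X.Opens) (_ : x ∈ V) (hV : V ≤ W) (c : ι → Γ(X, V)),
        ∑ j, c j • resM M (hV.trans h) (g j) = resM M hV s) : IsFrame g := by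
  intro W h
  have hinj' : ∀ (W : X.Opens) (h : W ≤ U) (c c' : ι → Γ(X, W)),
      ∑ j, c j • resM M h (g j) = ∑ j, c' j • resM M h (g j) → c = c' := by
    intro W h c c' hcc
    rw [← sub_eq_zero]
    refine hinj W h _ ?_
    simp only [Pi.sub_apply, sub_smul, Finset.sum_sub_distrib]
    exact sub_eq_zero.mpr hcc
  have hsr : ∀ (V V' : X.Opens) (hV : V ≤ U) (hV' : V' ≤ V) (c : ι → Γ(X, V)),
      resM M hV' (∑ j, c j • resM M hV (g j)) =
        ∑ j, resO hV' (c j) • resM M (hV'.trans hV) (g j) := by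
    intro V V' hV hV' c
    rw [map_sum]
    refine Finset.sum_congr rfl fun j _ => ?_
    rw [LinearMap.map_smulₛₗ, resM_resM]
  refine ⟨fun c c' => hinj' W h c c', fun s => ?_⟩
  choose! V hxV hV c hc using hsurj W h s
  -- Local coordinates are unique by injectivity, so they agree on overlaps and glue.
  have hglue : ∀ j, ∃ t : Γ(X, W), ∀ x : W, resO (hV x.1 x.2) t = c x.1 j := by
    intro j
    refine function_glue (fun x : W => V x.1) (fun x => hV x.1 x.2)
      (fun x hx => ⟨⟨x, hx⟩, hxV x hx⟩) (fun x => c x.1 j) fun x y W' hx hy => ?_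
    refine congrFun (hinj' W' (hx.trans ((hV x.1 x.2).trans h)) (fun j => resO hx (c x.1 j))
      (fun j => resO hy (c y.1 j)) ?_) j
    rw [← hsr _ _ ((hV x.1 x.2).trans h) hx (c x.1), hc x.1 x.2]
    refine Eq.trans ?_ (hsr _ _ ((hV y.1 y.2).trans h) hy (c y.1))
    rw [hc y.1 y.2, resM_resM, resM_resM]
  choose t ht using hglue
  refine ⟨t, section_ext fun x hx => ⟨V x, hxV x hx, hV x hx, ?_⟩⟩
  dsimp only
  rw [hsr, ← hc x hx]
  exact Finset.sum_congr rfl fun j _ => by rw [ht j ⟨x, hx⟩]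

end AlgebraicGeometry.EulerK

/-! ### Kernels and extensions of locally free sheaves -/

namespace AlgebraicGeometry.EulerK

variable {X : Scheme.{u}} {M N K : X.Modules}

theorem isVect_of_isFrame {ι : X → Type*} [∀ x, Fintype (ι x)]
    (h : ∀ x : X, ∃ (U : X.Opens) (_ : x ∈ U) (g : ι x → Γ(M, U)), IsFrame g) : IsVect M := by
  refine isVect_iff_isFrame.mpr fun x => ?_
  obtain ⟨U, hxU, g, hg⟩ := h x
  exact ⟨U, hxU, _, _, hg.reindex (Fintype.equivFin (ι x)).symm⟩

theorem IsVect.of_iso (h : IsVect M) (e : M ≅ N) : IsVect N := fun x => by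
  obtain ⟨U, hxU, n, ⟨i⟩⟩ := h x
  exact ⟨U, hxU, n, ⟨(Scheme.Modules.restrictFunctor U.ι).mapIso e.symm ≪≫ i⟩⟩

theorem isVect_of_isZero (h : IsZero M) : IsVect M := by
  refine isVect_of_isFrame (ι := fun _ => Empty) fun x => ⟨⊤, trivial, Empty.elim, fun W _ => ?_⟩
  have hM : Subsingleton Γ(M, W) := ⟨fun s t => by
    rw [← onSections_id W s, ← onSections_id W t, (IsZero.iff_id_eq_zero M).mp h, onSections_zero,
      onSections_zero]⟩
  exact ⟨fun _ _ _ => Subsingleton.elim _ _, fun s => ⟨0, Subsingleton.elim _ _⟩⟩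

/-- Frames of two sheaves on a common neighbourhood of a point. -/
theorem IsVect.exists_isFrame_pair (hM : IsVect M) (hN : IsVect N) (x : X) :
    ∃ (U : X.Opens) (_ : x ∈ U) (m n : ℕ) (g : Fin m → Γ(M, U)) (h : Fin n → Γ(N, U)),
      IsFrame g ∧ IsFrame h := by
  obtain ⟨U, hxU, m, g, hg⟩ := isVect_iff_isFrame.mp hM x
  obtain ⟨V, hxV, n, h, hh⟩ := isVect_iff_isFrame.mp hN x
  exact ⟨U ⊓ V, ⟨hxU, hxV⟩, m, n, _, _, hg.res inf_le_left, hh.res inf_le_right⟩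

/-- Finitely many sections lift near a point. -/
theorem exists_lift_family (f : M ⟶ N) [Epi f] {n : ℕ} {U : X.Opens} (t : Fin n → Γ(N, U)) {x : X}
    (hx : x ∈ U) : ∃ (V : X.Opens) (_ : x ∈ V) (hV : V ≤ U) (s : Fin n → Γ(M, V)),
      ∀ j, onSections f V (s j) = resM N hV (t j) := by
  induction n with
  | zero => exact ⟨U, hx, le_rfl, Fin.elim0, fun j => j.elim0⟩
  | succ n ih =>
    obtain ⟨V, hxV, hV, s, hs⟩ := ih (fun j => t j.succ)
    obtain ⟨W, hxW, hW, s₀, hs₀⟩ := exists_section_of_epi f (resM N hV (t 0)) x hxV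
    refine ⟨W, hxW, hW.trans hV, Fin.cons s₀ fun j => resM M hW (s j), fun j => ?_⟩
    refine Fin.cases ?_ (fun j => ?_) j
    · rw [Fin.cons_zero, hs₀, resM_resM]
    · rw [Fin.cons_succ, ← resM_onSections, hs, resM_resM]

theorem resM_sum_smul {ι : Type*} [Fintype ι] {U V W : X.Opens} (hV : V ≤ U) (hW : W ≤ V)
    (c : ι → Γ(X, V)) (g : ι → Γ(M, U)) : resM M hW (∑ j, c j • resM M hV (g j)) =
      ∑ j, resO hW (c j) • resM M (hW.trans hV) (g j) := by
  rw [map_sum]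
  refine Finset.sum_congr rfl fun j _ => ?_
  rw [LinearMap.map_smulₛₗ, resM_resM]

variable {S : ShortComplex X.Modules}

/-- The kernel of an epimorphism of coherent locally free sheaves. -/
theorem _root_.CategoryTheory.ShortComplex.ShortExact.isVect_X₁ (hS : S.ShortExact)
    (h₂ : IsVect S.X₂) (h₃ : IsVect S.X₃) : IsVect S.X₁ := by
  have := hS.mono_f
  have := hS.epi_g
  refine isVect_iff_isFrame.mpr fun x => ?_
  obtain ⟨U, hxU, m, n, g, h, hg, hh⟩ := h₂.exists_isFrame_pair h₃ x
  obtain ⟨V, hxV, hV, s, hs⟩ := exists_lift_family S.g h hxU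
  -- the projection to the kernel given by the lifts `s`
  let ρ (W : X.Opens) (hW : W ≤ V) : Γ(S.X₂, W) →ₗ[Γ(X, W)] Γ(S.X₂, W) :=
    LinearMap.id - ((Fintype.linearCombination Γ(X, W) fun k => resM S.X₂ hW (s k)).comp
      (hh.equiv (hW.trans hV)).symm.toLinearMap).comp (onSections S.g W)
  have hρ : ∀ W hW y, ρ W hW y = y - ∑ k, (hh.equiv (hW.trans hV)).symm (onSections S.g W y) k •
    resM S.X₂ hW (s k) := fun W hW y => rfl
  have hρ0 : ∀ W hW y, onSections S.g W (ρ W hW y) = 0 := by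
    intro W hW y
    rw [hρ, map_sub, map_sum, sub_eq_zero]
    conv_lhs => rw [← hh.sum_equiv_symm (hW.trans hV) (onSections S.g W y)]
    refine Finset.sum_congr rfl fun k _ => ?_
    rw [map_smul, ← resM_onSections, hs, resM_resM]
  have hρker : ∀ W hW y, onSections S.g W y = 0 → ρ W hW y = y := by
    intro W hW y hy
    rw [hρ, hy, map_zero]
    simp
  have hρres : ∀ W hW y, resM S.X₂ hW (ρ V le_rfl y) = ρ W hW (resM S.X₂ hW y) := by
    intro W hW y
    rw [hρ, hρ, map_sub, resM_sum_smul, ← resM_onSections]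
    congr 1
    refine Finset.sum_congr rfl fun k _ => ?_
    rw [hh.equiv_symm_res hV hW]
  have hk : ∀ j, ∃ k : Γ(S.X₁, V), onSections S.f V k = ρ V le_rfl (resM S.X₂ hV (g j)) := fun j =>
    exists_section_of_exact hS.exact _ (hρ0 _ _ _)
  choose k hk using hk
  -- The sections `k j` over `ρ (g j)` generate the kernel, with the coordinates of the ambient
  -- frame: a section `z` of the kernel is fixed by `ρ`, so `z = ∑ λ_j g_j` gives `z = ∑ λ_j ρ
  -- (g_j)`.
  refine exists_isFrame_of_coords k
    (fun W hW => (hg.equiv (hW.trans hV)).symm.toLinearMap.comp (onSections S.f W)) ?_ ?_ hxV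
  · intro W hW z j
    simp only [LinearMap.comp_apply, LinearEquiv.coe_coe]
    rw [← resM_onSections, hg.equiv_symm_res hV hW]
  · intro W hW z
    apply onSections_injective S.f W
    simp only [LinearMap.comp_apply, LinearEquiv.coe_coe, map_sum, map_smul]
    have hz : onSections S.g W (onSections S.f W z) = 0 := by
      rw [← onSections_comp, S.zero, onSections_zero]
    conv_rhs => rw [← hρker W hW _ hz, ← hg.sum_equiv_symm (hW.trans hV) (onSections S.f W z),
      map_sum]
    refine Finset.sum_congr rfl fun j _ => ?_
    rw [map_smul, ← resM_onSections, hk, hρres, resM_resM]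

/-- Extensions of coherent locally free sheaves. -/
theorem _root_.CategoryTheory.ShortComplex.ShortExact.isVect_X₂ (hS : S.ShortExact)
    (h₁ : IsVect S.X₁) (h₃ : IsVect S.X₃) : IsVect S.X₂ := by
  have := hS.mono_f
  have := hS.epi_g
  have hfg : ∀ (W : X.Opens) z, onSections S.g W (onSections S.f W z) = 0 := fun W z => by
    rw [← onSections_comp, S.zero, onSections_zero]
  refine isVect_iff_isFrame.mpr fun x => ?_
  obtain ⟨U, hxU, m, n, g, h, hg, hh⟩ := h₁.exists_isFrame_pair h₃ x
  obtain ⟨V, hxV, hV, s, hs⟩ := exists_lift_family S.g h hxU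
  refine ⟨V, hxV, _, _, IsFrame.reindex (ι := Fin m ⊕ Fin n)
    (g := Sum.elim (fun j => onSections S.f V (resM S.X₁ hV (g j))) s) ?_ finSumFinEquiv.symm⟩
  have hgs : ∀ (W : X.Opens) (hW : W ≤ V) (c : Fin n → Γ(X, W)),
      onSections S.g W (∑ k, c k • resM S.X₂ hW (s k)) = hh.equiv (hW.trans hV) c := by
    intro W hW c
    rw [map_sum, hh.equiv_apply]
    refine Finset.sum_congr rfl fun k _ => ?_
    rw [map_smul, ← resM_onSections, hs, resM_resM]
  have hfs : ∀ (W : X.Opens) (hW : W ≤ V) (c : Fin m → Γ(X, W)),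
      ∑ j, c j • resM S.X₂ hW (onSections S.f V (resM S.X₁ hV (g j))) =
        onSections S.f W (hg.equiv (hW.trans hV) c) := by
    intro W hW c
    rw [hg.equiv_apply, map_sum]
    refine Finset.sum_congr rfl fun k _ => ?_
    rw [map_smul, resM_onSections, resM_resM]
  intro W hW
  constructor
  · intro c c' hcc
    simp only [Fintype.sum_sum_type, Sum.elim_inl, Sum.elim_inr] at hcc
    rw [hfs W hW fun j => c (Sum.inl j), hfs W hW fun j => c' (Sum.inl j)] at hcc
    have e := congrArg (onSections S.g W) hcc
    rw [map_add, map_add, hfg, hfg, zero_add, zero_add, hgs W hW fun j => c (Sum.inr j),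
      hgs W hW fun j => c' (Sum.inr j)] at e
    have e := (hh.equiv (hW.trans hV)).injective e
    have e' : ∀ k, c (Sum.inr k) = c' (Sum.inr k) := congrFun e
    simp only [e', add_left_inj] at hcc
    have e₂ := (hg.equiv (hW.trans hV)).injective (onSections_injective S.f W hcc)
    funext j
    rcases j with j | j
    · exact congrFun e₂ j
    · exact e' j
  · intro t
    let c := (hh.equiv (hW.trans hV)).symm (onSections S.g W t)
    obtain ⟨z, hz⟩ := exists_section_of_exact hS.exact (t - ∑ k, c k • resM S.X₂ hW (s k)) (by
      rw [map_sub, hgs, LinearEquiv.apply_symm_apply, sub_self])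
    refine ⟨Sum.elim ((hg.equiv (hW.trans hV)).symm z) c, ?_⟩
    simp only [Fintype.sum_sum_type, Sum.elim_inl, Sum.elim_inr]
    rw [hfs W hW ((hg.equiv (hW.trans hV)).symm z), LinearEquiv.apply_symm_apply, hz,
      sub_add_cancel]

end AlgebraicGeometry.EulerK

namespace AlgebraicGeometry.EulerK

variable {X : Scheme.{u}} {M N : X.Modules}

/-! ### Classes in the Grothendieck group -/

open scoped ZeroObject

open Classical in
/-- The class of a coherent locally free sheaf, and `0` for other sheaves. -/
noncomputable def K0.clsOrZero (M : X.Modules) : K0 X := if h : IsVect M then K0.cls M h else 0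

theorem K0.cls_eq_clsOrZero (h : IsVect M) : K0.cls M h = K0.clsOrZero M := by
  rw [clsOrZero, dif_pos h]

theorem K0.clsOrZero_of_shortExact {S : ShortComplex X.Modules} (hS : S.ShortExact)
    (h₁ : IsVect S.X₁) (h₃ : IsVect S.X₃) :
    K0.clsOrZero S.X₂ = K0.clsOrZero S.X₁ + K0.clsOrZero S.X₃ := by
  have h₂ := hS.isVect_X₂ h₁ h₃
  rw [← K0.cls_eq_clsOrZero h₁, ← K0.cls_eq_clsOrZero h₂, ← K0.cls_eq_clsOrZero h₃]
  rw [K0.cls, K0.cls, K0.cls, ← QuotientAddGroup.mk_add, QuotientAddGroup.eq_iff_sub_mem,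
    ← sub_sub]
  exact AddSubgroup.subset_closure ⟨S, hS, h₁, h₂, h₃, rfl⟩

theorem K0.clsOrZero_of_isZero (h : IsZero M) : K0.clsOrZero M = 0 := by
  have hM := isVect_of_isZero h
  have hS : (ShortComplex.mk (𝟙 M) (0 : M ⟶ M) comp_zero).ShortExact :=
    { exact := by
        rw [ShortComplex.exact_iff_epi _ rfl]
        infer_instance
      mono_f := by infer_instance
      epi_g := ⟨fun _ _ _ => h.eq_of_src _ _⟩ }
  simpa using K0.clsOrZero_of_shortExact hS hM hM

theorem K0.clsOrZero_of_iso (e : M ≅ N) : K0.clsOrZero M = K0.clsOrZero N := by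
  by_cases hM : IsVect M
  · have hZ : IsZero (0 : X.Modules) := isZero_zero _
    have hS : (ShortComplex.mk e.hom (0 : N ⟶ 0) comp_zero).ShortExact :=
      { exact := by
          rw [ShortComplex.exact_iff_epi _ rfl]
          infer_instance
        mono_f := by infer_instance
        epi_g := ⟨fun _ _ _ => hZ.eq_of_src _ _⟩ }
    have := K0.clsOrZero_of_shortExact hS hM (isVect_of_isZero hZ)
    rw [K0.clsOrZero_of_isZero hZ, add_zero] at this
    exact this.symm
  · rw [clsOrZero, clsOrZero, dif_neg hM, dif_neg fun h => hM (h.of_iso e.symm)]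

variable {K L : CochainComplex X.Modules ℤ}

/-- The sheaf of cocycles. -/
noncomputable abbrev cocyc (K : CochainComplex X.Modules ℤ) (n : ℤ) : X.Modules :=
  kernel (K.d n (n + 1))

/-- In an exact degree the image is the sheaf of cocycles. -/
theorem nonempty_cocyc_iso_image {n : ℤ} (h : K.ExactAt n) :
    Nonempty (cocyc K n ≅ image (K.d (n - 1) n)) := by
  rw [HomologicalComplex.exactAt_iff' K (n - 1) n (n + 1) (by simp) (by simp),
    ShortComplex.exact_iff_epi_kernel_lift] at h
  have h' : Epi (kernel.lift (K.d n (n + 1)) (K.d (n - 1) n) (K.d_comp_d _ _ _)) := h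
  have := strongEpi_of_epi (kernel.lift (K.d n (n + 1)) (K.d (n - 1) n) (K.d_comp_d _ _ _))
  let F : MonoFactorisation (K.d (n - 1) n) :=
    { I := cocyc K n
      m := kernel.ι _
      e := kernel.lift (K.d n (n + 1)) (K.d (n - 1) n) (K.d_comp_d _ _ _) }
  exact ⟨(StrongEpiMonoFactorisation.mk F).toMonoIsImage.isoExt (Image.isImage _)⟩

/-- The sequence `0 → Zⁿ → Kⁿ → Zⁿ⁺¹ → 0`; exactness in degree `n + 1` is what makes `d` surjective
onto `Zⁿ⁺¹`. -/
theorem cocyc_shortExact {n : ℤ} (h : K.ExactAt (n + 1)) :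
    (ShortComplex.mk (kernel.ι (K.d n (n + 1)))
      (kernel.lift (K.d (n + 1) (n + 1 + 1)) (K.d n (n + 1)) (K.d_comp_d _ _ _))
      (by rw [← cancel_mono (kernel.ι _), Category.assoc, kernel.lift_ι, kernel.condition,
        zero_comp])).ShortExact where
  exact := by
    refine exact_of_onSections _ fun U y hy x hx => ⟨U, hx, le_rfl, ?_⟩
    have hk : (ShortComplex.mk (kernel.ι (K.d n (n + 1))) (K.d n (n + 1))
      (kernel.condition _)).Exact := ShortComplex.exact_of_f_is_kernel _ (kernelIsKernel _)
    rw [resM_self]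
    refine exists_section_of_exact hk y ?_
    dsimp only at hy ⊢
    rw [← kernel.lift_ι (K.d (n + 1) (n + 1 + 1)) (K.d n (n + 1)) (K.d_comp_d _ _ _),
      onSections_comp, hy, map_zero]
  mono_f := by dsimp only; infer_instance
  epi_g := by
    rw [HomologicalComplex.exactAt_iff' K n (n + 1) (n + 1 + 1) (by simp) (by simp),
      ShortComplex.exact_iff_epi_kernel_lift] at h
    exact h

/-- The alternating sum that defines the class of a complex. -/
noncomputable def altSum (K : CochainComplex X.Modules ℤ) (b n₀ : ℤ) : K0 X :=
  ∑ n ∈ Finset.Ico b n₀, n.negOnePow • K0.clsOrZero (K.X n) +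
    n₀.negOnePow • K0.clsOrZero (cocyc K n₀)

/-- The conditions on a complex for which the alternating sum is a class of it. -/
structure IsClassData (K : CochainComplex X.Modules ℤ) (b n₀ : ℤ) : Prop where
  vect : ∀ n, IsVect (K.X n)
  zero : ∀ n < b, IsZero (K.X n)
  exactAt : ∀ n ≥ n₀, K.ExactAt n
  cocyc : ∀ n ≥ n₀, IsVect (cocyc K n)

/-- Cocycles replace images. In exact degrees they are isomorphic, and cocycles fit into the short
exact sequences used below. -/
theorem hasClass_iff {c : K0 X} :
    HasClass K c ↔ ∃ b n₀ : ℤ, IsClassData K b n₀ ∧ c = altSum K b n₀ := by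
  have key : ∀ (b n₀ : ℤ) (hK : ∀ n, IsVect (K.X n)) (_ : ∀ n ≥ n₀, K.ExactAt n)
      (hI : ∀ n ≥ n₀, IsVect (image (K.d (n - 1) n))),
      ∑ n ∈ Finset.Ico b n₀, n.negOnePow • K0.cls (K.X n) (hK n) +
        n₀.negOnePow • K0.cls (image (K.d (n₀ - 1) n₀)) (hI n₀ le_rfl) = altSum K b n₀ := by
    intro b n₀ hK hE hI
    obtain ⟨e⟩ := nonempty_cocyc_iso_image (hE n₀ le_rfl)
    rw [altSum, K0.clsOrZero_of_iso e, K0.cls_eq_clsOrZero]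
    simp only [K0.cls_eq_clsOrZero]
  constructor
  · rintro ⟨b, n₀, hK, hb, hE, hI, rfl⟩
    exact ⟨b, n₀, ⟨hK, hb, hE, fun n hn =>
      (hI n hn).of_iso (nonempty_cocyc_iso_image (hE n hn)).some.symm⟩, key b n₀ hK hE hI⟩
  · rintro ⟨b, n₀, h, rfl⟩
    have hI : ∀ n ≥ n₀, IsVect (image (K.d (n - 1) n)) := fun n hn =>
      (h.cocyc n hn).of_iso (nonempty_cocyc_iso_image (h.exactAt n hn)).some
    exact ⟨b, n₀, h.vect, h.zero, h.exactAt, hI, (key b n₀ h.vect h.exactAt hI).symm⟩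

theorem IsClassData.mono {b b' n₀ n₁ : ℤ} (h : IsClassData K b n₀) (hb : b' ≤ b) (hn : n₀ ≤ n₁) :
    IsClassData K b' n₁ :=
  ⟨h.vect, fun n hn => h.zero n (hn.trans_le hb), fun n h' => h.exactAt n (hn.trans h'),
    fun n h' => h.cocyc n (hn.trans h')⟩

theorem IsClassData.altSum_left {b b' n₀ : ℤ} (h : IsClassData K b n₀) (hb : b' ≤ b) :
    altSum K b n₀ = altSum K b' n₀ := by
  rw [altSum, altSum, add_left_inj]
  refine Finset.sum_subset (Finset.Ico_subset_Ico_left hb) fun n hn hn' => ?_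
  rw [Finset.mem_Ico] at hn hn'
  rw [K0.clsOrZero_of_isZero (h.zero n (by omega)), smul_zero]

/-- The relation `[Kⁿ] = [Zⁿ] + [Zⁿ⁺¹]` absorbs the new term of the sum into the change of the tail.
-/
theorem altSum_succ {b n : ℤ} (hbn : b ≤ n) (h : K.ExactAt (n + 1)) (h₁ : IsVect (cocyc K n))
    (h₂ : IsVect (cocyc K (n + 1))) : altSum K b (n + 1) = altSum K b n := by
  have e := K0.clsOrZero_of_shortExact (cocyc_shortExact h) h₁ h₂
  dsimp only at e
  have hI : Finset.Ico b (n + 1) = insert n (Finset.Ico b n) := by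
    ext k
    rw [Finset.mem_insert, Finset.mem_Ico, Finset.mem_Ico]
    omega
  rw [altSum, altSum, hI, Finset.sum_insert (by simp), e, Int.negOnePow_succ, smul_add,
    Units.neg_smul]
  abel

theorem IsClassData.altSum_right {b n₀ n₁ : ℤ} (h : IsClassData K b n₀) (hb : b ≤ n₀)
    (hn : n₀ ≤ n₁) : altSum K b n₁ = altSum K b n₀ := by
  induction n₁, hn using Int.leInduction with
  | base => rfl
  | succ n hn ih =>
    rw [altSum_succ (hb.trans hn) (h.exactAt _ (by omega)) (h.cocyc _ hn) (h.cocyc _ (by omega)),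
      ih]

/-- The class does not depend on the choice of the degrees. -/
theorem IsClassData.altSum_eq {b n₀ b' n₁ : ℤ} (h : IsClassData K b n₀)
    (h' : IsClassData K b' n₁) : altSum K b n₀ = altSum K b' n₁ := by
  let B := min (min b b') (min n₀ n₁)
  have hB : B ≤ b := by omega
  have hB' : B ≤ b' := by omega
  rw [h.altSum_left hB, h'.altSum_left hB',
    ← (h.mono hB le_rfl).altSum_right (by omega) (le_max_left n₀ n₁),
    ← (h'.mono hB' le_rfl).altSum_right (by omega) (le_max_right n₀ n₁)]

theorem HasClass.unique {c c' : K0 X} (h : HasClass K c) (h' : HasClass K c') : c = c' := by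
  obtain ⟨b, n₀, hd, rfl⟩ := hasClass_iff.mp h
  obtain ⟨b', n₀', hd', rfl⟩ := hasClass_iff.mp h'
  exact hd.altSum_eq hd'

theorem HasClass.cl_eq {c : K0 X} (h : HasClass K c) : cl K = c := by
  have h' : ∃ c, HasClass K c := ⟨c, h⟩
  rw [cl, dif_pos h']
  exact h'.choose_spec.unique h

/-- The class of an acyclic complex is zero. -/
theorem IsClassData.altSum_eq_zero {b n₀ : ℤ} (h : IsClassData K b n₀)
    (hK : ∀ n, K.ExactAt n) : altSum K b n₀ = 0 := by
  -- Descending induction: `Zⁿ⁻¹` is the kernel of an epimorphism from `Kⁿ⁻¹` to the locally free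
  -- `Zⁿ`. So `n₀` may be moved down to a degree in which the complex is zero.
  have hZ : ∀ n ≤ n₀, IsVect (EulerK.cocyc K n) := by
    intro n hn
    induction n, hn using Int.leInductionDown with
    | base => exact h.cocyc n₀ le_rfl
    | pred n hn ih =>
      have hS := cocyc_shortExact (hK (n - 1 + 1))
      refine hS.isVect_X₁ (h.vect _) ?_
      dsimp only
      rw [sub_add_cancel]
      exact ih
  let B := min b n₀
  have hB : IsClassData K B B := ⟨h.vect, fun n hn => h.zero n (by omega), fun n _ => hK n,
    fun n _ => (le_total n n₀).elim (hZ n) (h.cocyc n)⟩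
  have hB' : IsClassData K (B - 1) (B - 1) := ⟨h.vect, fun n hn => h.zero n (by omega),
    fun n _ => hK n, fun n _ => (le_total n n₀).elim (hZ n) (h.cocyc n)⟩
  rw [h.altSum_eq hB', altSum, Finset.Ico_self, Finset.sum_empty, zero_add,
    K0.clsOrZero_of_isZero, smul_zero]
  exact IsZero.of_mono (kernel.ι _) (h.zero _ (by omega))

end AlgebraicGeometry.EulerK

/-! ### Invariance of the class under quasi-isomorphism -/

namespace AlgebraicGeometry.EulerK

variable {X : Scheme.{u}} {K L : CochainComplex X.Modules ℤ} (φ : K ⟶ L)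

theorem onSections_eq_of_eq {M N : X.Modules} {f g : M ⟶ N} (h : f = g) {U : X.Opens} (x : Γ(M, U)) :
    onSections f U x = onSections g U x := by rw [h]

open CochainComplex

theorem mappingCone_X_shortExact (n : ℤ) :
    (ShortComplex.mk ((mappingCone.inr φ).f n) ((mappingCone.fst φ).1.v n (n + 1) rfl)
      (by simp)).ShortExact where
  exact := by
    refine exact_of_onSections _ fun U y hy x hx => ⟨U, hx, le_rfl, onSections
      ((mappingCone.snd φ).v n n (add_zero n)) U y, ?_⟩
    have e := onSections_eq_of_eq (mappingCone.id_X φ n (n + 1) rfl) y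
    rw [onSections_add, onSections_comp, onSections_comp, onSections_id] at e
    dsimp only at hy ⊢
    rw [hy, map_zero, zero_add] at e
    rw [e, resM_self]
  mono_f := by
    have : Mono ((mappingCone.inr φ).f n ≫ (mappingCone.snd φ).v n n (add_zero n)) := by
      rw [mappingCone.inr_f_snd_v]
      infer_instance
    exact mono_of_mono _ ((mappingCone.snd φ).v n n (add_zero n))
  epi_g := by
    have : Epi ((mappingCone.inl φ).v (n + 1) n (by ring) ≫
        (mappingCone.fst φ).1.v n (n + 1) rfl) := by
      rw [mappingCone.inl_v_fst_v]
      infer_instance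
    dsimp only
    exact epi_of_epi ((mappingCone.inl φ).v (n + 1) n _) _

theorem onSections_kernel_ι {M N : X.Modules} (f : M ⟶ N) {U : X.Opens} (z : Γ(kernel f, U)) :
    onSections f U (onSections (kernel.ι f) U z) = 0 := by
  rw [← onSections_comp, kernel.condition, onSections_zero]

theorem exists_kernel_section {M N : X.Modules} (f : M ⟶ N) {U : X.Opens} (y : Γ(M, U))
    (hy : onSections f U y = 0) : ∃ z : Γ(kernel f, U), onSections (kernel.ι f) U z = y :=
  exists_section_of_exact (S := ShortComplex.mk (kernel.ι f) f (kernel.condition f))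
    (ShortComplex.exact_of_f_is_kernel _ (kernelIsKernel f)) y hy

theorem exists_section_of_exactAt {n : ℤ} (h : K.ExactAt n) {U : X.Opens} (y : Γ(K.X n, U))
    (hy : onSections (K.d n (n + 1)) U y = 0) : ∀ x ∈ U, ∃ (V : X.Opens) (_ : x ∈ V) (hV : V ≤ U)
      (z : Γ(K.X (n - 1), V)), onSections (K.d (n - 1) n) V z = resM (K.X n) hV y := by
  rw [HomologicalComplex.exactAt_iff' K (n - 1) n (n + 1) (by simp) (by simp)] at h
  exact exists_section_of_exact' h y hy

/-- Degreewise the cone is an extension of `Kⁿ⁺¹` by `Lⁿ`; on cocycles this stays exact on the right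
because `Hⁿ⁺¹(L) = 0`. -/
theorem mappingCone_cocyc_shortExact {n : ℤ} (h : L.ExactAt (n + 1)) :
    ∃ S : ShortComplex X.Modules, S.ShortExact ∧ S.X₁ = cocyc L n ∧ S.X₂ = cocyc (mappingCone φ) n ∧
      S.X₃ = cocyc K (n + 1) := by
  let C := mappingCone φ
  let i : cocyc L n ⟶ cocyc C n := kernel.lift _ (kernel.ι _ ≫ (mappingCone.inr φ).f n) (by
    rw [Category.assoc, mappingCone.inr_f_d, kernel.condition_assoc, zero_comp])
  let p : cocyc C n ⟶ cocyc K (n + 1) := kernel.lift _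
    (kernel.ι _ ≫ (mappingCone.fst φ).1.v n (n + 1) rfl) (by
      have e := mappingCone.d_fst_v φ n (n + 1) (n + 1 + 1) rfl rfl
      have e' : (mappingCone.fst φ).1.v n (n + 1) rfl ≫ K.d (n + 1) (n + 1 + 1) =
          -(C.d n (n + 1) ≫ (mappingCone.fst φ).1.v (n + 1) (n + 1 + 1) rfl) := by
        rw [e, neg_neg]
      rw [Category.assoc, e', Preadditive.comp_neg, kernel.condition_assoc, zero_comp, neg_zero])
  have hi : i ≫ kernel.ι _ = kernel.ι _ ≫ (mappingCone.inr φ).f n := kernel.lift_ι _ _ _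
  have hp : p ≫ kernel.ι _ = kernel.ι _ ≫ (mappingCone.fst φ).1.v n (n + 1) rfl :=
    kernel.lift_ι _ _ _
  have := (mappingCone_X_shortExact φ n).mono_f
  dsimp only at this
  have hip : i ≫ p = 0 := by
    rw [← cancel_mono (kernel.ι _), Category.assoc, hp, ← Category.assoc, hi, Category.assoc,
      mappingCone.inr_f_fst_v, comp_zero, zero_comp]
  refine ⟨ShortComplex.mk i p hip, ShortComplex.ShortExact.mk' ?_ ?_ ?_, rfl, rfl, rfl⟩
  · refine exact_of_onSections _ fun U y hy x hx => ⟨U, hx, le_rfl, ?_⟩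
    dsimp only at y hy ⊢
    rw [resM_self]
    have e := onSections_eq_of_eq hp y
    rw [onSections_comp, onSections_comp, hy, map_zero] at e
    obtain ⟨z, hz⟩ := exists_section_of_exact (mappingCone_X_shortExact φ n).exact _ e.symm
    dsimp only at z hz
    have hz0 : onSections (L.d n (n + 1)) U z = 0 := by
      have := (mappingCone_X_shortExact φ (n + 1)).mono_f
      dsimp only at this
      apply onSections_injective ((mappingCone.inr φ).f (n + 1)) U
      rw [map_zero, ← onSections_comp, ← mappingCone.inr_f_d, onSections_comp, hz,
        onSections_kernel_ι]
    obtain ⟨z', hz'⟩ := exists_kernel_section _ z hz0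
    refine ⟨z', onSections_injective (kernel.ι _) U ?_⟩
    rw [← onSections_comp, hi, onSections_comp, hz', hz]
  · have : Mono (i ≫ kernel.ι _) := by
      rw [hi]
      infer_instance
    exact mono_of_mono i (kernel.ι _)
  · refine epi_of_onSections _ fun U t x hx => ?_
    dsimp only at t ⊢
    have ht := onSections_kernel_ι _ t
    obtain ⟨k, hk⟩ : ∃ k, k = onSections (kernel.ι _) U t := ⟨_, rfl⟩
    rw [← hk] at ht
    -- For a cocycle `k` of `K` write `φ k = d z` locally. Then `inl k - inr z` is a cocycle of the
    -- cone that lifts `k`.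
    obtain ⟨V, hxV, hV, z, hz⟩ := exists_section_of_exactAt h (onSections (φ.f (n + 1)) U k) (by
      have e := onSections_eq_of_eq (φ.comm (n + 1) (n + 1 + 1)) k
      rw [onSections_comp, onSections_comp, ht, map_zero] at e
      exact e) x hx
    have hn : n + 1 - 1 = n := by ring
    generalize n + 1 - 1 = n' at hn z
    subst hn
    obtain ⟨w, hw⟩ := exists_kernel_section (C.d n' (n' + 1))
      (onSections ((mappingCone.inl φ).v (n' + 1) n' (by ring)) V (resM _ hV k) -
        onSections ((mappingCone.inr φ).f n') V z) (by
        have e₁ := onSections_eq_of_eq (mappingCone.inl_v_d φ (n' + 1) n' (n' + 1 + 1) (by ring)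
          (by ring)) (resM _ hV k)
        have e₂ := onSections_eq_of_eq (mappingCone.inr_f_d φ n' (n' + 1)) z
        rw [sub_eq_add_neg, onSections_add, onSections_neg, onSections_comp, onSections_comp,
          onSections_comp, ← resM_onSections (K.d _ _), ht, map_zero, map_zero, neg_zero] at e₁
        rw [onSections_comp, onSections_comp, hz, resM_onSections] at e₂
        rw [map_sub, e₂]
        exact sub_eq_zero.mpr (e₁.trans (add_zero _)))
    refine ⟨V, hxV, hV, w, onSections_injective (kernel.ι _) V ?_⟩
    have e₁ := onSections_eq_of_eq (mappingCone.inl_v_fst_v φ (n' + 1) n' (by ring)) (resM _ hV k)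
    have e₂ := onSections_eq_of_eq (mappingCone.inr_f_fst_v φ n' (n' + 1) rfl) z
    rw [onSections_comp, onSections_id] at e₁
    rw [onSections_comp, onSections_zero] at e₂
    rw [← onSections_comp, hp, onSections_comp, hw, map_sub, e₁, e₂, sub_zero, ← resM_onSections,
      hk]

/-- Quasi-isomorphic complexes have the same class. -/
theorem HasClass.eq_of_quasiIso [hφ : QuasiIso φ] {c c' : K0 X} (hc : HasClass K c)
    (hc' : HasClass L c') : c = c' := by
  obtain ⟨b₁, n₁, h₁, rfl⟩ := hasClass_iff.mp hc
  obtain ⟨b₂, n₂, h₂, rfl⟩ := hasClass_iff.mp hc'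
  let b := min b₁ b₂
  let N := max n₁ n₂
  have hK : IsClassData K b N := h₁.mono (min_le_left _ _) (le_max_left _ _)
  have hL : IsClassData L b N := h₂.mono (min_le_right _ _) (le_max_right _ _)
  have hex := (quasiIso_iff_exactAt_mappingCone φ).mp hφ
  have hZ : ∀ n ≥ N, IsVect (cocyc (mappingCone φ) n) ∧
      K0.clsOrZero (cocyc (mappingCone φ) n) =
        K0.clsOrZero (cocyc L n) + K0.clsOrZero (cocyc K (n + 1)) := by
    intro n hn
    obtain ⟨S, hS, e₁, e₂, e₃⟩ := mappingCone_cocyc_shortExact φ (hL.exactAt (n + 1) (by omega))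
    have v₁ : IsVect S.X₁ := by rw [e₁]; exact hL.cocyc n hn
    have v₃ : IsVect S.X₃ := by rw [e₃]; exact hK.cocyc _ (by omega)
    rw [← e₁, ← e₂, ← e₃]
    exact ⟨hS.isVect_X₂ v₁ v₃, K0.clsOrZero_of_shortExact hS v₁ v₃⟩
  have hX : ∀ n, K0.clsOrZero ((mappingCone φ).X n) =
      K0.clsOrZero (L.X n) + K0.clsOrZero (K.X (n + 1)) := fun n =>
    K0.clsOrZero_of_shortExact (mappingCone_X_shortExact φ n) (hL.vect n) (hK.vect _)
  -- The cone contains `K` shifted by one, so it can be nonzero already in degree `b - 1`.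
  have hC : IsClassData (mappingCone φ) (b - 1) N :=
    ⟨fun n => (mappingCone_X_shortExact φ n).isVect_X₂ (hL.vect n) (hK.vect _),
      fun n hn => (mappingCone.isZero_X_iff φ n).mpr ⟨hK.zero _ (by omega), hL.zero _ (by omega)⟩,
      fun n _ => hex n, fun n hn => (hZ n hn).1⟩
  have h0 := hC.altSum_eq_zero hex
  have hL' := h₂.altSum_eq (hL.mono (by omega : b - 1 ≤ b) le_rfl)
  -- The class of `K` is computed with tail in degree `N + 1`, because `Zᴺ` of the cone involves
  -- `Zᴺ⁺¹` of `K`.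
  have hK' := h₁.altSum_eq (hK.mono le_rfl (by omega : N ≤ N + 1))
  have hsum : ∑ n ∈ Finset.Ico (b - 1) N, n.negOnePow • K0.clsOrZero (K.X (n + 1)) =
      -∑ n ∈ Finset.Ico b (N + 1), n.negOnePow • K0.clsOrZero (K.X n) := by
    rw [← Finset.sum_neg_distrib]
    refine Finset.sum_nbij (fun n => n + 1) (fun n hn => ?_) (fun n _ n' _ h => ?_)
      (fun n hn => ⟨n - 1, ?_, ?_⟩) (fun n hn => ?_)
    · rw [Finset.mem_Ico] at hn ⊢
      omega
    · exact add_right_cancel h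
    · rw [Finset.mem_coe, Finset.mem_Ico] at hn ⊢
      omega
    · exact sub_add_cancel n 1
    · rw [Int.negOnePow_succ, Units.neg_smul, neg_neg]
  rw [altSum, (hZ N le_rfl).2] at h0
  simp only [hX, smul_add, Finset.sum_add_distrib, hsum] at h0
  rw [hL', hK', altSum, altSum, Int.negOnePow_succ, Units.neg_smul, ← sub_eq_zero, ← neg_eq_zero,
    ← h0]
  abel

end AlgebraicGeometry.EulerK

/-! ### Sections of the sheaves `K_i^n` -/

namespace AlgebraicGeometry.EulerK

variable {X : Scheme.{u}}

theorem exists_affine_nhd {U : X.Opens} {x : X} (hx : x ∈ U) :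
    ∃ V : X.affineOpens, x ∈ V.1 ∧ V.1 ≤ U := by
  obtain ⟨V, hV, hxV, hVU⟩ := X.isBasis_affineOpens.exists_subset_of_mem_open hx U.isOpen
  obtain ⟨V, hV, rfl⟩ := hV
  exact ⟨⟨V, hV⟩, hxV, hVU⟩

namespace TwoTerm

variable (F : TwoTerm X)

theorem res_res {U V W : X.Opens} (h : V ≤ U) (h' : W ≤ V) (x : F.Alg U) :
    F.res h' (F.res h x) = F.res (h'.trans h) x := by
  induction x using SymExt.mono_induction with
  | h0 => simp
  | hadd x y hx hy => simp only [map_add, hx, hy]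
  | hsmul r x hx => rw [res_smul, res_smul, res_smul, hx, resO_resO]
  | hmono c b => simp only [res, SymExt.map_mono, List.map_map, Function.comp_def, resM_resM]

theorem res_mem {m : ℕ} {i n : ℤ} {V W : X.Opens} (h : W ≤ V) {z : F.Alg V}
    (hz : z ∈ F.totU m i n V) : F.res h z ∈ F.totU m i n W :=
  SymExt.map_mem_tot _ _ _ hz

variable {F} {m : ℕ} {i n : ℤ}

/-- Restriction of sections of `K_i^n` over affine open subsets. -/
noncomputable def totResU {V W : X.Opens} (h : W ≤ V) :
    F.totU m i n V →ₛₗ[resO h] F.totU m i n W where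
  toFun z := ⟨F.res h z, F.res_mem h z.2⟩
  map_add' _ _ := Subtype.ext (map_add _ _ _)
  map_smul' _ _ := Subtype.ext (F.res_smul _ _ _)

variable (F m i n) in
/-- The compatible family defined by an element of `K_i^n(V)`. -/
noncomputable def famOf (V : X.Opens) : F.totU m i n V →ₗ[Γ(X, V)] F.totSec m i n V where
  toFun z := ⟨fun W => F.res W.2 z, fun W => F.res_mem W.2 z.2, fun W _ h => F.res_res W.2 h z⟩
  map_add' _ _ := Subtype.ext (funext fun _ => map_add _ _ _)
  map_smul' _ _ := Subtype.ext (funext fun _ => F.res_smul _ _ _)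

variable (F m i n) in
/-- The section of the sheaf `K_i^n` defined by an element of `K_i^n(V)`. -/
noncomputable def secOf (V : X.Opens) : F.totU m i n V →ₗ[Γ(X, V)] Γ(F.totSheaf m i n, V) where
  toFun z := shfUnit (F.totPresheaf m i n) V (famOf F m i n V z)
  map_add' z z' := by rw [map_add]; exact map_add _ _ _
  map_smul' r z := by
    rw [map_smul]
    exact shfUnit_smul (F.totPresheaf m i n) r _

theorem resM_secOf {V W : X.Opens} (h : W ≤ V) (z : F.totU m i n V) :
    resM _ h (secOf F m i n V z) = secOf F m i n W (totResU h z) := by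
  refine (shfUnit_res (F.totPresheaf m i n) h _).trans ?_
  refine congrArg (shfUnit (F.totPresheaf m i n) W) ?_
  exact Subtype.ext (funext fun W' => (F.res_res h W'.2 z.1).symm)

theorem exists_totResU_eq_zero {V : X.Opens} (z : F.totU m i n V) (hz : secOf F m i n V z = 0)
    {x : X} (hx : x ∈ V) :
    ∃ (W : X.affineOpens) (_ : x ∈ W.1) (h : W.1 ≤ V), totResU h z = 0 := by
  obtain ⟨W, hxW, hW, h0⟩ := shfUnit_locally_injective _ _ hz x hx
  obtain ⟨W', hxW', hW'⟩ := exists_affine_nhd hxW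
  refine ⟨W', hxW', hW'.trans hW, Subtype.ext ?_⟩
  exact congrFun (congrArg Subtype.val h0) ⟨W', hW'⟩

theorem exists_secOf_eq {U : X.Opens} (t : Γ(F.totSheaf m i n, U)) {x : X} (hx : x ∈ U) :
    ∃ (V : X.affineOpens) (_ : x ∈ V.1) (h : V.1 ≤ U) (z : F.totU m i n V.1),
      secOf F m i n V.1 z = resM _ h t := by
  obtain ⟨W, hxW, hW, s, hs⟩ := shfUnit_locally_surjective _ t x hx
  obtain ⟨V, hxV, hV⟩ := exists_affine_nhd hxW
  let s' : F.totSec m i n W := s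
  refine ⟨V, hxV, hV.trans hW, ⟨s'.1 ⟨V, hV⟩, s'.2.1 ⟨V, hV⟩⟩, ?_⟩
  refine Eq.trans ?_ ((congrArg (resM (F.totSheaf m i n) hV) hs).trans (resM_resM hW hV t))
  refine Eq.trans ?_ (shfUnit_res (F.totPresheaf m i n) hV s).symm
  refine congrArg (shfUnit (F.totPresheaf m i n) V.1) ?_
  exact Subtype.ext (funext fun W' => s'.2.2 ⟨V, hV⟩ ⟨W'.1, W'.2.trans hV⟩ W'.2)

theorem onSections_sheafMap {Φ F : TwoTerm X} (T : AffMap Φ F) {m : ℕ} {i n i' n' : ℤ}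
    (hT : ∀ V : X.affineOpens, ∀ x ∈ Φ.totU m i n V.1, T.toFun V x ∈ F.totU m i' n' V.1)
    (V : X.affineOpens) (z : Φ.totU m i n V.1) :
    onSections (T.sheafMap hT) V.1 (secOf Φ m i n V.1 z) =
      secOf F m i' n' V.1 ⟨T.toFun V z, hT V z z.2⟩ := by
  refine (onSections_shfUnit (T.presheafMap hT) V.1 _).trans ?_
  refine congrArg (shfUnit (F.totPresheaf m i' n') V.1) ?_
  exact Subtype.ext (funext fun W => (T.res_toFun V W.1 W.2 z.1).symm)

/-! ### Frames -/

section Frames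

variable {r₀ r₁ : ℕ} {U : X.Opens} {e : Fin r₀ → Γ(F.F₀, U)} {b : Fin r₁ → Γ(F.F₁, U)}

theorem res_monoBasis (he : IsFrame e) (hb : IsFrame b) {V W : X.Opens} (hV : V ≤ U) (hW : W ≤ V)
    (x : (Fin r₀ →₀ ℕ) × Finset (Fin r₁)) :
    F.res hW (SymExt.monoBasis (he.basis hV) (hb.basis hV) x) =
      SymExt.monoBasis (he.basis (hW.trans hV)) (hb.basis (hW.trans hV)) x := by
  rw [SymExt.monoBasis_apply, SymExt.monoBasis_apply, res, SymExt.map_mono, List.map_map,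
    List.map_map]
  have h₀ : ⇑(he.basis (hW.trans hV)) = resM F.F₀ hW ∘ he.basis hV := funext fun j => by
    rw [Function.comp_apply, IsFrame.basis_apply, IsFrame.basis_apply, resM_resM]
  have h₁ : ⇑(hb.basis (hW.trans hV)) = resM F.F₁ hW ∘ hb.basis hV := funext fun j => by
    rw [Function.comp_apply, IsFrame.basis_apply, IsFrame.basis_apply, resM_resM]
  rw [h₀, h₁]

/-- The index type of the monomial basis of `K_i^n`. -/
abbrev TotIdx (r₀ r₁ m : ℕ) (i n : ℤ) : Type :=
  (SymExt.totIndex m i n : Set ((Fin r₀ →₀ ℕ) × Finset (Fin r₁)))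

noncomputable instance : Fintype (TotIdx r₀ r₁ m i n) :=
  (SymExt.finite_totIndex m i n).fintype

/-- The monomial basis of `K_i^n(V)` given by frames. -/
noncomputable def frameBasis (he : IsFrame e) (hb : IsFrame b) {V : X.Opens} (hV : V ≤ U)
    (m : ℕ) (i n : ℤ) : Module.Basis (TotIdx r₀ r₁ m i n) Γ(X, V) (F.totU m i n V) :=
  SymExt.totBasis (he.basis hV) (hb.basis hV) m i n

theorem totResU_frameBasis (he : IsFrame e) (hb : IsFrame b) {V W : X.Opens} (hV : V ≤ U)
    (hW : W ≤ V) (x : TotIdx r₀ r₁ m i n) :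
    totResU hW (frameBasis he hb hV m i n x) = frameBasis he hb (hW.trans hV) m i n x := by
  apply Subtype.ext
  refine Eq.trans ?_ (SymExt.coe_totBasis _ _ m i n x).symm
  refine (congrArg (F.res hW) (SymExt.coe_totBasis _ _ m i n x)).trans ?_
  exact res_monoBasis he hb hV hW x.1

theorem sum_smul_resM_secOf (he : IsFrame e) (hb : IsFrame b) {V : X.Opens} (hV : V ≤ U)
    (c : TotIdx r₀ r₁ m i n → Γ(X, V)) :
    ∑ x, c x • resM _ hV (secOf F m i n U (frameBasis he hb le_rfl m i n x)) =
      secOf F m i n V (∑ x, c x • frameBasis he hb hV m i n x) := by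
  rw [map_sum]
  refine Finset.sum_congr rfl fun x _ => ?_
  rw [map_smul, resM_secOf, totResU_frameBasis]

/-- Monomial bases restrict to monomial bases. Sheafification changes sections only locally, so
linear independence and generation, both local conditions, pass to the sheaf. -/
theorem isFrame_secOf (he : IsFrame e) (hb : IsFrame b) :
    IsFrame fun x => secOf F m i n U (frameBasis he hb le_rfl m i n x) := by
  refine isFrame_of_locally _ (fun W h c hc => ?_) fun W h s x hx => ?_
  · rw [sum_smul_resM_secOf] at hc
    funext j
    refine function_ext fun x hx => ?_
    obtain ⟨V, hxV, hV, h0⟩ := exists_totResU_eq_zero _ hc hx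
    refine ⟨V.1, hxV, hV, ?_⟩
    simp only [map_sum, LinearMap.map_smulₛₗ, totResU_frameBasis] at h0
    rw [← Module.Basis.equivFun_symm_apply, LinearEquiv.map_eq_zero_iff] at h0
    exact (congrFun h0 j).trans (map_zero _).symm
  · obtain ⟨V, hxV, hV, z, hz⟩ := exists_secOf_eq s hx
    refine ⟨V.1, hxV, hV, (frameBasis he hb (hV.trans h) m i n).repr z, ?_⟩
    rw [sum_smul_resM_secOf, Module.Basis.sum_repr, hz]

/-- Over an open subset with frames the sections of the sheaf are precisely the elements of the
algebraic `K_i^n`. All later statements about the sheaves are reduced to algebra by this. -/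
theorem secOf_bijective (he : IsFrame e) (hb : IsFrame b) {V : X.Opens} (hV : V ≤ U) :
    Function.Bijective (secOf F m i n V) := by
  have h := isFrame_secOf (m := m) (i := i) (n := n) he hb V hV
  let B := frameBasis he hb hV m i n
  have key : (fun c : TotIdx r₀ r₁ m i n → Γ(X, V) =>
      ∑ x, c x • resM _ hV (secOf F m i n U (frameBasis he hb le_rfl m i n x))) =
      secOf F m i n V ∘ B.equivFun.symm := by
    funext c
    rw [Function.comp_apply, Module.Basis.equivFun_symm_apply, sum_smul_resM_secOf]
  rw [key] at h
  exact (Function.Bijective.of_comp_iff _ B.equivFun.symm.bijective).mp h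

end Frames

variable (F) in
theorem exists_frames (x : X) : ∃ (U : X.Opens) (_ : x ∈ U) (r₀ r₁ : ℕ) (e : Fin r₀ → Γ(F.F₀, U))
    (b : Fin r₁ → Γ(F.F₁, U)), IsFrame e ∧ IsFrame b :=
  F.vect₀.exists_isFrame_pair F.vect₁ x

variable (F m i n) in
theorem isVect_totSheaf : IsVect (F.totSheaf m i n) := by
  refine isVect_iff_isFrame.mpr fun x => ?_
  obtain ⟨U, hxU, r₀, r₁, e, b, he, hb⟩ := F.exists_frames x
  exact ⟨U, hxU, _, _, (isFrame_secOf he hb).reindex (Fintype.equivFin _).symm⟩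

end TwoTerm

end AlgebraicGeometry.EulerK

/-! ### Exactness and locally free cocycles in large degrees -/

namespace AlgebraicGeometry.EulerK

variable {X : Scheme.{u}} {M N : X.Modules}

/-- The kernel of a map that has a generalized inverse on an open subset with frames. -/
theorem exists_isFrame_kernel {ι κ : Type*} [Fintype ι] [Fintype κ] (f : M ⟶ N) {U : X.Opens}
    {g : ι → Γ(M, U)} {h : κ → Γ(N, U)} (hg : IsFrame g) (hh : IsFrame h)
    (Q : Γ(N, U) →ₗ[Γ(X, U)] Γ(M, U))
    (hQ : ∀ s, onSections f U (Q (onSections f U s)) = onSections f U s) {x : X} (hx : x ∈ U) :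
    ∃ (V : X.Opens) (_ : x ∈ V) (n : ℕ) (k : Fin n → Γ(kernel f, V)), IsFrame k := by
  have hk : ∀ j, ∃ k : Γ(kernel f, U), onSections (kernel.ι f) U k =
      g j - Q (onSections f U (g j)) := fun j =>
    exists_kernel_section f _ (by rw [map_sub, hQ, sub_self])
  choose k hk using hk
  -- `1 - Q f` projects onto the kernel, so the sections `k j = g j - Q (f (g j))` generate it, with
  -- coordinates taken in the frame `g`.
  refine exists_isFrame_of_coords k
    (fun W hW => (hg.equiv hW).symm.toLinearMap.comp (onSections (kernel.ι f) W)) ?_ ?_ hx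
  · intro W hW z j
    simp only [LinearMap.comp_apply, LinearEquiv.coe_coe]
    rw [← resM_onSections, hg.equiv_symm_res le_rfl hW]
  · intro W hW z
    apply onSections_injective (kernel.ι f) W
    simp only [LinearMap.comp_apply, LinearEquiv.coe_coe, map_sum, map_smul]
    obtain ⟨lam, hlam⟩ : ∃ lam, lam = (hg.equiv hW).symm (onSections (kernel.ι f) W z) := ⟨_, rfl⟩
    have hz : ∑ j, lam j • resM M hW (g j) = onSections (kernel.ι f) W z := by
      rw [hlam, hg.sum_equiv_symm]
    rw [← hlam]
    have e : ∀ j, onSections (kernel.ι f) W (resM _ hW (k j)) =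
        resM M hW (g j) - resM M hW (Q (onSections f U (g j))) := fun j => by
      rw [← resM_onSections, hk, map_sub]
    simp only [e, smul_sub, Finset.sum_sub_distrib]
    rw [hz, sub_eq_self]
    -- expand `f (g j)` in the frame `h`
    let D (j : ι) : κ → Γ(X, U) := (hh.equiv le_rfl).symm (onSections f U (g j))
    have hD : ∀ j, ∑ l, D j l • h l = onSections f U (g j) := fun j => by
      have := hh.sum_equiv_symm le_rfl (onSections f U (g j))
      simpa only [resM_self] using this
    -- `Q` is defined over `U` only, so it cannot be applied to sections over `W`. Instead, `∑ λ_j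
    -- f(g_j) = 0` forces its coefficients in the frame `h` to vanish, and these multiply the
    -- restrictions of `Q (h l)`.
    have h1 : hh.equiv hW (fun l => ∑ j, lam j * resO hW (D j l)) = 0 := by
      have h0 := onSections_kernel_ι f z
      rw [← hz, map_sum] at h0
      rw [← h0, hh.equiv_apply]
      simp only [Finset.sum_smul]
      rw [Finset.sum_comm]
      refine Finset.sum_congr rfl fun j _ => ?_
      rw [map_smul, ← resM_onSections, ← hD, map_sum, Finset.smul_sum]
      refine Finset.sum_congr rfl fun l _ => ?_
      rw [LinearMap.map_smulₛₗ, smul_smul]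
    rw [LinearEquiv.map_eq_zero_iff] at h1
    have h2 : ∀ j, lam j • resM M hW (Q (onSections f U (g j))) =
        ∑ l, (lam j * resO hW (D j l)) • resM M hW (Q (h l)) := fun j => by
      rw [← hD, map_sum, map_sum, Finset.smul_sum]
      refine Finset.sum_congr rfl fun l _ => ?_
      rw [map_smul, LinearMap.map_smulₛₗ, smul_smul]
    simp only [h2]
    rw [Finset.sum_comm]
    refine Finset.sum_eq_zero fun l _ => ?_
    rw [← Finset.sum_smul]
    have := congrFun h1 l
    rw [this, Pi.zero_apply, zero_smul]

theorem isZero_of_sections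
    (h : ∀ (U : X.Opens) (s : Γ(M, U)), ∀ x ∈ U, ∃ (V : X.Opens) (_ : x ∈ V) (hV : V ≤ U),
      resM M hV s = 0) : IsZero M := by
  rw [IsZero.iff_id_eq_zero]
  ext U s
  refine section_ext fun x hx => ?_
  obtain ⟨V, hxV, hV, h0⟩ := h U s x hx
  exact ⟨V, hxV, hV, h0.trans (map_zero _).symm⟩

namespace TwoTerm

variable {F : TwoTerm X} {m : ℕ} {i n : ℤ}

theorem onSections_complex_d (a : F.ClosedForm m) {n n' : ℤ} (h : n + 1 = n') (V : X.affineOpens)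
    (z : F.totU m i n V.1) :
    onSections ((a.complex i).d n n') V.1 (secOf F m i n V.1 z) = secOf F m i n' V.1
      ⟨SymExt.totD (F.dU V.1) (a.val V) z, h ▸ SymExt.totD_mem_tot (F.dU V.1) (a.mem V) z.2⟩ := by
  have e : (a.complex i).d n n' = a.totD.sheafMap (fun V x hx => h ▸
    SymExt.totD_mem_tot (F.dU V.1) (a.mem V) hx) := dif_pos h
  rw [e]
  exact onSections_sheafMap a.totD _ V z

theorem exists_secOf_eq_of_le {U : X.Opens} (t : Γ(F.totSheaf m i n, U)) {x : X} (hx : x ∈ U)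
    (V : X.Opens) (hxV : x ∈ V) :
    ∃ (W : X.affineOpens) (_ : x ∈ W.1) (h : W.1 ≤ U) (_ : W.1 ≤ V) (z : F.totU m i n W.1),
      secOf F m i n W.1 z = resM _ h t := by
  obtain ⟨W, hxW, hW, z, hz⟩ := exists_secOf_eq (resM _ inf_le_left t : Γ(F.totSheaf m i n, U ⊓ V))
    ⟨hx, hxV⟩
  exact ⟨W, hxW, hW.trans inf_le_left, hW.trans inf_le_right, z, by rw [hz, resM_resM]⟩

/-- An affine open subset with frames of `F₀` and `F₁` of ranks at most `B`. -/
def HasFrames (F : TwoTerm X) (B : ℕ) (V : X.Opens) : Prop :=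
  ∃ (r₀ r₁ : ℕ) (_ : r₀ ≤ B) (_ : r₁ ≤ B) (e : Fin r₀ → Γ(F.F₀, V)) (b : Fin r₁ → Γ(F.F₁, V)),
    IsFrame e ∧ IsFrame b

theorem HasFrames.mono {B : ℕ} {V W : X.Opens} (h : HasFrames F B V) (hW : W ≤ V) :
    HasFrames F B W := by
  obtain ⟨r₀, r₁, h₀, h₁, e, b, he, hb⟩ := h
  exact ⟨r₀, r₁, h₀, h₁, _, _, he.res hW, hb.res hW⟩

theorem HasFrames.mono_right {B B' : ℕ} {V : X.Opens} (h : HasFrames F B V) (hB : B ≤ B') :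
    HasFrames F B' V := by
  obtain ⟨r₀, r₁, h₀, h₁, e, b, he, hb⟩ := h
  exact ⟨r₀, r₁, h₀.trans hB, h₁.trans hB, _, _, he, hb⟩

theorem HasFrames.secOf_bijective {B : ℕ} {V : X.Opens} (h : HasFrames F B V) :
    Function.Bijective (secOf F m i n V) := by
  obtain ⟨r₀, r₁, -, -, e, b, he, hb⟩ := h
  exact TwoTerm.secOf_bijective he hb le_rfl

theorem HasFrames.totU_eq_bot {B : ℕ} {V : X.Opens} (h : HasFrames F B V) (hi : 0 ≤ i)
    (hn : n < -(B : ℤ)) : F.totU m i n V = ⊥ := by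
  obtain ⟨r₀, r₁, -, h₁, e, b, he, hb⟩ := h
  exact SymExt.tot_eq_bot (he.basis le_rfl) (hb.basis le_rfl) hi (by rw [Fintype.card_fin]; omega)

/-- A bound `B` for the ranks of `F₁` bounds the exterior degree, and then no monomial has total
degree below `-B`. -/
theorem isZero_totSheaf {B : ℕ} (h : ∀ x : X, ∃ V : X.Opens, x ∈ V ∧ HasFrames F B V) (hi : 0 ≤ i)
    (hn : n < -(B : ℤ)) : IsZero (F.totSheaf m i n) := by
  refine isZero_of_sections fun U s x hx => ?_
  obtain ⟨V, hxV, hV⟩ := h x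
  obtain ⟨W, hxW, hWU, hWV, z, hz⟩ := exists_secOf_eq_of_le s hx V hxV
  refine ⟨W.1, hxW, hWU, ?_⟩
  have h0 : z = 0 := Subtype.ext
    ((Submodule.mem_bot _).mp (((hV.mono hWV).totU_eq_bot hi hn).le z.2))
  rw [← hz, h0, map_zero]

/-- A contraction of the total complexes in degrees `n ≥ n₀` on an affine open subset. -/
def HasContraction (a : F.ClosedForm m) (n₀ : ℤ) (V : X.affineOpens) : Prop :=
  ∃ H : F.Alg V.1 →ₗ[Γ(X, V.1)] F.Alg V.1, ∀ i : ℕ, i ≤ m → ∀ n : ℤ, n₀ ≤ n →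
    ∀ z ∈ F.totU m i n V.1,
      SymExt.totD (F.dU V.1) (a.val V) (SymExt.totProj _ _ _ m i (n - 1) (H z)) +
        SymExt.totProj _ _ _ m i n (H (SymExt.totD (F.dU V.1) (a.val V) z)) = z

theorem exists_totD_eq {a : F.ClosedForm m} {n₀ : ℤ} {V : X.affineOpens}
    (h : HasContraction a n₀ V) {i : ℕ} (hi : i ≤ m) {n : ℤ} (hn : n₀ ≤ n) (z : F.totU m i n V.1)
    (hz : SymExt.totD (F.dU V.1) (a.val V) z = 0) :
    ∃ w : F.totU m i (n - 1) V.1, SymExt.totD (F.dU V.1) (a.val V) w = z := by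
  obtain ⟨H, hH⟩ := h
  refine ⟨⟨_, SymExt.totProj_mem m i (n - 1) (H z)⟩, ?_⟩
  have := hH i hi n hn z z.2
  rwa [hz, map_zero, map_zero, add_zero] at this

/-- On an open subset with frames a cocycle of sections is an algebraic one, and the contraction
gives its primitive. -/
theorem complex_exactAt {a : F.ClosedForm m} {n₀ : ℤ} {B : ℕ}
    (h : ∀ (x : X) (U : X.Opens), x ∈ U → ∃ V : X.affineOpens, x ∈ V.1 ∧ V.1 ≤ U ∧
      HasFrames F B V.1 ∧ HasContraction a n₀ V)
    {i : ℕ} (hi : i ≤ m) {n : ℤ} (hn : n₀ ≤ n) : (a.complex i).ExactAt n := by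
  refine exactAt_of_onSections _ n fun U y hy x hx => ?_
  obtain ⟨V, hxV, hVU, hV, hH⟩ := h x U hx
  obtain ⟨z, hz⟩ := hV.secOf_bijective.2 (resM _ hVU y : Γ(F.totSheaf m i n, V.1))
  have e := onSections_complex_d (i := i) a (rfl : n + 1 = n + 1) V z
  have hz' : onSections ((a.complex i).d n (n + 1)) V.1 (secOf F m i n V.1 z) = 0 := by
    refine (congrArg (onSections ((a.complex i).d n (n + 1)) V.1) hz).trans ?_
    refine (resM_onSections ((a.complex i).d n (n + 1)) hVU y).symm.trans ?_
    rw [hy, map_zero]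
  have e0 := hV.secOf_bijective.1 ((e.symm.trans hz').trans (map_zero _).symm)
  obtain ⟨w, hw⟩ := exists_totD_eq hH hi hn z (congrArg Subtype.val e0)
  refine ⟨V.1, hxV, hVU, secOf F m i (n - 1) V.1 w, ?_⟩
  refine (onSections_complex_d a (sub_add_cancel n 1) V w).trans (Eq.trans ?_ hz)
  exact congrArg _ (Subtype.ext hw)

/-- A contraction `P` in degree `n` satisfies `D P D = D`: apply `D` to `DP + PD = 1`. So `P` is a
generalized inverse of the differential, and `exists_isFrame_kernel` applies. -/
theorem isVect_cocyc_complex {a : F.ClosedForm m} {n₀ : ℤ} {B : ℕ}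
    (h : ∀ (x : X) (U : X.Opens), x ∈ U → ∃ V : X.affineOpens, x ∈ V.1 ∧ V.1 ≤ U ∧
      HasFrames F B V.1 ∧ HasContraction a n₀ V)
    {i : ℕ} (hi : i ≤ m) {n : ℤ} (hn : n₀ ≤ n) : IsVect (cocyc (a.complex i) n) := by
  refine isVect_iff_isFrame.mpr fun x => ?_
  obtain ⟨V, hxV, -, hV, H, hH⟩ := h x ⊤ trivial
  obtain ⟨r₀, r₁, -, -, e, b, he, hb⟩ := id hV
  let E : F.totU m i (n + 1) V.1 ≃ₗ[Γ(X, V.1)] Γ(F.totSheaf m i (n + 1), V.1) :=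
    LinearEquiv.ofBijective (secOf F m i (n + 1) V.1) hV.secOf_bijective
  let P : F.totU m i (n + 1) V.1 →ₗ[Γ(X, V.1)] F.totU m i n V.1 :=
    ((SymExt.totProj Γ(X, V.1) Γ(F.F₀, V.1) Γ(F.F₁, V.1) m i n).comp
      (H.comp (F.totU m i (n + 1) V.1).subtype)).codRestrict _
      fun z => SymExt.totProj_mem m i n _
  refine exists_isFrame_kernel (M := F.totSheaf m i n) (N := F.totSheaf m i (n + 1))
    ((a.complex i).d n (n + 1)) (isFrame_secOf he hb) (isFrame_secOf he hb)
    ((secOf F m i n V.1).comp (P.comp E.symm.toLinearMap)) (fun s => ?_) hxV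
  obtain ⟨z, rfl⟩ := hV.secOf_bijective.2 s
  have e₁ := onSections_complex_d (i := i) a (rfl : n + 1 = n + 1) V z
  let w : F.totU m i (n + 1) V.1 := ⟨SymExt.totD (F.dU V.1) (a.val V) z,
    SymExt.totD_mem_tot (F.dU V.1) (a.mem V) z.2⟩
  have e₂ : ((secOf F m i n V.1).comp (P.comp E.symm.toLinearMap))
      (onSections ((a.complex i).d n (n + 1)) V.1 (secOf F m i n V.1 z)) =
      secOf F m i n V.1 (P w) := by
    refine (congrArg _ e₁).trans ?_
    exact congrArg (fun t => secOf F m i n V.1 (P t)) (E.symm_apply_apply w)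
  refine (congrArg (onSections ((a.complex i).d n (n + 1)) V.1) e₂).trans ?_
  refine (onSections_complex_d (i := i) a (rfl : n + 1 = n + 1) V (P w)).trans (Eq.trans ?_ e₁.symm)
  refine congrArg _ (Subtype.ext ?_)
  have key := congrArg (SymExt.totD (F.dU V.1) (a.val V)) (hH i hi n hn z z.2)
  rw [map_add, SymExt.totD_totD _ (a.mem V) (a.closed V), zero_add] at key
  exact key

end TwoTerm

end AlgebraicGeometry.EulerK

namespace AlgebraicGeometry.EulerK

/-! ### Scalars and residue fields of closed points -/

section Scalars

variable {X : Scheme.{u}} {κ : Type u} [Field κ]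

/-- The scalars in the functions on an open subset of a scheme over a field. -/
noncomputable def scalar (s : X ⟶ Spec (CommRingCat.of κ)) (V : X.Opens) : κ →+* Γ(X, V) :=
  (resO le_top).comp (s.appTop.hom.comp (Scheme.ΓSpecIso (CommRingCat.of κ)).inv.hom)

theorem isUnit_natCast [CharZero κ] (s : X ⟶ Spec (CommRingCat.of κ)) (V : X.Opens) (k : ℕ)
    (hk : k ≠ 0) : IsUnit (k : Γ(X, V)) := by
  have := (isUnit_iff_ne_zero.mpr (Nat.cast_ne_zero.mpr hk : (k : κ) ≠ 0)).map (scalar s V)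
  rwa [map_natCast] at this

theorem isAlgClosed_residueField [IsAlgClosed κ] (s : X ⟶ Spec (CommRingCat.of κ))
    [LocallyOfFiniteType s] {x : X} (hx : IsClosed ({x} : Set X)) :
    IsAlgClosed (X.residueField x) :=
  IsAlgClosed.of_ringEquiv κ _ (residueFieldIsoBase s x hx).symm.commRingCatIsoToRingEquiv

/-- The residue field at a closed point is the algebraically closed base field, so constant
functions already take all values. -/
theorem evaluation_surjective [IsAlgClosed κ] (s : X ⟶ Spec (CommRingCat.of κ))
    [LocallyOfFiniteType s] {x : X} (hx : IsClosed ({x} : Set X)) (V : X.Opens) (hxV : x ∈ V) :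
    Function.Surjective (X.evaluation V x hxV).hom := by
  intro t
  obtain ⟨c, rfl⟩ := (ConcreteCategory.bijective_of_isIso (residueFieldIsoBase s x hx).inv).2 t
  refine ⟨scalar s V c, ?_⟩
  have h := congrArg Scheme.Hom.appTop (SpecMap_residueFieldIsoBase_inv s x hx)
  have h' := congrArg (fun t => (Scheme.ΓSpecIso _).inv ≫ t) h
  simp only [Scheme.fromSpecResidueField, Scheme.Hom.comp_appTop] at h'
  rw [← Scheme.ΓSpecIso_inv_naturality] at h'
  have h2 : (X.fromSpecStalk x).appTop ≫ (Spec.map (X.residue x)).appTop =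
      X.presheaf.germ ⊤ x trivial ≫ X.residue x ≫ (Scheme.ΓSpecIso _).inv := by
    rw [Scheme.fromSpecStalk_appTop, Scheme.ΓSpecIso_inv_naturality]
    have : (homOfLE le_top : (⊤ : (Spec (X.presheaf.stalk x)).Opens) ⟶ ⊤) = 𝟙 _ := rfl
    rw [this, op_id, CategoryTheory.Functor.map_id]
    simp
  rw [h2] at h'
  have h3 : (residueFieldIsoBase s x hx).inv = (Scheme.ΓSpecIso (.of κ)).inv ≫ s.appTop ≫
      X.presheaf.germ ⊤ x trivial ≫ X.residue x := by
    rw [← cancel_mono (Scheme.ΓSpecIso (X.residueField x)).inv]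
    simpa using h'
  rw [h3]
  have h4 : X.presheaf.germ ⊤ x trivial = X.presheaf.map (homOfLE le_top).op ≫
    X.presheaf.germ V x hxV := (X.presheaf.germ_res (homOfLE le_top) x hxV).symm
  rw [h4]
  rfl

end Scalars

end AlgebraicGeometry.EulerK

namespace AlgebraicGeometry.EulerK

/-! ### Uniform bounds, and existence of the classes -/

section Uniform

variable {X : Scheme.{u}}

/-- On a quasi-compact scheme, a local property with a bound holds with a uniform bound if it holds
near all closed points. -/
theorem exists_uniform_bound [CompactSpace X] (P : ℕ → X.affineOpens → Prop)
    (hmono : ∀ B (V W : X.affineOpens), W.1 ≤ V.1 → P B V → P B W)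
    (hbound : ∀ B B' V, B ≤ B' → P B V → P B' V)
    (h : ∀ x : X, IsClosed ({x} : Set X) → ∃ (V : X.affineOpens) (B : ℕ), x ∈ V.1 ∧ P B V) :
    ∃ B, ∀ (x : X) (U : X.Opens), x ∈ U → ∃ V : X.affineOpens, x ∈ V.1 ∧ V.1 ≤ U ∧ P B V := by
  have hall : ∀ x : X, ∃ (V : X.affineOpens) (B : ℕ), x ∈ V.1 ∧ P B V := by
    by_contra! hx
    obtain ⟨x₀, hx₀⟩ := hx
    -- The bad set is closed, and a nonempty closed subset of a quasi-compact scheme contains a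
    -- closed point. So nondegeneracy at closed points is enough.
    let S : Set X := {x | ∀ (V : X.affineOpens) (B : ℕ), x ∈ V.1 → ¬ P B V}
    have hS : IsClosed S := by
      rw [← isOpen_compl_iff, isOpen_iff_forall_mem_open]
      intro x hx
      obtain ⟨V, B, hxV, hV⟩ : ∃ (V : X.affineOpens) (B : ℕ), x ∈ V.1 ∧ P B V := by
        by_contra! hcon
        exact hx hcon
      exact ⟨V.1, fun y hy hyS => hyS V B hy hV, V.1.isOpen, hxV⟩
    obtain ⟨x, hxS, hx⟩ := IsClosed.exists_closed_singleton hS ⟨x₀, hx₀⟩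
    obtain ⟨V, B, hxV, hV⟩ := h x hx
    exact hxS V B hxV hV
  choose V B hxV hV using hall
  obtain ⟨t, ht⟩ := CompactSpace.elim_nhds_subcover (fun x => ((V x).1 : Set X))
    fun x => (V x).1.isOpen.mem_nhds (hxV x)
  refine ⟨t.sup B, fun x U hx => ?_⟩
  obtain ⟨y, hy, hxy⟩ : ∃ y ∈ t, x ∈ (V y).1 := by
    have : x ∈ ⋃ y ∈ t, ((V y).1 : Set X) := by rw [ht]; trivial
    simpa using this
  obtain ⟨W, hxW, hW⟩ := exists_affine_nhd (U := (V y).1 ⊓ U) ⟨hxy, hx⟩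
  exact ⟨W, hxW, hW.trans inf_le_right, hbound _ _ _ (Finset.le_sup hy)
    (hmono _ _ _ (hW.trans inf_le_left) (hV y))⟩

end Uniform

namespace TwoTerm

variable {X : Scheme.{u}} {F : TwoTerm X} {m : ℕ}

variable (F) in
theorem exists_hasFrames [CompactSpace X] :
    ∃ B, ∀ (x : X) (U : X.Opens), x ∈ U → ∃ V : X.affineOpens, x ∈ V.1 ∧ V.1 ≤ U ∧
      HasFrames F B V.1 := by
  refine exists_uniform_bound (fun B V => HasFrames F B V.1) (fun B V W hW h => h.mono hW)
    (fun B B' V hB h => h.mono_right hB) fun x _ => ?_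
  obtain ⟨U, hxU, r₀, r₁, e, b, he, hb⟩ := F.exists_frames x
  obtain ⟨V, hxV, hV⟩ := exists_affine_nhd hxU
  exact ⟨V, max r₀ r₁, hxV, HasFrames.mono ⟨r₀, r₁, le_max_left _ _, le_max_right _ _, e, b, he, hb⟩
    hV⟩

/-- An affine open subset with frames, on which powers of the linear coordinates are in the
base ideal of `a`. -/
def IsGood (a : F.ClosedForm m) (B : ℕ) (V : X.affineOpens) : Prop :=
  ∃ (r₀ r₁ N : ℕ) (_ : r₀ ≤ B) (_ : r₁ ≤ B) (_ : N ≤ B) (e : Fin r₀ → Γ(F.F₀, V.1))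
    (b : Fin r₁ → Γ(F.F₁, V.1)), IsFrame e ∧ IsFrame b ∧
    ∀ j, SymmetricAlgebra.ι Γ(X, V.1) Γ(F.F₀, V.1) (e j) ^ N ∈
      SymExt.baseIdeal (F.dU V.1) (a.val V)

theorem symMap_res_mem_baseIdeal (a : F.ClosedForm m) {V W : X.affineOpens} (hW : W.1 ≤ V.1)
    {r : ℕ} {b : Fin r → Γ(F.F₁, V.1)} (hb : IsFrame b)
    {s : SymmetricAlgebra Γ(X, V.1) Γ(F.F₀, V.1)}
    (hs : s ∈ SymExt.baseIdeal (F.dU V.1) (a.val V)) :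
    SymExt.symMap (resO hW) (resM F.F₀ hW) s ∈ SymExt.baseIdeal (F.dU W.1) (a.val W) := by
  have := SymExt.symMap_mem_baseIdeal (resO hW) (resM F.F₀ hW) (resM F.F₁ hW) (F.dU V.1)
    (F.dU W.1) (resM_onSections F.d hW) (hb.basis le_rfl) (hb.basis hW)
    (fun j => by rw [IsFrame.basis_apply, IsFrame.basis_apply, resM_resM]) (a.mem V) hs
  rwa [← a.res_val V W hW]

theorem IsGood.mono {a : F.ClosedForm m} {B : ℕ} {V W : X.affineOpens} (h : IsGood a B V)
    (hW : W.1 ≤ V.1) : IsGood a B W := by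
  obtain ⟨r₀, r₁, N, h₀, h₁, hN, e, b, he, hb, h⟩ := h
  refine ⟨r₀, r₁, N, h₀, h₁, hN, _, _, he.res hW, hb.res hW, fun j => ?_⟩
  have := symMap_res_mem_baseIdeal a hW hb (h j)
  rwa [map_pow, SymExt.symMap_ι] at this

theorem IsGood.mono_right {a : F.ClosedForm m} {B B' : ℕ} {V : X.affineOpens} (h : IsGood a B V)
    (hB : B ≤ B') : IsGood a B' V := by
  obtain ⟨r₀, r₁, N, h₀, h₁, hN, h⟩ := h
  exact ⟨r₀, r₁, N, h₀.trans hB, h₁.trans hB, hN.trans hB, h⟩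

theorem IsGood.hasFrames {a : F.ClosedForm m} {B : ℕ} {V : X.affineOpens} (h : IsGood a B V) :
    HasFrames F B V.1 := by
  obtain ⟨r₀, r₁, N, h₀, h₁, hN, e, b, he, hb, h⟩ := h
  exact ⟨r₀, r₁, h₀, h₁, e, b, he, hb⟩

/-- The degree bound `r₀ N + m + 1` of the algebraic contraction is replaced by one in `B` alone, so
that it is the same on all good subsets. -/
theorem IsGood.hasContraction {a : F.ClosedForm m} (hm : 1 ≤ m) {B : ℕ} {V : X.affineOpens}
    (h : IsGood a B V) : HasContraction a ((B * B + m + 1 : ℕ) : ℤ) V := by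
  obtain ⟨r₀, r₁, N, h₀, h₁, hN, e, b, he, hb, h⟩ := h
  obtain ⟨H, hH⟩ := SymExt.exists_tot_contraction (he.basis le_rfl) (hb.basis le_rfl) (F.dU V.1) hm
    (a.mem V) (a.closed V) N (fun j => by rw [IsFrame.basis_apply, resM_self]; exact h j)
  refine ⟨H, fun i hi n hn z hz => hH i hi n (le_trans ?_ hn) z hz⟩
  rw [Fintype.card_fin]
  exact_mod_cast Nat.add_le_add_right (Nat.add_le_add_right (Nat.mul_le_mul h₀ hN) m) 1

/-- Near `x` the base ideal contains `r e_j ^ N` with `r` not vanishing at `x`; shrinking to where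
`r` is a unit removes it. -/
theorem ClosedForm.Nondegenerate.exists_isGood {κ : Type u} [Field κ] [IsAlgClosed κ]
    (s : X ⟶ Spec (CommRingCat.of κ)) [LocallyOfFiniteType s] {a : F.ClosedForm m}
    (ha : a.Nondegenerate) {x : X} (hx : IsClosed ({x} : Set X)) :
    ∃ (V : X.affineOpens) (B : ℕ), x ∈ V.1 ∧ IsGood a B V := by
  obtain ⟨U, hxU, r₀, r₁, e, b, he, hb⟩ := F.exists_frames x
  obtain ⟨V, hxV, hV⟩ := exists_affine_nhd hxU
  have := isAlgClosed_residueField s hx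
  obtain ⟨r, N, hr, h⟩ := SymExt.exists_smul_pow_mem_baseIdeal (he.basis hV) (hb.basis hV)
    (X.evaluation V.1 x hxV).hom (evaluation_surjective s hx V.1 hxV) (F.dU V.1) (a.mem V)
    (ha V x hxV hx)
  obtain ⟨W', hxW', hW', hu⟩ := exists_isUnit_res hxV r hr
  obtain ⟨W, hxW, hWW'⟩ := exists_affine_nhd hxW'
  refine ⟨W, max (max r₀ r₁) N, hxW, r₀, r₁, N, (le_max_left _ _).trans (le_max_left _ _),
    (le_max_right _ _).trans (le_max_left _ _), le_max_right _ _, _, _,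
    he.res (hWW'.trans (hW'.trans hV)), hb.res (hWW'.trans (hW'.trans hV)), fun j => ?_⟩
  have h1 := symMap_res_mem_baseIdeal a (hWW'.trans hW') (hb.res hV) (h j)
  rw [Algebra.smul_def, map_mul, SymExt.symMap_algebraMap, map_pow, SymExt.symMap_ι,
    IsFrame.basis_apply, resM_resM] at h1
  have hu' : IsUnit (resO (hWW'.trans hW') r) := by
    rw [← resO_resO hW' hWW']
    exact hu.map _
  exact (Ideal.unit_mul_mem_iff_mem _ (hu'.map (algebraMap _ _))).mp h1

theorem ClosedForm.Nondegenerate.exists_isClassData {κ : Type u} [Field κ] [IsAlgClosed κ]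
    (s : X ⟶ Spec (CommRingCat.of κ)) [LocallyOfFiniteType s] [CompactSpace X]
    {a : F.ClosedForm m} (ha : a.Nondegenerate) (hm : 1 ≤ m) :
    ∃ b n₀ : ℤ, ∀ i : ℕ, i ≤ m → IsClassData (a.complex i) b n₀ := by
  obtain ⟨B, hB⟩ := exists_uniform_bound (IsGood a) (fun B V W hW h => h.mono hW)
    (fun B B' V hB h => h.mono_right hB) fun x hx => ha.exists_isGood s hx
  have h : ∀ (x : X) (U : X.Opens), x ∈ U → ∃ V : X.affineOpens, x ∈ V.1 ∧ V.1 ≤ U ∧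
      HasFrames F B V.1 ∧ HasContraction a ((B * B + m + 1 : ℕ) : ℤ) V := fun x U hx => by
    obtain ⟨V, hxV, hVU, hV⟩ := hB x U hx
    exact ⟨V, hxV, hVU, hV.hasFrames, hV.hasContraction hm⟩
  refine ⟨-B, ((B * B + m + 1 : ℕ) : ℤ), fun i hi => ⟨fun n => isVect_totSheaf F m i n,
    fun n hn => ?_, fun n hn => complex_exactAt h hi hn, fun n hn => isVect_cocyc_complex h hi hn⟩⟩
  refine isZero_totSheaf (fun x => ?_) (Int.natCast_nonneg i) hn
  obtain ⟨V, hxV, -, hV, -⟩ := h x ⊤ trivial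
  exact ⟨V.1, hxV, hV⟩

theorem ClosedForm.Nondegenerate.exists_hasClass {κ : Type u} [Field κ] [IsAlgClosed κ]
    (s : X ⟶ Spec (CommRingCat.of κ)) [LocallyOfFiniteType s] [CompactSpace X]
    {a : F.ClosedForm m} (ha : a.Nondegenerate) (hm : 1 ≤ m) {i : ℕ} (hi : i ≤ m) :
    ∃ c, HasClass (a.complex i) c := by
  obtain ⟨b, n₀, h⟩ := ha.exists_isClassData s hm
  exact ⟨_, hasClass_iff.mpr ⟨b, n₀, h i hi, rfl⟩⟩

/-- Quasi-isomorphic total complexes have the same Euler class. -/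
theorem Ke_eq_of_quasiIso {κ : Type u} [Field κ] [IsAlgClosed κ]
    (s : X ⟶ Spec (CommRingCat.of κ)) [LocallyOfFiniteType s] [CompactSpace X] {Φ : TwoTerm X}
    {α : Φ.ClosedForm m} {a : F.ClosedForm m} (hα : α.Nondegenerate) (ha : a.Nondegenerate)
    (hm : 1 ≤ m) (h : ∀ i : ℕ, i ≤ m → ∃ φ : α.complex i ⟶ a.complex i, QuasiIso φ) :
    a.Ke = α.Ke := by
  refine Finset.sum_congr rfl fun i hi => ?_
  have hi' : i ≤ m := Nat.lt_succ_iff.mp (Finset.mem_range.mp hi)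
  obtain ⟨φ, hφ⟩ := h i hi'
  obtain ⟨c, hc⟩ := ha.exists_hasClass s hm hi'
  obtain ⟨γ, hγ⟩ := hα.exists_hasClass s hm hi'
  rw [hc.cl_eq, hγ.cl_eq]
  exact (hγ.eq_of_quasiIso φ hc).symm

end TwoTerm

end AlgebraicGeometry.EulerK

/-- An alternating form in more arguments than there are basis vectors vanishes on every tuple of
basis vectors, as no such tuple is injective. -/
theorem SymExt.piece_eq_bot_of_card_lt {R M₀ M₁ ι₁ : Type*} [CommRing R] [AddCommGroup M₀]
    [Module R M₀] [AddCommGroup M₁] [Module R M₁] [Fintype ι₁] (b : Module.Basis ι₁ R M₁) {h k : ℤ}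
    (hk : (Fintype.card ι₁ : ℤ) < k) : piece R M₀ M₁ h k = ⊥ := by
  rw [piece, Submodule.span_eq_bot]
  rintro _ ⟨c, l, -, rfl, rfl⟩
  have h0 : ExteriorAlgebra.ιMulti R (M := M₁) l.length = 0 :=
    b.ext_alternating fun v hv => by
      have := Fintype.card_le_of_injective v hv
      rw [Fintype.card_fin] at this
      omega
  have h1 := congrArg (fun g => g l.get) h0
  simp only [ExteriorAlgebra.ιMulti_apply] at h1
  rw [mono, ← List.ofFn_get l, List.map_ofFn]
  exact (congrArg _ h1).trans (TensorProduct.tmul_zero _ _)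

/-! ### Quasi-isomorphisms of two-term complexes are local homotopy equivalences -/

section Cone

variable {R M₀ M₁ N₀ N₁ ι : Type*} [CommRing R]
  [AddCommGroup M₀] [Module R M₀] [AddCommGroup M₁] [Module R M₁]
  [AddCommGroup N₀] [Module R N₀] [AddCommGroup N₁] [Module R N₁]

/-- Exactness of the cone at its first two terms says that `M₁` is the fibre product of `M₀` and
`N₁` over `N₀`. This is its universal property. -/
theorem exists_lift_to_cone_kernel {L : Type*} [AddCommGroup L] [Module R L]
    (f₀ : M₀ →ₗ[R] N₀) (f₁ : M₁ →ₗ[R] N₁) (d : M₁ →ₗ[R] M₀) (d' : N₁ →ₗ[R] N₀)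
    (hinj : ∀ y, d y = 0 → f₁ y = 0 → y = 0)
    (hex : ∀ x w, f₀ x = d' w → ∃ y, d y = x ∧ f₁ y = w) (p : L →ₗ[R] M₀) (q : L →ₗ[R] N₁)
    (hpq : ∀ l, f₀ (p l) = d' (q l)) :
    ∃ g : L →ₗ[R] M₁, (∀ l, d (g l) = p l) ∧ ∀ l, f₁ (g l) = q l := by
  have hP : Function.Injective (d.prod f₁) := by
    refine (injective_iff_map_eq_zero _).mpr fun y hy => ?_
    exact hinj y (congrArg Prod.fst hy) (congrArg Prod.snd hy)
  choose g hg₁ hg₂ using fun l => hex _ _ (hpq l)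
  refine ⟨⟨⟨g, fun l l' => hP ?_⟩, fun r l => hP ?_⟩, hg₁, hg₂⟩
  · simp [hg₁, hg₂]
  · simp [hg₁, hg₂]

/-- A map of two-term complexes of modules whose cone is exact has a homotopy inverse, if the
target in degree zero is free. -/
theorem exists_homotopyInverse_of_exact_cone
    (f₀ : M₀ →ₗ[R] N₀) (f₁ : M₁ →ₗ[R] N₁) (d : M₁ →ₗ[R] M₀) (d' : N₁ →ₗ[R] N₀)
    (hf : ∀ b, f₀ (d b) = d' (f₁ b)) (e : Module.Basis ι R N₀)
    (hsurj : ∀ j, ∃ x w, f₀ x + d' w = e j)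
    (hinj : ∀ y, d y = 0 → f₁ y = 0 → y = 0)
    (hex : ∀ x w, f₀ x = d' w → ∃ y, d y = x ∧ f₁ y = w) :
    ∃ (g₀ : N₀ →ₗ[R] M₀) (g₁ : N₁ →ₗ[R] M₁) (σ : M₀ →ₗ[R] M₁) (σ' : N₀ →ₗ[R] N₁),
      (∀ b, g₀ (d' b) = d (g₁ b)) ∧ (∀ c, c = g₀ (f₀ c) + d (σ c)) ∧
      (∀ b, b = g₁ (f₁ b) + σ (d b)) ∧ (∀ c, c = f₀ (g₀ c) + d' (σ' c)) ∧
      (∀ b, b = f₁ (g₁ b) + σ' (d' b)) := by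
  -- Lifting the basis of `N₀` along `M₀ ⊕ N₁ → N₀` gives `g₀` and `σ'` together. The maps `g₁` and
  -- `σ` into `M₁` are then forced by the fibre product.
  choose x w hxw using hsurj
  let g₀ := e.constr ℕ x
  let σ' := e.constr ℕ w
  have h₀' : ∀ c, f₀ (g₀ c) + d' (σ' c) = c := by
    have : f₀ ∘ₗ g₀ + d' ∘ₗ σ' = LinearMap.id := e.ext fun j => by
      simp only [LinearMap.add_apply, LinearMap.comp_apply, g₀, σ', Module.Basis.constr_basis, hxw,
        LinearMap.id_apply]
    exact LinearMap.congr_fun this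
  obtain ⟨g₁, hg₁, hg₁'⟩ := exists_lift_to_cone_kernel f₀ f₁ d d' hinj hex (g₀ ∘ₗ d')
    (LinearMap.id - σ' ∘ₗ d') fun l => by
      simp only [LinearMap.comp_apply, LinearMap.sub_apply, LinearMap.id_apply, map_sub]
      exact eq_sub_of_add_eq (h₀' (d' l))
  obtain ⟨σ, hσ, hσ'⟩ := exists_lift_to_cone_kernel f₀ f₁ d d' hinj hex
    (LinearMap.id - g₀ ∘ₗ f₀) (σ' ∘ₗ f₀) fun l => by
      simp only [LinearMap.comp_apply, LinearMap.sub_apply, LinearMap.id_apply, map_sub]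
      exact sub_eq_of_eq_add' (h₀' (f₀ l)).symm
  simp only [LinearMap.comp_apply, LinearMap.sub_apply, LinearMap.id_apply] at hg₁ hg₁' hσ hσ'
  refine ⟨g₀, g₁, σ, σ', fun b => (hg₁ b).symm, fun c => by rw [hσ]; abel, fun b => ?_,
    fun c => (h₀' c).symm, fun b => by rw [hg₁']; abel⟩
  refine sub_eq_zero.mp (hinj _ ?_ ?_)
  · rw [map_sub, map_add, hg₁, hσ, ← hf]; abel
  · rw [map_sub, map_add, hg₁', hσ', ← hf]; abel

end Cone

namespace AlgebraicGeometry.EulerK.TwoTerm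

variable {X : Scheme.{u}} {Φ F : TwoTerm X}

namespace Hom

variable {f : TwoTerm.Hom Φ F}

theorem IsQuasiIso.eq_zero (hf : f.IsQuasiIso) {U : X.Opens} {y : Γ(Φ.F₁, U)}
    (hy : Φ.dU U y = 0) (hy' : onSections f.f₁ U y = 0) : y = 0 := by
  have := hf.1
  obtain ⟨k, rfl⟩ := exists_kernel_section Φ.d y hy
  have h1 : onSections (kernel.map Φ.d F.d f.f₁ f.f₀ f.comm.symm) U k = 0 := by
    apply onSections_injective (kernel.ι F.d) U
    rw [map_zero, ← onSections_comp, kernel.lift_ι, onSections_comp, hy']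
  rw [onSections_injective _ U (h1.trans (map_zero _).symm), map_zero]

theorem IsQuasiIso.exists_cycle (hf : f.IsQuasiIso) {U : X.Opens} {w : Γ(F.F₁, U)}
    (hw : F.dU U w = 0) : ∃ y, Φ.dU U y = 0 ∧ onSections f.f₁ U y = w := by
  have := hf.1
  obtain ⟨k, rfl⟩ := exists_kernel_section F.d w hw
  let φ := kernel.map Φ.d F.d f.f₁ f.f₀ f.comm.symm
  refine ⟨onSections (kernel.ι Φ.d) U (onSections (inv φ) U k), onSections_kernel_ι _ _, ?_⟩
  have h1 : inv φ ≫ kernel.ι Φ.d ≫ f.f₁ = kernel.ι F.d := by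
    rw [IsIso.inv_comp_eq]
    exact (kernel.lift_ι _ _ _).symm
  rw [← onSections_comp, ← onSections_comp, h1]

/-- Already on sections `Φ₁` is the fibre product of `Φ₀` and `F₁` over `F₀`: injectivity on
cokernels gives a preimage of `x` locally, surjectivity on kernels corrects it to match `w`, and
uniqueness (`eq_zero`) glues. -/
theorem IsQuasiIso.exists_unique_local (hf : f.IsQuasiIso) {U : X.Opens} {x : Γ(Φ.F₀, U)}
    {w : Γ(F.F₁, U)} (h : onSections f.f₀ U x = F.dU U w) :
    ∃ y, Φ.dU U y = x ∧ onSections f.f₁ U y = w := by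
  have := hf.2
  have h0 : onSections (cokernel.π Φ.d) U x = 0 := by
    apply onSections_injective (cokernel.map Φ.d F.d f.f₁ f.f₀ f.comm.symm) U
    rw [map_zero, ← onSections_comp, cokernel.π_desc, onSections_comp, h, dU, ← onSections_comp,
      cokernel.condition]
    rfl
  have hS : (ShortComplex.mk Φ.d (cokernel.π Φ.d) (cokernel.condition _)).Exact :=
    ShortComplex.exact_of_g_is_cokernel _ (cokernelIsCokernel Φ.d)
  have hloc : ∀ p : U, ∃ (V : X.Opens) (_ : p.1 ∈ V) (hV : V ≤ U) (y : Γ(Φ.F₁, V)),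
      Φ.dU V y = resM _ hV x ∧ onSections f.f₁ V y = resM _ hV w := by
    rintro ⟨p, hp⟩
    obtain ⟨V, hpV, hV, y, hy⟩ := exists_section_of_exact' hS x h0 p hp
    have hy : Φ.dU V y = resM _ hV x := hy
    obtain ⟨y', hy', hy''⟩ := hf.exists_cycle (w := resM _ hV w - onSections f.f₁ V y) (by
      rw [map_sub, ← resM_onSections, ← h, ← f.onSections_comm, hy, resM_onSections, sub_self])
    refine ⟨V, hpV, hV, y + y', ?_, ?_⟩
    · rw [map_add, hy, hy', add_zero]
    · rw [map_add, hy'']; abel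
  choose V hpV hV y hy hy' using hloc
  obtain ⟨t, ht⟩ := section_glue (M := Φ.F₁) V hV (fun p hp => ⟨⟨p, hp⟩, hpV _⟩) y
    fun p q W hp hq => sub_eq_zero.mp <| hf.eq_zero (by
      rw [map_sub, ← resM_onSections, ← resM_onSections, hy, hy, resM_resM, resM_resM, sub_self])
      (by rw [map_sub, ← resM_onSections, ← resM_onSections, hy', hy', resM_resM, resM_resM,
        sub_self])
  refine ⟨t, section_ext fun p hp => ⟨V ⟨p, hp⟩, hpV _, hV _, ?_⟩,
    section_ext fun p hp => ⟨V ⟨p, hp⟩, hpV _, hV _, ?_⟩⟩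
  · rw [resM_onSections, ht, hy]
  · rw [resM_onSections, ht, hy']

/-- Surjectivity on cokernels: a map that vanishes on the images of `f₀` and of `d` factors through
the cokernel of `d` and vanishes there. -/
theorem IsQuasiIso.epi (hf : f.IsQuasiIso) : Epi (biprod.desc f.f₀ F.d) := by
  have := hf.2
  refine Preadditive.epi_of_cancel_zero _ fun {P} g hg => ?_
  have h₀ : f.f₀ ≫ g = 0 := by rw [← biprod.inl_desc_assoc f.f₀ F.d, hg, comp_zero]
  have h₁ : F.d ≫ g = 0 := by rw [← biprod.inr_desc_assoc f.f₀ F.d, hg, comp_zero]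
  rw [← cokernel.π_desc F.d g h₁]
  have h2 : cokernel.map Φ.d F.d f.f₁ f.f₀ f.comm.symm ≫ cokernel.desc F.d g h₁ = 0 := by
    rw [← cancel_epi (cokernel.π Φ.d), cokernel.π_desc_assoc, Category.assoc, cokernel.π_desc, h₀,
      comp_zero]
  rw [zero_of_epi_comp _ h2, comp_zero]

/-- Near every point a quasi-isomorphism has a homotopy inverse. -/
theorem IsQuasiIso.exists_homotopyInverse (hf : f.IsQuasiIso) {U : X.Opens} {r : ℕ}
    {e : Fin r → Γ(F.F₀, U)} (he : IsFrame e) {x : X} (hx : x ∈ U) :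
    ∃ (V : X.Opens) (_ : x ∈ V) (_ : V ≤ U), ∀ W ≤ V,
      ∃ (g₀ : Γ(F.F₀, W) →ₗ[Γ(X, W)] Γ(Φ.F₀, W)) (g₁ : Γ(F.F₁, W) →ₗ[Γ(X, W)] Γ(Φ.F₁, W))
        (σ : Γ(Φ.F₀, W) →ₗ[Γ(X, W)] Γ(Φ.F₁, W)) (σ' : Γ(F.F₀, W) →ₗ[Γ(X, W)] Γ(F.F₁, W)),
      (∀ b, g₀ (F.dU W b) = Φ.dU W (g₁ b)) ∧ (∀ c, c = g₀ (onSections f.f₀ W c) + Φ.dU W (σ c)) ∧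
      (∀ b, b = g₁ (onSections f.f₁ W b) + σ (Φ.dU W b)) ∧
      (∀ c, c = onSections f.f₀ W (g₀ c) + F.dU W (σ' c)) ∧
      (∀ b, b = onSections f.f₁ W (g₁ b) + σ' (F.dU W b)) := by
  have := hf.epi
  obtain ⟨V, hxV, hV, s, hs⟩ := exists_lift_family (biprod.desc f.f₀ F.d) e hx
  refine ⟨V, hxV, hV, fun W hW => ?_⟩
  refine exists_homotopyInverse_of_exact_cone (onSections f.f₀ W) (onSections f.f₁ W) (Φ.dU W)
    (F.dU W) (f.onSections_comm W) (he.basis (hW.trans hV)) (fun j => ?_)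
    (fun y => hf.eq_zero) (fun x w => hf.exists_unique_local)
  refine ⟨onSections biprod.fst W (resM _ hW (s j)), onSections biprod.snd W (resM _ hW (s j)), ?_⟩
  rw [dU, ← onSections_comp, ← onSections_comp, ← onSections_add, ← biprod.desc_eq,
    ← resM_onSections, hs, resM_resM, IsFrame.basis_apply]

/-- Exactness of the cone is local. Near a point there are frames and a homotopy inverse, so the
algebraic comparison of Koszul homology and then of total homology applies; the ranks of the
degree-one terms bound the exterior degree. -/
theorem IsQuasiIso.quasiIso_total {κ : Type u} [Field κ] [CharZero κ]
    (s : X ⟶ Spec (CommRingCat.of κ)) (hf : f.IsQuasiIso) {m : ℕ} (α : Φ.ClosedForm m)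
    (a : F.ClosedForm m) (h : f.push α.toSection = a.toSection) (i : ℤ) :
    QuasiIso (f.total α a h i) := by
  refine quasiIso_of_onSections _ fun n U y z hy hz x hx => ?_
  obtain ⟨U₁, hxU₁, r₀, r₁, e, b, he, hb⟩ := F.exists_frames x
  obtain ⟨U₂, hxU₂, ρ₀, ρ₁, ε, β, hε, hβ⟩ := Φ.exists_frames x
  obtain ⟨U₃, hxU₃, hU₃, hinv⟩ := hf.exists_homotopyInverse he hxU₁
  obtain ⟨V, hxV, hV⟩ := exists_affine_nhd (U := (U₃ ⊓ U₂) ⊓ U) ⟨⟨hxU₃, hxU₂⟩, hx⟩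
  have hVU : V.1 ≤ U := hV.trans inf_le_right
  have hVU₃ : V.1 ≤ U₃ := hV.trans (inf_le_left.trans inf_le_left)
  have hVU₂ : V.1 ≤ U₂ := hV.trans (inf_le_left.trans inf_le_right)
  have hVU₁ : V.1 ≤ U₁ := hVU₃.trans hU₃
  obtain ⟨g₀, g₁, σ, σ', hg, h₀, h₁, h₀', h₁'⟩ := hinv V.1 hVU₃
  obtain ⟨y₀, hy₀⟩ := (secOf_bijective (m := m) (i := i) (n := n + 1) hε hβ hVU₂).2
    (resM _ hVU y : Γ(Φ.totSheaf m i (n + 1), V.1))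
  obtain ⟨z₀, hz₀⟩ := (secOf_bijective (m := m) (i := i) (n := n) he hb hVU₁).2
    (resM _ hVU z : Γ(F.totSheaf m i n, V.1))
  have hval : SymExt.map (RingHom.id _) (onSections f.f₀ V.1) (onSections f.f₁ V.1) (α.val V) =
      a.val V := congrArg (fun s : F.Section m 1 => s.val V) h
  have hDy : SymExt.totD (Φ.dU V.1) (α.val V) y₀ = 0 := by
    have e1 := onSections_complex_d (i := i) α (by ring : (n + 1) + 1 = n + 2) V y₀
    have e2 : onSections ((α.complex i).d (n + 1) (n + 2)) V.1 (secOf Φ m i (n + 1) V.1 y₀) = 0 := by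
      refine (congrArg (onSections ((α.complex i).d (n + 1) (n + 2)) V.1) hy₀).trans ?_
      refine (resM_onSections ((α.complex i).d (n + 1) (n + 2)) hVU y).symm.trans ?_
      rw [hy, map_zero]
    exact congrArg Subtype.val
      ((secOf_bijective hε hβ hVU₂).1 ((e1.symm.trans e2).trans (map_zero _).symm))
  have hDz : SymExt.totD (F.dU V.1) (a.val V) z₀ =
      SymExt.map (RingHom.id _) (onSections f.f₀ V.1) (onSections f.f₁ V.1) y₀ := by
    have e1 := onSections_complex_d (i := i) a (rfl : n + 1 = n + 1) V z₀
    have e2 : onSections ((a.complex i).d n (n + 1)) V.1 (secOf F m i n V.1 z₀) =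
        onSections ((f.total α a h i).f (n + 1)) V.1 (secOf Φ m i (n + 1) V.1 y₀) := by
      refine (congrArg (onSections ((a.complex i).d n (n + 1)) V.1) hz₀).trans ?_
      refine (resM_onSections ((a.complex i).d n (n + 1)) hVU z).symm.trans ?_
      rw [hz, resM_onSections]
      exact (congrArg (onSections ((f.total α a h i).f (n + 1)) V.1) hy₀).symm
    have e3 := onSections_sheafMap f.affMap (m := m) (i := i) (n := n + 1) f.affMap_mem V y₀
    exact congrArg Subtype.val
      ((secOf_bijective he hb hVU₁).1 ((e1.symm.trans e2).trans e3))
  obtain ⟨y', hy', z', hz', hyy, hzz⟩ := SymExt.exists_totD_of_koszul (onSections f.f₀ V.1)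
    (onSections f.f₁ V.1) (Φ.dU V.1) (F.dU V.1) (f.onSections_comm V.1) (α.mem V) (α.closed V)
    (fun y z => SymExt.koszul_cone_exact (isUnit_natCast s V.1) (onSections f.f₀ V.1)
    (onSections f.f₁ V.1) (Φ.dU V.1) (F.dU V.1) (f.onSections_comm V.1) g₀ g₁ hg σ σ' h₀ h₁ h₀' h₁'
    y z) (max r₁ ρ₁) (fun h k hk => ⟨SymExt.piece_eq_bot_of_card_lt (hβ.basis hVU₂) (by rw [Fintype.card_fin]; omega),
      SymExt.piece_eq_bot_of_card_lt (hb.basis hVU₁) (by rw [Fintype.card_fin]; omega)⟩) y₀.2 z₀.2 hDy (by rw [hval]; exact hDz)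
  refine ⟨V.1, hxV, hVU, secOf Φ m i n V.1 ⟨y', hy'⟩, secOf F m i (n - 1) V.1 ⟨z', hz'⟩, ?_, ?_⟩
  · refine (onSections_complex_d α rfl V _).trans (Eq.trans ?_ hy₀)
    exact congrArg _ (Subtype.ext hyy.symm)
  · refine Eq.trans ?_ hz₀
    refine (congrArg₂ (fun s t : Γ(F.totSheaf m i n, V.1) => s + t)
      (onSections_sheafMap f.affMap f.affMap_mem V _)
      (onSections_complex_d a (sub_add_cancel n 1) V ⟨z', hz'⟩)).trans ?_
    refine (map_add _ _ _).symm.trans (congrArg _ (Subtype.ext ?_))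
    rw [hval] at hzz
    exact hzz.symm

end Hom

end AlgebraicGeometry.EulerK.TwoTerm

/-! ### Exponentials of homotopies -/

namespace SymExt

variable {R M₀ M₁ : Type*} [CommRing R] [AddCommGroup M₀] [Module R M₀]
  [AddCommGroup M₁] [Module R M₁]

theorem piece_two_induction {h : ℤ} (motive : SymExt R M₀ M₁ → Prop) (h0 : motive 0)
    (hadd : ∀ x y, motive x → motive y → motive (x + y))
    (hsmul : ∀ (r : R) x, motive x → motive (r • x))
    (hmono : ∀ (c : List M₀) (b b' : M₁), motive (mono c [b, b']))
    {x : SymExt R M₀ M₁} (hx : x ∈ piece R M₀ M₁ h 2) : motive x := by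
  induction hx using Submodule.span_induction with
  | mem x h =>
    obtain ⟨c, b, -, hb, rfl⟩ := h
    have hb' : b.length = 2 := by exact_mod_cast hb
    obtain ⟨b, b', rfl⟩ := List.length_eq_two.mp hb'
    exact hmono c b b'
  | zero => exact h0
  | add x y _ _ h1 h2 => exact hadd _ _ h1 h2
  | smul r x _ h => exact hsmul _ _ h

/-- Elements of even exterior degree are central; it suffices to move an odd generator past two
others. -/
theorem commute_of_mem_piece_two {h : ℤ} {x : SymExt R M₀ M₁} (hx : x ∈ piece R M₀ M₁ h 2)
    (y : SymExt R M₀ M₁) : Commute x y := by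
  refine piece_two_induction (fun x => Commute x y) (Commute.zero_left y)
    (fun _ _ h1 h2 => h1.add_left h2) (fun r _ h1 => h1.smul_left r) (fun c b b' => ?_) hx
  have hι : ∀ b'' : M₁, Commute (mono c [b, b'] : SymExt R M₀ M₁)
      (1 ⊗ₜ[R] ExteriorAlgebra.ι R b'') := fun b'' => by
    have : ExteriorAlgebra.ι R b * (ExteriorAlgebra.ι R b' * ExteriorAlgebra.ι R b'') =
        ExteriorAlgebra.ι R b'' * (ExteriorAlgebra.ι R b * ExteriorAlgebra.ι R b') := by
      rw [ι_mul_ι b' b'', mul_neg, ← mul_assoc, ι_mul_ι b b'', neg_mul, neg_neg, mul_assoc]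
    rw [commute_iff_eq, mono, Algebra.TensorProduct.tmul_mul_tmul,
      Algebra.TensorProduct.tmul_mul_tmul, mul_one, one_mul]
    simp only [List.map_cons, List.map_nil, List.prod_cons, List.prod_nil, mul_one, mul_assoc, this]
  induction y using mono_induction with
  | h0 => exact Commute.zero_right _
  | hadd x y h1 h2 => exact h1.add_right h2
  | hsmul r x h1 => exact h1.smul_right r
  | hmono c' l =>
    induction l with
    | nil =>
      have : (mono c' [] : SymExt R M₀ M₁) = (c'.map (SymmetricAlgebra.ι R M₀)).prod ⊗ₜ[R] 1 := by
        simp [mono]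
      rw [this]
      exact (sym_comm _ _).symm
    | cons b'' l ih =>
      rw [mono_cons c' b'' l]
      exact (hι b'').mul_right ih

theorem koszul_mul_of_mem_piece_two (d : M₁ →ₗ[R] M₀) {h : ℤ} {x : SymExt R M₀ M₁}
    (hx : x ∈ piece R M₀ M₁ h 2) (y : SymExt R M₀ M₁) :
    koszul d (x * y) = koszul d x * y + x * koszul d y := by
  refine piece_two_induction (fun x => koszul d (x * y) = koszul d x * y + x * koszul d y)
    (by simp) (fun x y h1 h2 => ?_) (fun r x h1 => ?_) (fun c b b' => ?_) hx
  · simp only [add_mul, map_add, h1, h2]; abel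
  · simp only [smul_mul_assoc, map_smul, h1, smul_add]
  · have h1 : (mono c [b] : SymExt R M₀ M₁) ∈ piece R M₀ M₁ c.length 1 := mono_mem c [b]
    have h2 : (mono [] [b'] : SymExt R M₀ M₁) ∈ piece R M₀ M₁ 0 1 := mono_mem [] [b']
    have h3 : (mono c [b, b'] : SymExt R M₀ M₁) = mono c [b] * mono [] [b'] := by
      rw [mono_mul, List.append_nil]; rfl
    rw [h3, mul_assoc, koszul_mul d h1, koszul_mul d h2, koszul_mul d h1]
    simp only [sub_mul, mul_sub, mul_assoc]
    abel

/-- The commutator of `D` with `h` is multiplication by `d h = a - a'`. The form `c` in `D` plays no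
role because `h` is central. -/
theorem totD_mul_of_mem_piece_two (d : M₁ →ₗ[R] M₀) {k : ℤ} {a a' h : SymExt R M₀ M₁}
    (hh : h ∈ piece R M₀ M₁ k 2) (hd : koszul d h = a - a') (c x : SymExt R M₀ M₁) :
    totD d c (h * x) = h * totD d c x + (totD d a x - totD d a' x) := by
  simp only [totD_apply]
  rw [koszul_mul_of_mem_piece_two d hh, hd, ← mul_assoc c h x,
    ← (commute_of_mem_piece_two hh c).eq]
  simp only [mul_add, sub_mul, mul_assoc]
  abel

theorem pow_mem_piece {h k : ℤ} {x : SymExt R M₀ M₁} (hx : x ∈ piece R M₀ M₁ h k) (j : ℕ) :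
    x ^ j ∈ piece R M₀ M₁ (j * h) (j * k) := by
  induction j with
  | zero =>
    rw [pow_zero]
    refine Submodule.subset_span ⟨[], [], by simp, by simp, ?_⟩
    simp [mono, Algebra.TensorProduct.one_def]
  | succ j ih =>
    rw [pow_succ]
    have := mul_mem_piece ih hx
    convert this using 2 <;> push_cast <;> ring

end SymExt

theorem commute_inverse_left {R : Type*} [MonoidWithZero R] {a b : R} (h : Commute a b) :
    Commute (Ring.inverse a) b := by
  by_cases ha : IsUnit a
  · obtain ⟨u, rfl⟩ := ha
    rw [Ring.inverse_unit]
    exact h.units_inv_left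
  · rw [Ring.inverse_non_unit _ ha]
    exact Commute.zero_left b

section Exp

variable {C : Type*} [Category* C] [Preadditive C] {A B : C}

/-- Identities between divided powers can be checked after multiplication by factorials. -/
theorem nsmul_hom_injective {k : ℕ} (hk : IsUnit (k : End A)) :
    Function.Injective fun φ : A ⟶ B => k • φ := by
  intro φ ψ h
  obtain ⟨u, hu⟩ := hk
  have e : ∀ φ : A ⟶ B, (u⁻¹.val : A ⟶ A) ≫ (k • φ) = φ := fun φ => by
    have h1 : k • φ = (show A ⟶ A from u.val) ≫ φ := by
      have : (show A ⟶ A from u.val) = k • 𝟙 A := by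
        rw [hu, ← nsmul_one]; rfl
      rw [this, Preadditive.nsmul_comp, Category.id_comp]
    rw [h1, ← Category.assoc]
    have h2 : (u⁻¹.val : A ⟶ A) ≫ (show A ⟶ A from u.val) = 𝟙 A := u.mul_inv
    rw [h2, Category.id_comp]
  rw [← e φ, ← e ψ]
  exact congrArg _ h

/-- The terms of the exponential series intertwine, up to a shift. -/
theorem dividedPow_comp (hA : ∀ k : ℕ, k ≠ 0 → IsUnit (k : End A))
    (γA : ℕ → (A ⟶ A)) (γB : ℕ → (B ⟶ B)) (gA : End A) (gB : End B)
    (hγA : ∀ j, j.factorial • γA j = (gA ^ j : End A))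
    (hγB : ∀ j, j.factorial • γB j = (gB ^ j : End B)) (D Δ : A ⟶ B)
    (hD : (gA : A ⟶ A) ≫ D = D ≫ (gB : B ⟶ B) - Δ)
    (hΔ : (gA : A ⟶ A) ≫ Δ = Δ ≫ (gB : B ⟶ B)) (j : ℕ) :
    γA (j + 1) ≫ D = D ≫ γB (j + 1) - Δ ≫ γB j := by
  have hpow : ∀ j : ℕ, (gA ^ (j + 1) : End A) ≫ D =
      D ≫ (gB ^ (j + 1) : End B) - (j + 1) • (Δ ≫ (gB ^ j : End B)) := by
    intro j
    induction j with
    | zero =>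
      have : (gB ^ 0 : End B) = 𝟙 B := pow_zero gB
      rw [this, zero_add, pow_one, pow_one, one_smul, Category.comp_id, hD]
    | succ j ih =>
      have e1 : (gA ^ (j + 1 + 1) : End A) = (gA : A ⟶ A) ≫ (gA ^ (j + 1) : End A) := pow_succ _ _
      have e2 : ∀ j, (gB ^ (j + 1) : End B) = (gB : B ⟶ B) ≫ (gB ^ j : End B) := fun j =>
        pow_succ _ _
      rw [e1, Category.assoc, ih, Preadditive.comp_sub, Preadditive.comp_nsmul, ← Category.assoc,
        hD, ← Category.assoc (gA : A ⟶ A), hΔ, Category.assoc Δ, ← e2, Preadditive.sub_comp,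
        Category.assoc D, ← e2 (j + 1), succ_nsmul _ (j + 1)]
      abel
  apply nsmul_hom_injective (hA _ (Nat.factorial_ne_zero (j + 1)))
  dsimp only
  have e1 : (j + 1).factorial • (D ≫ γB (j + 1)) = D ≫ (gB ^ (j + 1) : End B) := by
    rw [← Preadditive.comp_nsmul, hγB]
  have e2 : (j + 1).factorial • (Δ ≫ γB j) = (j + 1) • (Δ ≫ (gB ^ j : End B)) := by
    rw [Nat.factorial_succ, mul_smul, ← Preadditive.comp_nsmul, hγB]
  rw [← Preadditive.nsmul_comp, hγA, hpow, smul_sub, e1, e2]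

end Exp

namespace AlgebraicGeometry.EulerK

variable {X : Scheme.{u}} {M N : X.Modules}

theorem expEnd_eq_sum {g : End M} {N : ℕ} (hN : g ^ N = 0) :
    expEnd g = ∑ j ∈ Finset.range N, Ring.inverse ((j.factorial : ℕ) : End M) * g ^ j := by
  have hg : IsNilpotent g := ⟨N, hN⟩
  refine Finset.sum_subset (fun j hj => ?_) fun j _ hj => ?_
  · rw [Finset.mem_range] at hj ⊢
    exact hj.trans_le (Nat.sInf_le hN)
  · rw [Finset.mem_range, not_lt] at hj
    rw [pow_eq_zero_of_le hj (pow_nilpotencyClass hg), mul_zero]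

/-- The exponential of a nilpotent element is `1` plus a nilpotent element. -/
theorem isUnit_expEnd {g : End M} (hg : IsNilpotent g) : IsUnit (expEnd g) := by
  obtain ⟨N, hN⟩ := hg
  rw [expEnd_eq_sum (pow_eq_zero_of_le (Nat.le_succ N) hN), Finset.sum_range_succ', Nat.factorial_zero,
    Nat.cast_one, Ring.inverse_one, pow_zero, one_mul]
  refine IsNilpotent.isUnit_add_one ?_
  simp only [pow_succ, ← mul_assoc]
  rw [← Finset.sum_mul]
  refine Commute.isNilpotent_mul_left ?_ ⟨N, hN⟩
  refine Commute.sum_left _ _ _ fun j _ => ?_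
  exact (commute_inverse_left (Nat.cast_commute _ _)).mul_left (Commute.pow_self g j)

/-- Exponentials intertwine `D` and `D - Δ`. -/
theorem expEnd_comp (hM : ∀ k : ℕ, k ≠ 0 → IsUnit (k : End M))
    (hN : ∀ k : ℕ, k ≠ 0 → IsUnit (k : End N)) {g : End M} {g' : End N} (hg : IsNilpotent g)
    (hg' : IsNilpotent g') (D Δ : M ⟶ N) (hD : (g : M ⟶ M) ≫ D = D ≫ (g' : N ⟶ N) - Δ)
    (hΔ : (g : M ⟶ M) ≫ Δ = Δ ≫ (g' : N ⟶ N)) :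
    (expEnd g : M ⟶ M) ≫ D = (D - Δ) ≫ (expEnd g' : N ⟶ N) := by
  obtain ⟨n, hn⟩ := hg
  obtain ⟨n', hn'⟩ := hg'
  let γ (M : X.Modules) (g : End M) (j : ℕ) : M ⟶ M :=
    Ring.inverse ((j.factorial : ℕ) : End M) * g ^ j
  have hγ : ∀ (M : X.Modules) (_ : ∀ k : ℕ, k ≠ 0 → IsUnit (k : End M)) (g : End M) (j : ℕ),
      j.factorial • γ M g j = (g ^ j : End M) := fun M hM g j => by
    refine (nsmul_eq_mul (α := End M) _ _).trans ?_
    exact Ring.mul_inverse_cancel_left _ _ (hM _ (Nat.factorial_ne_zero j))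
  have h0 : ∀ (M : X.Modules) (g : End M), γ M g 0 = 𝟙 M := fun M g => by
    change Ring.inverse ((Nat.factorial 0 : ℕ) : End M) * g ^ 0 = 1
    rw [Nat.factorial_zero, Nat.cast_one, Ring.inverse_one, pow_zero, one_mul]
  have key := dividedPow_comp hM (γ M g) (γ N g') g g' (hγ M hM g) (hγ N hN g') D Δ hD hΔ
  have e1 : expEnd g = ∑ j ∈ Finset.range (max n n' + 1), γ M g j :=
    expEnd_eq_sum (pow_eq_zero_of_le (by omega) hn)
  have e2 : expEnd g' = ∑ j ∈ Finset.range (max n n' + 1), γ N g' j :=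
    expEnd_eq_sum (pow_eq_zero_of_le (by omega) hn')
  -- The shift in `dividedPow_comp` pairs `Δ` with one term fewer, so the exponential is written
  -- with two lengths.
  have e3 : expEnd g' = ∑ j ∈ Finset.range (max n n'), γ N g' j :=
    expEnd_eq_sum (pow_eq_zero_of_le (by omega) hn')
  rw [Preadditive.sub_comp]
  nth_rw 2 [e3]
  rw [e1, e2, Preadditive.sum_comp, Finset.sum_range_succ', Finset.sum_range_succ', h0, h0,
    Preadditive.comp_add, Preadditive.comp_sum, Preadditive.comp_sum, Category.id_comp,
    Category.comp_id]
  simp only [key, Finset.sum_sub_distrib]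
  abel

theorem onSections_natCast (k : ℕ) (U : X.Opens) (x : Γ(M, U)) :
    onSections ((k : End M) : M ⟶ M) U x = (k : Γ(X, U)) • x := by
  induction k with
  | zero =>
    rw [Nat.cast_zero, Nat.cast_zero, zero_smul]
    rfl
  | succ k ih =>
    rw [Nat.cast_succ, Nat.cast_succ, add_smul, one_smul, ← ih]
    rfl

theorem isUnit_natCast_end {κ : Type u} [Field κ] [CharZero κ]
    (s : X ⟶ Spec (CommRingCat.of κ)) (M : X.Modules) (k : ℕ) (hk : k ≠ 0) :
    IsUnit (k : End M) := by
  rw [isUnit_iff_isIso]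
  refine isIso_of_onSections _ (fun U t ht => ?_) fun U t x hx => ⟨U, hx, le_rfl, ?_⟩
  · rw [onSections_natCast] at ht
    exact (isUnit_natCast s U k hk).smul_eq_zero.mp ht
  · obtain ⟨u, hu⟩ := isUnit_natCast s U k hk
    refine ⟨u⁻¹.val • t, ?_⟩
    rw [onSections_natCast, ← hu, smul_smul, Units.mul_inv, one_smul, resM_self]

namespace TwoTerm

variable {F : TwoTerm X} {m : ℕ} {i n : ℤ}

/-- Morphisms from `K_i^n` are determined by their values on small affine open subsets. -/
theorem totSheaf_hom_ext {B : ℕ} (hB : ∀ (x : X) (U : X.Opens), x ∈ U → ∃ V : X.affineOpens, x ∈ V.1 ∧ V.1 ≤ U ∧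
      HasFrames F B V.1) {φ ψ : F.totSheaf m i n ⟶ M}
    (h : ∀ (V : X.affineOpens) (z : F.totU m i n V.1), HasFrames F B V.1 →
      onSections φ V.1 (secOf F m i n V.1 z) = onSections ψ V.1 (secOf F m i n V.1 z)) : φ = ψ := by
  ext U t
  refine section_ext fun x hx => ?_
  obtain ⟨V₀, hxV₀, -, hV₀⟩ := hB x ⊤ trivial
  obtain ⟨V, hxV, hVU, hV, z, hz⟩ := exists_secOf_eq_of_le t hx V₀.1 hxV₀
  refine ⟨V.1, hxV, hVU, ?_⟩
  change resM M hVU (onSections φ U t) = resM M hVU (onSections ψ U t)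
  rw [resM_onSections, resM_onSections, ← hz]
  exact h V z (hV₀.mono hV)

theorem onSections_tilde (h : F.Section ((m : ℤ) - 1) 2) (V : X.affineOpens)
    (z : F.totU m i n V.1) :
    onSections (h.tilde i n) V.1 (secOf F m i n V.1 z) = secOf F m i n V.1
      ⟨h.val V * z.1, SymExt.mul_mem_tot (-1) 1 (by ring) (by ring) (by ring) (h.mem V) z.2⟩ :=
  onSections_sheafMap h.mul _ V z

theorem onSections_tilde_pow (h : F.Section ((m : ℤ) - 1) 2) (V : X.affineOpens)
    (z : F.totU m i n V.1) (j : ℕ) :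
    ∃ w : F.totU m i n V.1, w.1 = h.val V ^ j * z.1 ∧
      onSections (h.tilde i n ^ j : End _) V.1 (secOf F m i n V.1 z) = secOf F m i n V.1 w := by
  induction j with
  | zero => exact ⟨z, by rw [pow_zero, one_mul], rfl⟩
  | succ j ih =>
    obtain ⟨w, hw, e⟩ := ih
    refine ⟨⟨h.val V * w.1, SymExt.mul_mem_tot (-1) 1 (by ring) (by ring) (by ring) (h.mem V) w.2⟩,
      by dsimp only; rw [hw, pow_succ', mul_assoc], ?_⟩
    rw [pow_succ']
    refine (congrArg (onSections (h.tilde i n) V.1) e).trans ?_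
    exact onSections_tilde h V w

/-- `h ^ (B + 1)` has exterior degree `2(B + 1)`, larger than the rank of `F₁` wherever that rank is
at most `B`; quasi-compactness provides a uniform `B`. -/
theorem isNilpotent_tilde [CompactSpace X] (h : F.Section ((m : ℤ) - 1) 2) (i n : ℤ) :
    IsNilpotent (h.tilde i n) := by
  obtain ⟨B, hB⟩ := F.exists_hasFrames
  refine ⟨B + 1, totSheaf_hom_ext hB fun V z hV => ?_⟩
  obtain ⟨r₀, r₁, -, h₁, e, b, he, hb⟩ := hV
  obtain ⟨w, hw, e⟩ := onSections_tilde_pow h V z (B + 1)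
  have h0 : h.val V ^ (B + 1) = 0 := by
    have := SymExt.pow_mem_piece (h.mem V) (B + 1)
    rwa [SymExt.piece_eq_bot_of_card_lt (hb.basis le_rfl) (by rw [Fintype.card_fin]; push_cast; omega),
      Submodule.mem_bot] at this
  have hw0 : w = 0 := Subtype.ext (by rw [hw, h0, zero_mul]; rfl)
  rw [e, hw0, map_zero]
  rfl

/-- The differential of the total complex. -/
noncomputable def ClosedForm.dTot (a : F.ClosedForm m) (i n : ℤ) :
    F.totSheaf m i n ⟶ F.totSheaf m i (n + 1) :=
  (a.complex i).d n (n + 1)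

theorem onSections_dTot (a : F.ClosedForm m) (V : X.affineOpens) (z : F.totU m i n V.1) :
    onSections (a.dTot i n) V.1 (secOf F m i n V.1 z) = secOf F m i (n + 1) V.1
      ⟨SymExt.totD (F.dU V.1) (a.val V) z, SymExt.totD_mem_tot (F.dU V.1) (a.mem V) z.2⟩ :=
  onSections_complex_d a rfl V z

theorem tilde_comp_dTot [CompactSpace X] (a a' c : F.ClosedForm m)
    (h : F.Section ((m : ℤ) - 1) 2)
    (hh : ∀ V : X.affineOpens, SymExt.koszul (F.dU V.1) (h.val V) = a.val V - a'.val V) (i n : ℤ) :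
    h.tilde i n ≫ c.dTot i n = c.dTot i n ≫ h.tilde i (n + 1) + (a.dTot i n - a'.dTot i n) := by
  obtain ⟨B, hB⟩ := F.exists_hasFrames
  refine totSheaf_hom_ext hB fun V z hV => ?_
  have l : onSections (h.tilde i n ≫ c.dTot i n) V.1 (secOf F m i n V.1 z) =
      secOf F m i (n + 1) V.1 ⟨_, SymExt.totD_mem_tot (F.dU V.1) (c.mem V)
        (SymExt.mul_mem_tot (-1) 1 (by ring) (by ring) (add_zero n) (h.mem V) z.2)⟩ :=
    (congrArg (onSections (c.dTot i n) V.1) (onSections_tilde h V z)).trans (onSections_dTot c V _)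
  have r : onSections (c.dTot i n ≫ h.tilde i (n + 1)) V.1 (secOf F m i n V.1 z) =
      secOf F m i (n + 1) V.1 ⟨_, SymExt.mul_mem_tot (-1) 1 (by ring) (by ring) (add_zero (n + 1))
        (h.mem V) (SymExt.totD_mem_tot (F.dU V.1) (c.mem V) z.2)⟩ :=
    (congrArg (onSections (h.tilde i (n + 1)) V.1) (onSections_dTot c V z)).trans
      (onSections_tilde h V _)
  have e := congrArg₂ (fun s t : Γ(F.totSheaf m i (n + 1), V.1) => s - t)
    (onSections_dTot a V z) (onSections_dTot a' V z)
  have e' : onSections (a.dTot i n - a'.dTot i n) V.1 (secOf F m i n V.1 z) =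
      onSections (a.dTot i n) V.1 (secOf F m i n V.1 z) -
        onSections (a'.dTot i n) V.1 (secOf F m i n V.1 z) := rfl
  rw [onSections_add, l, r, e']
  rw [e, ← map_sub, ← map_add]
  refine congrArg _ (Subtype.ext ?_)
  exact SymExt.totD_mul_of_mem_piece_two (F.dU V.1) (h.mem V) (hh V) (c.val V) z.1

/-- Homotopic forms have isomorphic total complexes. -/
theorem exists_iso_of_homotopy {κ : Type u} [Field κ] [CharZero κ]
    (s : X ⟶ Spec (CommRingCat.of κ)) [CompactSpace X] (a a' : F.ClosedForm m)
    (h : F.Section ((m : ℤ) - 1) 2)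
    (hh : ∀ V : X.affineOpens, SymExt.koszul (F.dU V.1) (h.val V) = a.val V - a'.val V) (i : ℤ) :
    ∃ e : a'.complex i ≅ a.complex i, ∀ n : ℤ, e.hom.f n = expEnd (-(h.tilde i n)) := by
  have hnil : ∀ n, IsNilpotent (-(h.tilde i n)) := fun n => (isNilpotent_tilde h i n).neg
  have hiso : ∀ n, IsIso (C := X.Modules) (X := F.totSheaf m i n) (expEnd (-(h.tilde i n))) :=
    fun n => (isUnit_iff_isIso _).mp (isUnit_expEnd (hnil n))
  have hcomm : ∀ n, (expEnd (-(h.tilde i n)) : F.totSheaf m i n ⟶ F.totSheaf m i n) ≫ a.dTot i n =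
      a'.dTot i n ≫ (expEnd (-(h.tilde i (n + 1))) :
        F.totSheaf m i (n + 1) ⟶ F.totSheaf m i (n + 1)) := fun n => by
    -- The commutator formula for `D_a` gives the first hypothesis of `expEnd_comp` with `Δ = D_a -
    -- D_a'`. Subtracting the formula for `D_a'` shows that `h̃` commutes with `Δ`.
    have h1 := tilde_comp_dTot a a' a h hh i n
    have h2 := tilde_comp_dTot a a' a' h hh i n
    have key := expEnd_comp (isUnit_natCast_end s _) (isUnit_natCast_end s _) (hnil n)
      (hnil (n + 1)) (a.dTot i n) (a.dTot i n - a'.dTot i n)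
      (by
        refine (Preadditive.neg_comp _ _).trans ?_
        refine Eq.trans ?_ (congrArg (· - _) (Preadditive.comp_neg _ _).symm)
        rw [h1]
        abel)
      (by
        refine (Preadditive.neg_comp _ _).trans (Eq.trans ?_ (Preadditive.comp_neg _ _).symm)
        rw [Preadditive.comp_sub, Preadditive.sub_comp, h1, h2]
        abel)
    rwa [sub_sub_cancel] at key
  refine ⟨HomologicalComplex.Hom.isoOfComponents
    (fun n => @asIso X.Modules _ (F.totSheaf m i n) (F.totSheaf m i n) _ (hiso n)) ?_, fun n => rfl⟩
  rintro n _ rfl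
  exact hcomm n

end TwoTerm

end AlgebraicGeometry.EulerK

/-! ### Homotopy invariance of nondegeneracy, and the theorem -/

theorem SymExt.koszul_zero {R M₀ M₁ : Type*} [CommRing R] [AddCommGroup M₀] [Module R M₀]
    [AddCommGroup M₁] [Module R M₁] (x : SymExt R M₀ M₁) :
    SymExt.koszul (0 : M₁ →ₗ[R] M₀) x = 0 := by
  induction x using SymExt.mono_induction with
  | h0 => exact map_zero _
  | hadd x y hx hy => rw [map_add, hx, hy, add_zero]
  | hsmul r x hx => rw [map_smul, hx, smul_zero]
  | hmono c b =>
    induction b with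
    | nil => exact SymExt.koszul_mono_nil _ c
    | cons b l ih =>
      rw [SymExt.mono_cons, SymExt.koszul_ι_mul, ih, LinearMap.zero_apply, map_zero,
        TensorProduct.zero_tmul, zero_mul, mul_zero, sub_zero]

namespace AlgebraicGeometry.EulerK

/-- The composite of `d` with the projection to `H₀` is zero, so `d h` maps to zero in `Sym H₀ ⊗ Λ`
of the fibre of `M₁`. Hence the same `c` represents both forms. -/
theorem FibreNondegenerate.of_homotopy {R M₀ M₁ : Type u} [CommRing R] [AddCommGroup M₀]
    [Module R M₀] [AddCommGroup M₁] [Module R M₁] {κ : Type u} [Field κ] {φ : R →+* κ}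
    {d : M₁ →ₗ[R] M₀} {a a' h : SymExt R M₀ M₁} (ha : FibreNondegenerate φ d a)
    (hh : SymExt.koszul d h = a - a') : FibreNondegenerate φ d a' := by
  let _ := φ.toAlgebra
  obtain ⟨c, hc, hv⟩ := ha
  refine ⟨c, hc.trans ?_, hv⟩
  rw [← sub_eq_zero, ← map_sub, ← hh]
  refine (SymExt.map_koszul φ _ _ d 0 (fun x => ?_) h).trans (SymExt.koszul_zero _)
  rw [LinearMap.zero_apply]
  refine (Submodule.Quotient.mk_eq_zero _).mpr ⟨toFibre φ M₁ x, ?_⟩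
  exact LinearMap.baseChange_tmul (A := κ) d 1 x

namespace TwoTerm

variable {X : Scheme.{u}} {Φ F : TwoTerm X} {m : ℕ}

theorem ClosedForm.Nondegenerate.of_homotopy {a a' : F.ClosedForm m} (ha : a.Nondegenerate)
    (h : F.Section ((m : ℤ) - 1) 2)
    (hh : ∀ V : X.affineOpens, SymExt.koszul (F.dU V.1) (h.val V) = a.val V - a'.val V) :
    a'.Nondegenerate :=
  fun V x hx hc => (ha V x hx hc).of_homotopy (hh V)

/-- The image of a closed form. -/
noncomputable def Hom.pushClosed (f : TwoTerm.Hom Φ F) (α : Φ.ClosedForm m) : F.ClosedForm m where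
  toSection := f.push α.toSection
  closed V := (f.onAlg_koszul V.1 (α.val V)).symm.trans (by rw [α.closed, map_zero])

theorem Ke_eq_of_homotopy {κ : Type u} [Field κ] [IsAlgClosed κ] [CharZero κ]
    (s : X ⟶ Spec (CommRingCat.of κ)) [LocallyOfFiniteType s] [CompactSpace X]
    (hm : 1 ≤ m) {a a' : F.ClosedForm m} (ha : a.Nondegenerate)
    (ha' : a'.Nondegenerate) (h : F.Section ((m : ℤ) - 1) 2)
    (hh : ∀ V : X.affineOpens, SymExt.koszul (F.dU V.1) (h.val V) = a.val V - a'.val V) :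
    a.Ke = a'.Ke :=
  Ke_eq_of_quasiIso s ha' ha hm fun i _ => by
    obtain ⟨e, -⟩ := exists_iso_of_homotopy s a a' h hh i
    exact ⟨e.hom, inferInstance⟩

theorem Ke_eq_of_isQuasiIso {κ : Type u} [Field κ] [IsAlgClosed κ] [CharZero κ]
    (s : X ⟶ Spec (CommRingCat.of κ)) [LocallyOfFiniteType s] [CompactSpace X]
    (hm : 1 ≤ m) {α : Φ.ClosedForm m} {a : F.ClosedForm m}
    (hα : α.Nondegenerate) (ha : a.Nondegenerate) {f : TwoTerm.Hom Φ F} (hf : f.IsQuasiIso)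
    (h : f.push α.toSection = a.toSection) : a.Ke = α.Ke :=
  Ke_eq_of_quasiIso s hα ha hm fun i _ => ⟨f.total α a h i, hf.quasiIso_total s α a h i⟩

end TwoTerm

end AlgebraicGeometry.EulerK

theorem mainTheorem2 (X : Scheme.{0}) (s : X ⟶ Spec (CommRingCat.of ℂ)) [LocallyOfFiniteType s]
    [QuasiCompact s] (m : ℕ) (hm : 1 ≤ m) :
    -- the classes `cl(K_i)` exist and are well defined
    (∀ (F : EulerK.TwoTerm X) (a : F.ClosedForm m), a.Nondegenerate →
      ∀ i : ℕ, i ≤ m → ∃! c : EulerK.K0 X, EulerK.HasClass (a.complex i) c) ∧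
    -- homotopic forms, with homotopy `h`
    (∀ (F : EulerK.TwoTerm X) (a a' : F.ClosedForm m), a.Nondegenerate → a'.Nondegenerate →
      ∀ h : F.Section ((m : ℤ) - 1) 2,
        (∀ V : X.affineOpens, SymExt.koszul (F.dU V.1) (h.val V) = a.val V - a'.val V) →
        (∀ i : ℕ, i ≤ m → (∀ n : ℤ, IsNilpotent (h.tilde i n)) ∧
          ∃ e : a'.complex i ≅ a.complex i,
            ∀ n : ℤ, e.hom.f n = EulerK.expEnd (-(h.tilde i n))) ∧
        a.Ke = a'.Ke) ∧
    -- quasi-isomorphisms that map the form `α` to the form `a`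
    (∀ (Φ F : EulerK.TwoTerm X) (α : Φ.ClosedForm m) (a : F.ClosedForm m),
      α.Nondegenerate → a.Nondegenerate →
      ∀ f : EulerK.TwoTerm.Hom Φ F, f.IsQuasiIso →
        ∀ hf : f.push α.toSection = a.toSection,
          (∀ i : ℕ, i ≤ m → QuasiIso (f.total α a hf i)) ∧ a.Ke = α.Ke) ∧
    -- quasi-isomorphisms that map the form `α` to a form homotopic to `a`
    (∀ (Φ F : EulerK.TwoTerm X) (α : Φ.ClosedForm m) (a : F.ClosedForm m),
      α.Nondegenerate → a.Nondegenerate →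
      ∀ f : EulerK.TwoTerm.Hom Φ F, f.IsQuasiIso →
        ∀ h : F.Section ((m : ℤ) - 1) 2,
          (∀ V : X.affineOpens, SymExt.koszul (F.dU V.1) (h.val V) =
            a.val V - (f.push α.toSection).val V) →
          a.Ke = α.Ke) := by
  have : CompactSpace X := QuasiCompact.compactSpace_of_compactSpace s
  refine ⟨fun F a ha i hi => ?_, fun F a a' ha ha' h hh => ⟨fun i _ =>
    ⟨fun n => EulerK.TwoTerm.isNilpotent_tilde h i n,
      EulerK.TwoTerm.exists_iso_of_homotopy s a a' h hh i⟩,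
      EulerK.TwoTerm.Ke_eq_of_homotopy s hm ha ha' h hh⟩,
    fun Φ F α a hα ha f hf h => ⟨fun i _ => hf.quasiIso_total s α a h i,
      EulerK.TwoTerm.Ke_eq_of_isQuasiIso s hm hα ha hf h⟩, fun Φ F α a hα ha f hf h hh => ?_⟩
  · obtain ⟨c, hc⟩ := ha.exists_hasClass s hm hi
    exact ⟨c, hc, fun c' hc' => hc'.unique hc⟩
  -- The image of `α` serves as intermediate form: it is homotopic to `a`, hence nondegenerate, and
  -- `f` maps `α` to it exactly.
  · have ha' : (f.pushClosed α).Nondegenerate := ha.of_homotopy h hh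
    exact (EulerK.TwoTerm.Ke_eq_of_homotopy s hm ha ha' h hh).trans
      (EulerK.TwoTerm.Ke_eq_of_isQuasiIso s hm hα ha' hf rfl)
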